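/- **Channel.** Fix $k\ge 1$, centres $c=(c_0,\dots,c_k)\in\mathbb R^{k+1}$, radii $r=(r_0,\dots,r_k)$ with $r_i\ge 0$, and a power $P$. The time-varying Gaussian ISI channel is $$y_t=\sum_{i=0}^k h_{t,i}\,x_{t-i}+z_t,\qquad t=1,2,\dots,$$ where $z_1,z_2,\dots$ are i.i.d. $N(0,1)$ and the random taps satisfy $h_{t,i}\in[c_i-r_i,c_i+r_i]$ almost surely; their joint law is otherwise arbitrary and unknown to transmitter and receiver, and message, taps and noise are independent. For block length $n$ put $m=n+k$; then $y=Hx+z$, where $x\in\mathbb R^n$ is the input (with $x_t=0$ for $t\notin\{1,\dots,n\}$), $y,z\in\mathbb R^m$, and $H$ is the $m\times n$ matrix with $H_{i,j}=h_{i,i-j}$ if $0\le i-j\le k$ and $0$ otherwise. Let $H_c$ be the $m\times n$ matrix with entries $c_{i-j}$ if $0\le i-j\le k$ and $0$ otherwise. **Capacity.** A rate $R\ge 0$ is achievable if there are encoder-decoder pairs, one for each block length $n$ and not depending on the law of the taps, for $\lceil 2^{nR}\rceil$ equiprobable messages, whose codewords satisfy $\mathbb E\|x\|_2^2\le nP$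 (average over the messages) and whose decoding error probability $p_{e,n}$ tends to $0$ as $n\to\infty$ for every admissible joint law of the taps. $C^*$ is the supremum of all achievable rates. **Notation.** $\log$ is to base $2$; $x^+=\max\{0,x\}$; $\|r\|_2^2=\sum_i r_i^2$; $r_s=\sum_i r_i$; $f(\omega)=\sum_{l=0}^k c_l e^{\sqrt{-1}\,l\omega}$; $\alpha=\min_{\omega\in[0,2\pi]}|f(\omega)|$; $\beta=\max_{\omega\in[0,2\pi]}|f(\omega)|$. For positive-definite matrices $\Sigma_n\in\mathbb R^{n\times n}$ put $$\phi_{1,n}=\frac{r_s(r_s+2\beta)\lambda_{\max}(\Sigma_n)}{1+\alpha^2\lambda_{\min}(\Sigma_n)},\quad \phi_{2,n}=r_s(r_s+2\beta)\frac{\mathrm{tr}(\Sigma_n)}{m},\quad \phi_{3,n}=\frac{1}{1+r_s(r_s+2\beta)\lambda_{\max}(\Sigma_n)},$$ $$\delta_n=-\tfrac12\log(1-\phi_{1,n})+\frac{1}{2\ln 2}\bigl(1-(1-\phi_{2,n})^+\phi_{3,n}\bigr).$$ **Theorem.** Let $\Sigma_n$ be positive-definite $n\times n$ matrices with $\mathrm{tr}(\Sigma_n)\le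 nP$ for all $n$ and $\lambda_{\max}(\Sigma_n)/n\to 0$, and assume $\phi_{1,n}<1$ for all $n$. Then $$C^*\ \ge\ C^*_{LB}:=\liminf_{n\to\infty}\Bigl(\frac1{2n}\log\det(I_n+H_c^TH_c\Sigma_n)-\log\Bigl(1+(k+1)\|r\|_2^2\,\frac{\mathrm{tr}(\Sigma_n)}{m+n}\Bigr)-\delta_n\Bigr)$$ (as an inequality between extended real numbers). Moreover, $C^*_{LB}$ is achieved by Gaussian random codes with a joint-typicality decoder tuned to $H_c$: for every $0\le R<C^*_{LB}$ there are thresholds $\varepsilon>0$ and $\eta_n>0$, not depending on the law of the taps, such that, for every admissible joint law of the taps, the following error probability tends to $0$ as $n\to\infty$. The $\lceil 2^{nR}\rceil$ codewords $x_i$ are drawn independently from $N(0,\Sigma_n)$ (independently of message, taps and noise), and the decoder outputs the unique index $i$ with $$x_i\in\mathcal T^{(n)}_{\varepsilon}(\Sigma_n),\qquad \begin{bmatrix}x_i\\ y\end{bmatrix}\in\mathcal T^{(m+n)}_{\eta_n}(\Xi_n),\qquad \Xi_n=\begin{bmatrix}\Sigma_n&\Sigma_nH_c^T\\ H_c\Sigma_n&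 I_m+H_c\Sigma_nH_c^T\end{bmatrix},$$ an error being declared if there is no such index or more than one. Here $\mathcal T^{(d)}_\eta(\Sigma)=\{a\in\mathbb R^d: |\tfrac1d a^T\Sigma^{-1}a-1|<\eta\}$, and the error probability is averaged over the random code, the uniform message, the taps and the noise. -/

import Mathlib

open MeasureTheory ProbabilityTheory Filter Topology

noncomputable section

namespace ISI

/-! ### Channel

Time slots are numbered from `0`; a block of `n` inputs produces `m = n + k` outputs. -/

/-- An array of channel taps: `h t i` is the `i`-th tap during time slot `t`. -/
abbrev Taps (k : ℕ) : Type := ℕ → Fin (k + 1) → ℝ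

/-- The `(n + k) × n` channel matrix, with entry `h t (t - j)` at `(t, j)` when `0 ≤ t - j ≤ k`
and `0` elsewhere. -/
def channelMatrix {k : ℕ} (n : ℕ) (h : Taps k) : Matrix (Fin (n + k)) (Fin n) ℝ :=
  Matrix.of fun t j =>
    if hj : (j : ℕ) ≤ t ∧ (t : ℕ) - j ≤ k then h t ⟨(t : ℕ) - j, Nat.lt_succ_of_le hj.2⟩ else 0

/-- The matrix `H_c` of the time-invariant channel with taps `c`. -/
def centreMatrix {k : ℕ} (n : ℕ) (c : Fin (k + 1) → ℝ) : Matrix (Fin (n + k)) (Fin n) ℝ :=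
  channelMatrix n fun _ => c

/-- `ν` is a possible joint law of the tap array: a probability measure under which each tap
`h t i` lies in `[c i - r i, c i + r i]` almost surely.  Nothing else is assumed of it. -/
structure IsTapLaw {k : ℕ} (c r : Fin (k + 1) → ℝ) (ν : Measure (Taps k)) : Prop where
  prob : IsProbabilityMeasure ν
  supp : ∀ t i, ∀ᵐ h ∂ν, h t i ∈ Set.Icc (c i - r i) (c i + r i)

/-- White Gaussian noise of unit variance. -/
def noise (m : ℕ) : Measure (Fin m → ℝ) := Measure.pi fun _ => gaussianReal 0 1

/-- The channel output `H x + z`. -/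
def output {k n : ℕ} (h : Taps k) (x : Fin n → ℝ) (z : Fin (n + k) → ℝ) : Fin (n + k) → ℝ :=
  (channelMatrix n h).mulVec x + z

/-! ### Codes and capacity -/

/-- The number of messages `2 ^ (n R)`, rounded up. -/
def numMessages (n : ℕ) (R : ℝ) : ℕ := ⌈(2 : ℝ) ^ ((n : ℝ) * R)⌉₊

/-- An encoder-decoder pair with `M` messages and codewords of length `n`. -/
structure BlockCode (k n M : ℕ) where
  enc : Fin M → Fin n → ℝ
  dec : (Fin (n + k) → ℝ) → Fin M
  measurable_dec : Measurable dec

/-- Average power constraint, the message being uniformly distributed. -/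
def BlockCode.PowerConstraint {k n M : ℕ} (C : BlockCode k n M) (P : ℝ) : Prop :=
  (M : ℝ)⁻¹ * ∑ w, ∑ t, C.enc w t ^ 2 ≤ n * P

/-- The probability of decoding error when the message is uniform, the taps have law `ν`, and
message, taps and noise are independent. -/
def BlockCode.errorProb {k n M : ℕ} (C : BlockCode k n M) (ν : Measure (Taps k)) : ℝ :=
  (M : ℝ)⁻¹ * ∑ w,
    (ν.prod (noise (n + k))).real {p | C.dec (output p.1 (C.enc w) p.2) ≠ w}

/-- `R` is achievable: some sequence of encoder-decoder pairs, which does not depend on the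
law of the taps, has vanishing error probability whatever that law is. -/
def Achievable {k : ℕ} (c r : Fin (k + 1) → ℝ) (P R : ℝ) : Prop :=
  0 ≤ R ∧ ∃ C : ∀ n, BlockCode k n (numMessages n R),
    (∀ n, (C n).PowerConstraint P) ∧
    ∀ ν : Measure (Taps k), IsTapLaw c r ν →
      Tendsto (fun n => (C n).errorProb ν) atTop (𝓝 0)

/-- The capacity `C*(c, r, P)`. -/
def capacity {k : ℕ} (c r : Fin (k + 1) → ℝ) (P : ℝ) : EReal :=
  sSup ((fun R : ℝ => (R : EReal)) '' {R | Achievable c r P R})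

/-! ### The lower bound -/

/-- Largest eigenvalue of a real symmetric matrix. -/
def lamMax {n : ℕ} (A : Matrix (Fin n) (Fin n) ℝ) : ℝ := sSup (spectrum ℝ A)

/-- Smallest eigenvalue of a real symmetric matrix. -/
def lamMin {n : ℕ} (A : Matrix (Fin n) (Fin n) ℝ) : ℝ := sInf (spectrum ℝ A)

/-- `|f(ω)|`, where `f(ω) = ∑ₗ cₗ exp(i l ω)`. -/
def gain {k : ℕ} (c : Fin (k + 1) → ℝ) (ω : ℝ) : ℝ :=
  ‖∑ l : Fin (k + 1), (c l : ℂ) * Complex.exp (Complex.I * ((l : ℕ) : ℂ) * (ω : ℂ))‖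

/-- The minimum of `|f|` over `[0, 2π]`. -/
def alpha {k : ℕ} (c : Fin (k + 1) → ℝ) : ℝ := sInf (gain c '' Set.Icc 0 (2 * Real.pi))

/-- The maximum of `|f|` over `[0, 2π]`. -/
def beta {k : ℕ} (c : Fin (k + 1) → ℝ) : ℝ := sSup (gain c '' Set.Icc 0 (2 * Real.pi))

/-- The sum of the radii. -/
def rSum {k : ℕ} (r : Fin (k + 1) → ℝ) : ℝ := ∑ i, r i

def phi1 {k n : ℕ} (c r : Fin (k + 1) → ℝ) (S : Matrix (Fin n) (Fin n) ℝ) : ℝ :=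
  rSum r * (rSum r + 2 * beta c) * lamMax S / (1 + alpha c ^ 2 * lamMin S)

def phi2 {k n : ℕ} (c r : Fin (k + 1) → ℝ) (S : Matrix (Fin n) (Fin n) ℝ) : ℝ :=
  rSum r * (rSum r + 2 * beta c) * (S.trace / ((n : ℝ) + k))

def phi3 {k n : ℕ} (c r : Fin (k + 1) → ℝ) (S : Matrix (Fin n) (Fin n) ℝ) : ℝ :=
  1 / (1 + rSum r * (rSum r + 2 * beta c) * lamMax S)

/-- The loss `δₙ`, in bits. -/
def delta {k n : ℕ} (c r : Fin (k + 1) → ℝ) (S : Matrix (Fin n) (Fin n) ℝ) : ℝ :=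
  -(1 / 2) * Real.logb 2 (1 - phi1 c r S)
    + 1 / (2 * Real.log 2) * (1 - max 0 (1 - phi2 c r S) * phi3 c r S)

/-- The `n`-th term of the lower bound; here `m + n = (n + k) + n`. -/
def boundTerm {k n : ℕ} (c r : Fin (k + 1) → ℝ) (S : Matrix (Fin n) (Fin n) ℝ) : ℝ :=
  1 / (2 * (n : ℝ)) *
      Real.logb 2 (1 + (centreMatrix n c).transpose * centreMatrix n c * S).det
    - Real.logb 2 (1 + ((k : ℝ) + 1) * (∑ i, r i ^ 2) * (S.trace / (((n : ℝ) + k) + n)))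
    - delta c r S

/-- `C*_LB`, the lower limit of the terms, as an extended real number. -/
def lowerBound {k : ℕ} (c r : Fin (k + 1) → ℝ) (S : ∀ n : ℕ, Matrix (Fin n) (Fin n) ℝ) : EReal :=
  liminf (fun n => ((boundTerm c r (S n) : ℝ) : EReal)) atTop

/-! ### Gaussian random codes and the joint-typicality decoder -/

/-- The law `N(0, S)` on `ℝⁿ`. -/
def codewordLaw {n : ℕ} (S : Matrix (Fin n) (Fin n) ℝ) : Measure (Fin n → ℝ) :=
  (multivariateGaussian 0 S).map WithLp.ofLp

/-- The Gaussian typical set `{a : |aᵀ S⁻¹ a / d - 1| < η}` of `N(0, S)`, where `d` is the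
dimension. -/
def typicalSet {ι : Type} [Fintype ι] [DecidableEq ι] (S : Matrix ι ι ℝ) (η : ℝ) : Set (ι → ℝ) :=
  {a | |1 / (Fintype.card ι : ℝ) * dotProduct a (S⁻¹.mulVec a) - 1| < η}

/-- The covariance matrix of `(x, H_c x + z)` for `x ∼ N(0, S)` and `z ∼ N(0, I)` independent. -/
def jointCov {k n : ℕ} (c : Fin (k + 1) → ℝ) (S : Matrix (Fin n) (Fin n) ℝ) :
    Matrix (Fin n ⊕ Fin (n + k)) (Fin n ⊕ Fin (n + k)) ℝ :=
  Matrix.fromBlocks S (S * (centreMatrix n c).transpose)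
    (centreMatrix n c * S) (1 + centreMatrix n c * S * (centreMatrix n c).transpose)

/-- The test of the joint-typicality decoder tuned to `H_c` for a codeword `x` and an
output `y`. -/
def JointlyTypical {k n : ℕ} (c : Fin (k + 1) → ℝ) (S : Matrix (Fin n) (Fin n) ℝ) (ε η : ℝ)
    (x : Fin n → ℝ) (y : Fin (n + k) → ℝ) : Prop :=
  x ∈ typicalSet S ε ∧ Sum.elim x y ∈ typicalSet (jointCov c S) η

open Classical in
/-- The joint-typicality decoder for the codebook `X`: it outputs the unique index that passes
the test, and declares a failure (`none`) if no index or more than one index passes. -/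
def jtDecode {k n M : ℕ} (c : Fin (k + 1) → ℝ) (S : Matrix (Fin n) (Fin n) ℝ) (ε η : ℝ)
    (X : Fin M → Fin n → ℝ) (y : Fin (n + k) → ℝ) : Option (Fin M) :=
  if h : ∃! i, JointlyTypical c S ε η (X i) y then some h.choose else none

/-- The error probability of the joint-typicality decoder, averaged over the Gaussian random
code with `M` independent `N(0, S)` codewords; code, message, taps and noise are independent. -/
def ensembleError {k n : ℕ} (c : Fin (k + 1) → ℝ) (S : Matrix (Fin n) (Fin n) ℝ) (ε η : ℝ)
    (M : ℕ) (ν : Measure (Taps k)) : ℝ :=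
  (M : ℝ)⁻¹ * ∑ w : Fin M,
    ((Measure.pi fun _ : Fin M => codewordLaw S).prod (ν.prod (noise (n + k)))).real
      {p | jtDecode c S ε η p.1 (output p.2.1 (p.1 w) p.2.2) ≠ some w}

end ISI

end

/-!
Fix a tap sequence in the box `[cᵢ - rᵢ, cᵢ + rᵢ]`. The true codeword passes the test tuned to `H_c`
by Chebyshev's inequality. Each wrong one passes with probability at most a Gaussian density ratio
whose determinant is that of the true output covariance, which the bound
`det(1 + HᵀHS) ≥ (1 - φ₁)ⁿ det(1 + H_cᵀH_cS)` compares with the determinant of the nominal one.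
Hence the ensemble error tends to `0` below the lower bound, uniformly over the tap sequences.

Capacity requires one code for all tap laws, and a random code that is good on average need not be
good for every law. Following Ahlswede's elimination, `2 ^ L` independent codebooks with `L ~ log n`
are, on average over the codebooks, good for every tap sequence of a finite grid at once (Hoeffding
and a union bound); a noise shift bound extends this from the grid to the whole box. The index of
the codebook is sent uncoded in a short prefix of spaced pulses, through a tap with `rₐ < |cₐ|`;
such a tap exists as soon as the lower bound is positive.
-/

namespace ISI

open scoped ENNReal NNReal Matrix

section Density

variable {ι : Type*} [Fintype ι]

/-- The standard Gaussian measure on `ι → ℝ`; `noise m` is the case `ι = Fin m`. -/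
noncomputable def stdNormal (ι : Type*) [Fintype ι] : Measure (ι → ℝ) :=
  Measure.pi fun _ => gaussianReal 0 1

/-- The Lebesgue density of the standard Gaussian measure on `ι → ℝ`. -/
noncomputable def gaussDensity (x : ι → ℝ) : ℝ≥0∞ :=
  ENNReal.ofReal ((√(2 * Real.pi))⁻¹ ^ Fintype.card ι * Real.exp (-(x ⬝ᵥ x) / 2))

instance : IsProbabilityMeasure (stdNormal ι) := by
  unfold stdNormal; infer_instance

instance (m : ℕ) : IsProbabilityMeasure (noise m) :=
  inferInstanceAs (IsProbabilityMeasure (stdNormal (Fin m)))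

theorem measurable_gaussDensity : Measurable (gaussDensity : (ι → ℝ) → ℝ≥0∞) := by
  unfold gaussDensity dotProduct
  fun_prop

theorem gaussDensity_eq_prod (x : ι → ℝ) :
    gaussDensity x = ENNReal.ofReal (∏ i, gaussianPDFReal 0 1 (x i)) := by
  simp only [gaussDensity, gaussianPDFReal, sub_zero, NNReal.coe_one, mul_one,
    Finset.prod_mul_distrib, Finset.prod_const, Finset.card_univ, ← Real.exp_sum, dotProduct,
    ← Finset.sum_div, Finset.sum_neg_distrib, sq]

theorem stdNormal_eq_withDensity : stdNormal ι = volume.withDensity gaussDensity := by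
  refine Measure.pi_eq fun s hs => ?_
  have hint : ∀ i, Integrable (gaussianPDFReal 0 1) (volume.restrict (s i)) := fun i =>
    (integrable_gaussianPDFReal 0 1).restrict
  have hnn : ∀ t, 0 ≤ gaussianPDFReal 0 1 t := gaussianPDFReal_nonneg 0 1
  rw [withDensity_apply _ (MeasurableSet.univ_pi hs), volume_pi, Measure.restrict_pi_pi]
  simp only [gaussDensity_eq_prod, gaussianReal_apply_eq_integral 0 one_ne_zero]
  rw [← ofReal_integral_eq_lintegral_ofReal (Integrable.fintype_prod hint)
      (ae_of_all _ fun x => Finset.prod_nonneg fun i _ => hnn (x i)),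
    integral_fintype_prod_eq_prod,
    ENNReal.ofReal_prod_of_nonneg fun i _ => integral_nonneg hnn]

theorem lintegral_gaussDensity : ∫⁻ x : ι → ℝ, gaussDensity x = 1 := by
  rw [← setLIntegral_univ, ← withDensity_apply _ MeasurableSet.univ, ← stdNormal_eq_withDensity,
    measure_univ]

theorem stdNormal_preimage_add_left (a : ι → ℝ) {A : Set (ι → ℝ)} (hA : MeasurableSet A) :
    stdNormal ι ((a + ·) ⁻¹' A) = ∫⁻ y in A, gaussDensity (y - a) := by
  have hpre : MeasurableSet ((a + ·) ⁻¹' A) := measurable_const_add a hA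
  rw [stdNormal_eq_withDensity, withDensity_apply _ hpre, ← lintegral_indicator hpre,
    ← lintegral_indicator hA,
    ← lintegral_sub_right_eq_self (Set.indicator ((a + ·) ⁻¹' A) gaussDensity) a]
  refine lintegral_congr fun y => ?_
  by_cases hy : y ∈ A <;> simp [hy]

theorem gaussDensity_sub_le (a y : ι → ℝ) {t : ℝ} (ht : 0 < t) :
    gaussDensity (y - a) ≤ ENNReal.ofReal t * gaussDensity y
      + ENNReal.ofReal (Real.exp (a ⬝ᵥ a) / t) * gaussDensity (y - (2 : ℝ) • a) := by
  unfold gaussDensity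
  rw [← ENNReal.ofReal_mul ht.le, ← ENNReal.ofReal_mul (by positivity),
    ← ENNReal.ofReal_add (by positivity) (by positivity)]
  refine ENNReal.ofReal_le_ofReal ?_
  set C := (√(2 * Real.pi))⁻¹ ^ Fintype.card ι
  set p := Real.exp (-(y ⬝ᵥ y) / 2)
  set ℓ := Real.exp (a ⬝ᵥ y - a ⬝ᵥ a / 2)
  have hone : Real.exp (-((y - a) ⬝ᵥ (y - a)) / 2) = p * ℓ := by
    rw [← Real.exp_add]
    congr 1
    simp only [sub_dotProduct, dotProduct_sub, dotProduct_comm y a]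
    ring
  have htwo : Real.exp (a ⬝ᵥ a) * Real.exp (-((y - (2 : ℝ) • a) ⬝ᵥ (y - (2 : ℝ) • a)) / 2)
      = p * ℓ ^ 2 := by
    rw [← Real.exp_nat_mul, ← Real.exp_add, ← Real.exp_add]
    congr 1
    simp only [sub_dotProduct, dotProduct_sub, smul_dotProduct, dotProduct_smul, smul_eq_mul,
      dotProduct_comm y a]
    push_cast
    ring
  have hamgm : ℓ ≤ t + ℓ ^ 2 / t := by
    rw [← sub_nonneg, show t + ℓ ^ 2 / t - ℓ = ((t - ℓ / 2) ^ 2 + 3 / 4 * ℓ ^ 2) / t by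
      field_simp; ring]
    positivity
  calc C * Real.exp (-((y - a) ⬝ᵥ (y - a)) / 2) = C * p * ℓ := by rw [hone]; ring
    _ ≤ C * p * (t + ℓ ^ 2 / t) := by gcongr
    _ = t * (C * p) + C * (p * ℓ ^ 2) / t := by ring
    _ = _ := by rw [← htwo]; ring

/-- The constant is the second moment of the likelihood ratio: `∫ p(y - a)² / p(y) dy = e^{|a|²}`,
where `p` is the density. -/
theorem stdNormal_add_left_le (a : ι → ℝ) {A : Set (ι → ℝ)} (hA : MeasurableSet A) {t : ℝ}
    (ht : 0 < t) :
    (stdNormal ι).real ((a + ·) ⁻¹' A) ≤ t * (stdNormal ι).real A + Real.exp (a ⬝ᵥ a) / t := by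
  have hmeas : Measurable fun y => gaussDensity (y - (2 : ℝ) • a) :=
    measurable_gaussDensity.comp (measurable_id.sub_const _)
  have key : stdNormal ι ((a + ·) ⁻¹' A) ≤
      ENNReal.ofReal t * stdNormal ι A + ENNReal.ofReal (Real.exp (a ⬝ᵥ a) / t) := calc
    _ = ∫⁻ y in A, gaussDensity (y - a) := stdNormal_preimage_add_left a hA
    _ ≤ ∫⁻ y in A, (ENNReal.ofReal t * gaussDensity y
          + ENNReal.ofReal (Real.exp (a ⬝ᵥ a) / t) * gaussDensity (y - (2 : ℝ) • a)) :=
        lintegral_mono fun y => gaussDensity_sub_le a y ht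
    _ = ENNReal.ofReal t * stdNormal ι A
          + ENNReal.ofReal (Real.exp (a ⬝ᵥ a) / t) * stdNormal ι (((2 : ℝ) • a + ·) ⁻¹' A) := by
        rw [lintegral_add_left (measurable_gaussDensity.const_mul _),
          lintegral_const_mul _ measurable_gaussDensity, lintegral_const_mul _ hmeas,
          stdNormal_preimage_add_left _ hA, stdNormal_eq_withDensity, withDensity_apply _ hA]
    _ ≤ _ := by
        gcongr
        exact mul_le_of_le_one_right' prob_le_one
  have := ENNReal.toReal_mono (by finiteness) key
  rwa [ENNReal.toReal_add (by finiteness) (by finiteness), ENNReal.toReal_mul,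
    ENNReal.toReal_ofReal ht.le, ENNReal.toReal_ofReal (by positivity)] at this

theorem lintegral_gaussDensity_mulVec [DecidableEq ι] {T : Matrix ι ι ℝ} (hT : T.det ≠ 0) :
    ∫⁻ w, gaussDensity (T *ᵥ w) = ENNReal.ofReal |T.det|⁻¹ := by
  have hmap := lintegral_map (μ := volume) measurable_gaussDensity
    (Matrix.toLin' T).continuous_of_finiteDimensional.measurable
  simp only [Real.map_matrix_volume_pi_eq_smul_volume_pi hT, lintegral_smul_measure,
    lintegral_gaussDensity, Matrix.toLin'_apply] at hmap
  simpa [abs_inv] using hmap.symm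

/-- The event says that the likelihood ratio between the laws of `w` and `T⁻¹ w` is bounded. -/
theorem stdNormal_mulVec_le [DecidableEq ι] {T : Matrix ι ι ℝ} (hT : T.det ≠ 0) (s : ℝ) :
    (stdNormal ι).real {w | (T *ᵥ w) ⬝ᵥ (T *ᵥ w) ≤ w ⬝ᵥ w + s} ≤ Real.exp (s / 2) / |T.det| := by
  set A := {w : ι → ℝ | (T *ᵥ w) ⬝ᵥ (T *ᵥ w) ≤ w ⬝ᵥ w + s}
  have hmul : Continuous fun w : ι → ℝ => T *ᵥ w := continuous_const.matrix_mulVec continuous_id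
  have hA : MeasurableSet A := (isClosed_le (hmul.dotProduct hmul)
    ((continuous_id.dotProduct continuous_id).add continuous_const)).measurableSet
  have hmeas : Measurable fun w => gaussDensity (T *ᵥ w) :=
    measurable_gaussDensity.comp hmul.measurable
  have hpt : ∀ w ∈ A, gaussDensity w ≤
      ENNReal.ofReal (Real.exp (s / 2)) * gaussDensity (T *ᵥ w) := by
    intro w hw
    unfold gaussDensity
    rw [← ENNReal.ofReal_mul (by positivity), mul_left_comm, ← Real.exp_add]
    have : (T *ᵥ w) ⬝ᵥ (T *ᵥ w) ≤ w ⬝ᵥ w + s := hw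
    gcongr
    linarith
  have key : stdNormal ι A ≤ ENNReal.ofReal (Real.exp (s / 2)) * ENNReal.ofReal |T.det|⁻¹ := calc
    _ = ∫⁻ w in A, gaussDensity w := by rw [stdNormal_eq_withDensity, withDensity_apply _ hA]
    _ ≤ ∫⁻ w in A, ENNReal.ofReal (Real.exp (s / 2)) * gaussDensity (T *ᵥ w) :=
        setLIntegral_mono' hA hpt
    _ ≤ ∫⁻ w, ENNReal.ofReal (Real.exp (s / 2)) * gaussDensity (T *ᵥ w) :=
        setLIntegral_le_lintegral _ _
    _ = _ := by
        rw [lintegral_const_mul _ hmeas, lintegral_gaussDensity_mulVec hT]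
  have := ENNReal.toReal_mono (by finiteness) key
  rwa [ENNReal.toReal_mul, ENNReal.toReal_ofReal (by positivity),
    ENNReal.toReal_ofReal (by positivity), ← div_eq_mul_inv] at this

end Density

instance {n : ℕ} (S : Matrix (Fin n) (Fin n) ℝ) : IsProbabilityMeasure (codewordLaw S) :=
  Measure.isProbabilityMeasure_map (by fun_prop)

theorem measurable_mulVec {m n : ℕ} (A : Matrix (Fin m) (Fin n) ℝ) :
    Measurable fun x : Fin n → ℝ => A *ᵥ x :=
  (Matrix.toLin' A).continuous_of_finiteDimensional.measurable

theorem noise_eq_codewordLaw_one (n : ℕ) : noise n = codewordLaw 1 := by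
  rw [codewordLaw, multivariateGaussian_zero_one, ← map_pi_eq_stdGaussian,
    Measure.map_map (by fun_prop) (by fun_prop)]
  exact Measure.map_id.symm

theorem dual_eq_dotProduct {n : ℕ} (L : StrongDual ℝ (Fin n → ℝ)) (x : Fin n → ℝ) :
    L x = x ⬝ᵥ fun i => L (Pi.single i 1) := by
  conv_lhs => rw [pi_eq_sum_univ' x]
  simp [dotProduct]

theorem posSemidef_mul_mul_transpose {m n : ℕ} {S : Matrix (Fin n) (Fin n) ℝ}
    (hS : S.PosSemidef) (A : Matrix (Fin m) (Fin n) ℝ) : (A * S * Aᵀ).PosSemidef := by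
  simpa using hS.mul_mul_conjTranspose_same A

theorem charFunDual_codewordLaw {n : ℕ} {S : Matrix (Fin n) (Fin n) ℝ} (hS : S.PosSemidef)
    (L : StrongDual ℝ (Fin n → ℝ)) {v : Fin n → ℝ} (hv : ∀ x, L x = x ⬝ᵥ v) :
    charFunDual (codewordLaw S) L = Complex.exp (-(v ⬝ᵥ S *ᵥ v : ℝ) / 2) := by
  have hofLp : (WithLp.ofLp : EuclideanSpace ℝ (Fin n) → Fin n → ℝ)
      = EuclideanSpace.equiv (Fin n) ℝ := rfl
  have hcomp : L.comp (EuclideanSpace.equiv (Fin n) ℝ : EuclideanSpace ℝ (Fin n) →L[ℝ] _)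
      = InnerProductSpace.toDualMap ℝ _ (WithLp.toLp 2 v) := by
    ext x
    exact (hv x.ofLp).trans (by simp [EuclideanSpace.inner_eq_star_dotProduct])
  rw [codewordLaw, hofLp, ← ContinuousLinearEquiv.coe_coe, charFunDual_map, hcomp,
    ← charFun_eq_charFunDual_toDualMap, charFun_multivariateGaussian hS]
  simp [neg_div]

theorem codewordLaw_map_mulVec {m n : ℕ} {S : Matrix (Fin n) (Fin n) ℝ} (hS : S.PosSemidef)
    (A : Matrix (Fin m) (Fin n) ℝ) :
    (codewordLaw S).map (A *ᵥ ·) = codewordLaw (A * S * Aᵀ) := by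
  have hA : (fun x => A *ᵥ x) = ⇑(LinearMap.toContinuousLinearMap (Matrix.toLin' A)) := by
    ext x; simp
  have : IsProbabilityMeasure ((codewordLaw S).map (A *ᵥ ·)) :=
    Measure.isProbabilityMeasure_map (measurable_mulVec A).aemeasurable
  refine Measure.ext_of_charFunDual (funext fun L => ?_)
  have hv := dual_eq_dotProduct L
  set v := fun i => L (Pi.single i 1)
  rw [charFunDual_codewordLaw (posSemidef_mul_mul_transpose hS A) L hv, hA, charFunDual_map,
    charFunDual_codewordLaw hS _ (v := v ᵥ* A) fun x => ?_]
  · simp [← Matrix.mulVec_mulVec, Matrix.dotProduct_mulVec, Matrix.mulVec_transpose]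
  · simp [hv, dotProduct_comm x, ← Matrix.dotProduct_mulVec, dotProduct_comm v]

theorem codewordLaw_conv {n : ℕ} {S T : Matrix (Fin n) (Fin n) ℝ} (hS : S.PosSemidef)
    (hT : T.PosSemidef) : codewordLaw S ∗ codewordLaw T = codewordLaw (S + T) := by
  refine Measure.ext_of_charFunDual (funext fun L => ?_)
  have hv := dual_eq_dotProduct L
  rw [charFunDual_conv, charFunDual_codewordLaw hS L hv, charFunDual_codewordLaw hT L hv,
    charFunDual_codewordLaw (hS.add hT) L hv, ← Complex.exp_add, Matrix.add_mulVec,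
    dotProduct_add]
  push_cast
  ring_nf

theorem measurePreserving_mulVec_noise {m n : ℕ} (A : Matrix (Fin m) (Fin n) ℝ) :
    MeasurePreserving (A *ᵥ ·) (noise n) (codewordLaw (A * Aᵀ)) :=
  ⟨measurable_mulVec A, by
    rw [noise_eq_codewordLaw_one, codewordLaw_map_mulVec Matrix.PosSemidef.one, Matrix.mul_one]⟩

theorem measurable_output {k n : ℕ} (h : Taps k) :
    Measurable fun p : (Fin n → ℝ) × (Fin (n + k) → ℝ) => output h p.1 p.2 :=
  ((measurable_mulVec _).comp measurable_fst).add measurable_snd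

theorem measurePreserving_output {k n : ℕ} {S : Matrix (Fin n) (Fin n) ℝ} (hS : S.PosSemidef)
    (h : Taps k) :
    MeasurePreserving (fun p : (Fin n → ℝ) × (Fin (n + k) → ℝ) => output h p.1 p.2)
      ((codewordLaw S).prod (noise (n + k)))
      (codewordLaw (1 + channelMatrix n h * S * (channelMatrix n h)ᵀ)) := by
  refine ⟨measurable_output h, ?_⟩
  rw [add_comm 1, ← codewordLaw_conv (posSemidef_mul_mul_transpose hS _) Matrix.PosSemidef.one,
    ← codewordLaw_map_mulVec hS, ← noise_eq_codewordLaw_one, Measure.conv]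
  conv_rhs => rw [← Measure.map_id (μ := noise (n + k))]
  rw [Measure.map_prod_map _ _ (measurable_mulVec _) measurable_id,
    Measure.map_map (by fun_prop) ((measurable_mulVec _).prodMap measurable_id)]
  rfl

section Chebyshev

variable {ι : Type*} [Fintype ι]

theorem measureReal_pi_le_abs_sum_sub {Ω : ι → Type*} [∀ i, MeasurableSpace (Ω i)]
    {μ : ∀ i, Measure (Ω i)} [∀ i, IsProbabilityMeasure (μ i)] {f : ∀ i, Ω i → ℝ}
    (hf : ∀ i, MemLp (f i) 2 (μ i)) {s : ℝ} (hs : 0 < s) :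
    (Measure.pi μ).real {x | s ≤ |∑ i, f i (x i) - ∑ i, ∫ y, f i y ∂μ i|}
      ≤ (∑ i, Var[f i; μ i]) / s ^ 2 := by
  have hmem : ∀ i, MemLp (fun x : ∀ i, Ω i => f i (x i)) 2 (Measure.pi μ) := fun i =>
    (hf i).comp_measurePreserving (measurePreserving_eval μ i)
  have hmean : ∫ x, (∑ i, fun x : ∀ i, Ω i => f i (x i)) x ∂Measure.pi μ
      = ∑ i, ∫ y, f i y ∂μ i := by
    simp only [Finset.sum_apply]
    rw [integral_finsetSum _ fun i _ => (hmem i).integrable (by norm_num)]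
    exact Finset.sum_congr rfl fun i _ => integral_comp_eval (hf i).aestronglyMeasurable
  have hcheb := meas_ge_le_variance_div_sq (memLp_finsetSum' Finset.univ fun i _ => hmem i) hs
  rw [hmean, variance_sum_pi hf] at hcheb
  have hvar : 0 ≤ ∑ i, Var[f i; μ i] := Finset.sum_nonneg fun i _ => variance_nonneg _ _
  simpa [Measure.real, ENNReal.toReal_ofReal (div_nonneg hvar (sq_nonneg s))] using
    ENNReal.toReal_mono (by finiteness) hcheb

theorem memLp_sq_gaussianReal : MemLp (fun x : ℝ => x ^ 2) 2 (gaussianReal 0 1) := by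
  have h4 : MemLp (id : ℝ → ℝ) 4 (gaussianReal 0 1) := memLp_id_gaussianReal 4
  rw [memLp_two_iff_integrable_sq (by fun_prop)]
  refine (h4.integrable_norm_rpow (by norm_num) (by norm_num)).congr (ae_of_all _ fun x => ?_)
  norm_num [← pow_mul, (by decide : Even 4).pow_abs]

theorem integral_sq_gaussianReal : ∫ x : ℝ, x ^ 2 ∂gaussianReal 0 1 = 1 := by
  have h := variance_id_gaussianReal (μ := 0) (v := 1)
  rw [variance_eq_integral (by fun_prop)] at h
  simpa using h

/-- The variance of the square of a standard Gaussian variable (its value is `2`), the constant in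
the Chebyshev bounds for Gaussian quadratic forms. -/
noncomputable def chiVar : ℝ := Var[fun x : ℝ => x ^ 2; gaussianReal 0 1]

theorem chiVar_nonneg : 0 ≤ chiVar := variance_nonneg _ _

theorem noise_le_abs_quadratic_sub {n : ℕ} (d : Fin n → ℝ) {s : ℝ} (hs : 0 < s) :
    (noise n).real {z | s ≤ |∑ i, d i * z i ^ 2 - ∑ i, d i|} ≤ chiVar * (∑ i, d i ^ 2) / s ^ 2 := by
  have h := measureReal_pi_le_abs_sum_sub (fun i => memLp_sq_gaussianReal.const_mul (d i)) hs
  simp only [integral_const_mul, integral_sq_gaussianReal, mul_one, variance_const_mul] at h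
  rwa [← Finset.sum_mul, mul_comm] at h

theorem noise_le_abs_normSq_sub (n : ℕ) {s : ℝ} (hs : 0 < s) :
    (noise n).real {z | s ≤ |z ⬝ᵥ z - n|} ≤ chiVar * n / s ^ 2 := by
  have h := noise_le_abs_quadratic_sub (fun _ : Fin n => (1 : ℝ)) hs
  simpa [dotProduct, sq] using h

theorem noise_le_abs_dotProduct {n : ℕ} (a : Fin n → ℝ) {s : ℝ} (hs : 0 < s) :
    (noise n).real {z | s ≤ |a ⬝ᵥ z|} ≤ (a ⬝ᵥ a) / s ^ 2 := by
  have hmean (i : Fin n) : ∫ y, a i * y ∂gaussianReal 0 1 = 0 := by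
    rw [integral_const_mul, integral_id_gaussianReal, mul_zero]
  have hvar (i : Fin n) : Var[fun y => a i * y; gaussianReal 0 1] = a i * a i := by
    rw [variance_const_mul, variance_fun_id_gaussianReal, NNReal.coe_one, mul_one, sq]
  have h := measureReal_pi_le_abs_sum_sub (μ := fun _ : Fin n => gaussianReal 0 1)
    (f := fun i x => a i * x) (fun i => (memLp_id_gaussianReal 2).const_mul (a i)) hs
  simp only [hmean, hvar, Finset.sum_const_zero, sub_zero] at h
  exact h

end Chebyshev

section ChannelMatrix

variable {k n : ℕ}

/-- The input symbol `x (t - i)` that reaches the output of slot `t` through the `i`-th tap, and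
`0` when there is no such symbol. -/
def tapInput (x : Fin n → ℝ) (t i : ℕ) : ℝ := ∑ j : Fin n, if t = i + j then x j else 0

theorem channelMatrix_apply (h : Taps k) (t : Fin (n + k)) (j : Fin n) :
    channelMatrix n h t j = ∑ i : Fin (k + 1), if (t : ℕ) = i + j then h t i else 0 := by
  simp only [channelMatrix, Matrix.of_apply]
  split_ifs with hj
  · rw [Finset.sum_eq_single_of_mem ⟨(t : ℕ) - j, Nat.lt_succ_of_le hj.2⟩ (Finset.mem_univ _)]
    · rw [if_pos (by simp only; omega)]
    · exact fun i _ hi => if_neg fun he => hi (Fin.ext (by simp only; omega))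
  · exact (Finset.sum_eq_zero fun i _ => if_neg fun he => hj (by omega)).symm

theorem channelMatrix_mulVec (h : Taps k) (x : Fin n → ℝ) (t : Fin (n + k)) :
    (channelMatrix n h *ᵥ x) t = ∑ i : Fin (k + 1), h t i * tapInput x t i := by
  simp only [Matrix.mulVec, dotProduct, channelMatrix_apply, tapInput, Finset.sum_mul,
    Finset.mul_sum, ite_mul, zero_mul, mul_ite, mul_zero]
  exact Finset.sum_comm

theorem channelMatrix_sub (h g : Taps k) :
    channelMatrix n h - channelMatrix n g = channelMatrix n (h - g) := by
  ext t j
  simp only [channelMatrix, Matrix.sub_apply, Matrix.of_apply]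
  split_ifs <;> simp

theorem tapInput_sq (x : Fin n → ℝ) (t i : ℕ) :
    tapInput x t i ^ 2 = ∑ j : Fin n, if t = i + j then x j ^ 2 else 0 := by
  unfold tapInput
  by_cases hj : ∃ j : Fin n, t = i + j
  · obtain ⟨j, rfl⟩ := hj
    simp [Fin.val_inj]
  · push Not at hj
    simp [hj]

theorem sum_tapInput_sq (x : Fin n → ℝ) (i : Fin (k + 1)) :
    ∑ t : Fin (n + k), tapInput x t i ^ 2 = x ⬝ᵥ x := by
  simp only [tapInput_sq, dotProduct]
  rw [Finset.sum_comm]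
  refine Finset.sum_congr rfl fun j _ => ?_
  rw [Finset.sum_eq_single_of_mem (⟨i + j, by omega⟩ : Fin (n + k)) (Finset.mem_univ _)
    fun t _ ht => if_neg fun he => ht (Fin.ext he), if_pos rfl, sq]

/-- Schur's test: Cauchy-Schwarz in each output slot, with the tap bound split as `a i * b i`. -/
theorem channelMatrix_energy_le_mul {h : Taps k} {a b : Fin (k + 1) → ℝ}
    (hab : ∀ (t : Fin (n + k)) i, |h t i| ≤ a i * b i) (x : Fin n → ℝ) :
    (channelMatrix n h *ᵥ x) ⬝ᵥ (channelMatrix n h *ᵥ x) ≤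
      (∑ i, a i ^ 2) * (∑ i, b i ^ 2) * (x ⬝ᵥ x) := by
  have hslot (t : Fin (n + k)) : (channelMatrix n h *ᵥ x) t * (channelMatrix n h *ᵥ x) t ≤
      (∑ i, a i ^ 2) * ∑ i : Fin (k + 1), b i ^ 2 * tapInput x t i ^ 2 := by
    have habs : |∑ i : Fin (k + 1), h t i * tapInput x t i|
        ≤ ∑ i : Fin (k + 1), a i * (b i * |tapInput x t i|) := by
      refine (Finset.abs_sum_le_sum_abs _ _).trans (Finset.sum_le_sum fun i _ => ?_)
      rw [abs_mul, ← mul_assoc]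
      gcongr
      exact hab t i
    rw [channelMatrix_mulVec, ← sq, ← sq_abs]
    calc _ ≤ (∑ i : Fin (k + 1), a i * (b i * |tapInput x t i|)) ^ 2 := by gcongr
      _ ≤ _ := Finset.sum_mul_sq_le_sq_mul_sq _ _ _
      _ = _ := by simp only [mul_pow, sq_abs]
  calc _ ≤ ∑ t : Fin (n + k), (∑ i, a i ^ 2) * ∑ i : Fin (k + 1), b i ^ 2 * tapInput x t i ^ 2 :=
        Finset.sum_le_sum fun t _ => hslot t
    _ = _ := by
        rw [← Finset.mul_sum, Finset.sum_comm]
        simp only [← Finset.mul_sum, sum_tapInput_sq, ← Finset.sum_mul, mul_assoc]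

theorem channelMatrix_energy_le {h : Taps k} {r : Fin (k + 1) → ℝ}
    (hr : ∀ (t : Fin (n + k)) i, |h t i| ≤ r i) (x : Fin n → ℝ) :
    (channelMatrix n h *ᵥ x) ⬝ᵥ (channelMatrix n h *ᵥ x) ≤
      ((k : ℝ) + 1) * (∑ i, r i ^ 2) * (x ⬝ᵥ x) := by
  have := channelMatrix_energy_le_mul (a := fun _ => 1) (b := r) (by simpa using hr) x
  simpa using this

theorem channelMatrix_energy_le_rSum {h : Taps k} {r : Fin (k + 1) → ℝ} (r0 : ∀ i, 0 ≤ r i)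
    (hr : ∀ (t : Fin (n + k)) i, |h t i| ≤ r i) (x : Fin n → ℝ) :
    (channelMatrix n h *ᵥ x) ⬝ᵥ (channelMatrix n h *ᵥ x) ≤ rSum r ^ 2 * (x ⬝ᵥ x) := by
  have := channelMatrix_energy_le_mul (a := fun i => √(r i)) (b := fun i => √(r i))
    (fun t i => by simpa only [Real.mul_self_sqrt (r0 i)] using hr t i) x
  simpa only [Real.sq_sqrt (r0 _), rSum, sq] using this

end ChannelMatrix

/-! ### Parseval's identity and the gain of the centre channel -/

section Parseval

variable {k n : ℕ}

open Polynomial in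
theorem circleAverage_ofFn (a : Fin n → ℝ) :
    Real.circleAverage (fun z => ‖(ofFn n fun t => (a t : ℂ)).eval z‖ ^ 2) 0 1 = a ⬝ᵥ a := by
  set p : ℂ[X] := ofFn n fun t => (a t : ℂ)
  have hsub : p.support ⊆ Finset.range n := fun i hi => Finset.mem_range.2 <| by
    by_contra hni
    exact mem_support_iff.1 hi (ofFn_coeff_eq_zero_of_ge _ (not_lt.1 hni))
  rw [← sum_sq_norm_coeff_eq_circleAverage, Finset.sum_subset hsub fun i _ hi => by
    rw [notMem_support_iff.1 hi]; simp, Finset.sum_range]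
  simp only [p, ofFn_coeff_eq_val_of_lt _ (Fin.is_lt _), Complex.norm_real, Real.norm_eq_abs,
    sq_abs, dotProduct, ← sq, Fin.eta]

open Polynomial in
theorem ofFn_centreMatrix_mulVec (c : Fin (k + 1) → ℝ) (x : Fin n → ℝ) :
    ofFn (n + k) (fun t => ((centreMatrix n c *ᵥ x) t : ℂ)) =
      ofFn (k + 1) (fun i => (c i : ℂ)) * ofFn n fun j => (x j : ℂ) := by
  rw [ofFn_eq_sum_monomial (n := k + 1), ofFn_eq_sum_monomial (n := n), Finset.sum_mul_sum]
  ext t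
  simp only [monomial_mul_monomial, finsetSum_coeff, coeff_monomial]
  by_cases ht : t < n + k
  · rw [ofFn_coeff_eq_val_of_lt _ ht, centreMatrix, channelMatrix_mulVec]
    simp [tapInput, Finset.mul_sum, eq_comm (a := t), apply_ite Complex.ofReal]
  · rw [ofFn_coeff_eq_zero_of_ge _ (not_lt.1 ht)]
    exact (Finset.sum_eq_zero fun i _ => Finset.sum_eq_zero fun j _ => if_neg (by omega)).symm

theorem continuous_gain (c : Fin (k + 1) → ℝ) : Continuous (gain c) := by
  unfold gain; fun_prop

theorem isCompact_gain_image (c : Fin (k + 1) → ℝ) :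
    IsCompact (gain c '' Set.Icc 0 (2 * Real.pi)) :=
  isCompact_Icc.image (continuous_gain c)

theorem gain_nonneg (c : Fin (k + 1) → ℝ) (ω : ℝ) : 0 ≤ gain c ω := norm_nonneg _

theorem alpha_nonneg (c : Fin (k + 1) → ℝ) : 0 ≤ alpha c :=
  Real.sInf_nonneg (by rintro _ ⟨ω, _, rfl⟩; exact gain_nonneg c ω)

theorem beta_nonneg (c : Fin (k + 1) → ℝ) : 0 ≤ beta c :=
  Real.sSup_nonneg (by rintro _ ⟨ω, _, rfl⟩; exact gain_nonneg c ω)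

theorem alpha_le_gain (c : Fin (k + 1) → ℝ) {ω : ℝ} (hω : ω ∈ Set.Icc 0 (2 * Real.pi)) :
    alpha c ≤ gain c ω :=
  csInf_le (isCompact_gain_image c).bddBelow ⟨ω, hω, rfl⟩

theorem gain_le_beta (c : Fin (k + 1) → ℝ) {ω : ℝ} (hω : ω ∈ Set.Icc 0 (2 * Real.pi)) :
    gain c ω ≤ beta c :=
  le_csSup (isCompact_gain_image c).bddAbove ⟨ω, hω, rfl⟩

open Polynomial in
theorem norm_eval_ofFn_circleMap (c : Fin (k + 1) → ℝ) (θ : ℝ) :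
    ‖(ofFn (k + 1) fun i => (c i : ℂ)).eval (circleMap 0 1 θ)‖ = gain c θ := by
  simp only [gain, circleMap, ofFn_eq_sum_monomial, eval_finsetSum, eval_monomial, zero_add,
    Complex.ofReal_one, one_mul, ← Complex.exp_nat_mul]
  congr! 4
  ring

open Polynomial in
theorem exists_gain_integral (c : Fin (k + 1) → ℝ) (x : Fin n → ℝ) :
    ∃ w : ℝ → ℝ, Continuous w ∧ 0 ≤ w ∧ x ⬝ᵥ x = ∫ θ in 0..2 * Real.pi, w θ ∧
      (centreMatrix n c *ᵥ x) ⬝ᵥ (centreMatrix n c *ᵥ x)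
        = ∫ θ in 0..2 * Real.pi, gain c θ ^ 2 * w θ := by
  set q : ℂ[X] := ofFn n fun j => (x j : ℂ)
  refine ⟨fun θ => (2 * Real.pi)⁻¹ * ‖q.eval (circleMap 0 1 θ)‖ ^ 2, ?_, fun θ => by positivity,
    ?_, ?_⟩
  · exact continuous_const.mul (((q.continuous.comp (continuous_circleMap 0 1)).norm).pow 2)
  · rw [← circleAverage_ofFn, Real.circleAverage, smul_eq_mul, intervalIntegral.integral_const_mul]
  · rw [← circleAverage_ofFn, ofFn_centreMatrix_mulVec, Real.circleAverage, smul_eq_mul,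
      ← intervalIntegral.integral_const_mul]
    simp only [eval_mul, norm_mul, mul_pow, norm_eval_ofFn_circleMap, q]
    congr! 2
    ring

theorem alpha_sq_mul_le_centreMatrix_energy (c : Fin (k + 1) → ℝ) (x : Fin n → ℝ) :
    alpha c ^ 2 * (x ⬝ᵥ x) ≤ (centreMatrix n c *ᵥ x) ⬝ᵥ (centreMatrix n c *ᵥ x) := by
  obtain ⟨w, hw, hw0, hx, hy⟩ := exists_gain_integral c x
  rw [hx, hy, ← intervalIntegral.integral_const_mul]
  refine intervalIntegral.integral_mono_on Real.two_pi_pos.le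
    ((continuous_const.mul hw).intervalIntegrable _ _)
    ((((continuous_gain c).pow 2).mul hw).intervalIntegrable _ _) fun θ hθ => ?_
  have := alpha_nonneg c
  have := hw0 θ
  gcongr
  exact alpha_le_gain c hθ

theorem centreMatrix_energy_le (c : Fin (k + 1) → ℝ) (x : Fin n → ℝ) :
    (centreMatrix n c *ᵥ x) ⬝ᵥ (centreMatrix n c *ᵥ x) ≤ beta c ^ 2 * (x ⬝ᵥ x) := by
  obtain ⟨w, hw, hw0, hx, hy⟩ := exists_gain_integral c x
  rw [hx, hy, ← intervalIntegral.integral_const_mul]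
  refine intervalIntegral.integral_mono_on Real.two_pi_pos.le
    ((((continuous_gain c).pow 2).mul hw).intervalIntegrable _ _)
    ((continuous_const.mul hw).intervalIntegrable _ _) fun θ hθ => ?_
  have := gain_nonneg c θ
  have := hw0 θ
  gcongr
  exact gain_le_beta c hθ

end Parseval

/-! ### Spectral factors and determinants -/

section LinearAlgebra

variable {m n : ℕ} {S B : Matrix (Fin n) (Fin n) ℝ} {d : Fin n → ℝ}

/-- A factorization `S = B Bᵀ` in which the columns of `B` are orthogonal, the squares `d i` of
their lengths being eigenvalues of `S`.  It writes `N(0, S)` as the law of `B u` for white noise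
`u`. -/
structure IsSpectralFactor (S B : Matrix (Fin n) (Fin n) ℝ) (d : Fin n → ℝ) : Prop where
  mul_transpose : B * Bᵀ = S
  transpose_mul : Bᵀ * B = Matrix.diagonal d
  mem_spectrum : ∀ i, d i ∈ spectrum ℝ S

theorem exists_isSpectralFactor (hS : S.PosSemidef) : ∃ B d, IsSpectralFactor S B d := by
  have hH := hS.isHermitian
  set d := hH.eigenvalues
  set U : Matrix (Fin n) (Fin n) ℝ := ↑hH.eigenvectorUnitary
  set D := Matrix.diagonal fun i => √(d i)
  have hUU : Uᵀ * U = 1 := Unitary.coe_star_mul_self hH.eigenvectorUnitary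
  have hspec : S = U * Matrix.diagonal d * Uᵀ := by
    have := hH.spectral_theorem
    rwa [Unitary.conjStarAlgAut_apply] at this
  have hD : D * D = Matrix.diagonal d := by
    simp only [D, Matrix.diagonal_mul_diagonal, Real.mul_self_sqrt (hS.eigenvalues_nonneg _), d]
  refine ⟨U * D, d, ?_, ?_, fun i => ?_⟩
  · rw [Matrix.transpose_mul, Matrix.diagonal_transpose, hspec, ← hD]
    simp only [Matrix.mul_assoc, D]
  · rw [Matrix.transpose_mul, Matrix.diagonal_transpose, Matrix.mul_assoc, ← Matrix.mul_assoc Uᵀ,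
      hUU, Matrix.one_mul, hD]
  · rw [hH.spectrum_real_eq_range_eigenvalues]
    exact ⟨i, rfl⟩

theorem pos_of_mem_spectrum (hS : S.PosDef) {x : ℝ} (hx : x ∈ spectrum ℝ S) : 0 < x := by
  rw [hS.isHermitian.spectrum_real_eq_range_eigenvalues] at hx
  obtain ⟨i, rfl⟩ := hx
  exact hS.eigenvalues_pos i

theorem lamMin_nonneg (hS : S.PosDef) : 0 ≤ lamMin S :=
  Real.sInf_nonneg fun _ hx => (pos_of_mem_spectrum hS hx).le

theorem lamMax_nonneg (hS : S.PosDef) : 0 ≤ lamMax S :=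
  Real.sSup_nonneg fun _ hx => (pos_of_mem_spectrum hS hx).le

theorem dotProduct_self_nonneg {ι : Type*} [Fintype ι] (v : ι → ℝ) : 0 ≤ v ⬝ᵥ v := by
  simpa using dotProduct_self_star_nonneg v

theorem dotProduct_mulVec_self (A : Matrix (Fin m) (Fin n) ℝ) (u : Fin n → ℝ) :
    (A *ᵥ u) ⬝ᵥ (A *ᵥ u) = u ⬝ᵥ ((Aᵀ * A) *ᵥ u) := by
  rw [← Matrix.mulVec_mulVec, Matrix.dotProduct_mulVec u, Matrix.vecMul_transpose]

namespace IsSpectralFactor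

theorem lamMin_le (hB : IsSpectralFactor S B d) (i : Fin n) : lamMin S ≤ d i :=
  csInf_le (Matrix.finite_real_spectrum).bddBelow (hB.mem_spectrum i)

theorem le_lamMax (hB : IsSpectralFactor S B d) (i : Fin n) : d i ≤ lamMax S :=
  le_csSup (Matrix.finite_real_spectrum).bddAbove (hB.mem_spectrum i)

theorem sum_eq_trace (hB : IsSpectralFactor S B d) : ∑ i, d i = S.trace := by
  rw [← hB.mul_transpose, Matrix.trace_mul_comm, hB.transpose_mul, Matrix.trace_diagonal]

theorem normSq_mulVec (hB : IsSpectralFactor S B d) (u : Fin n → ℝ) :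
    (B *ᵥ u) ⬝ᵥ (B *ᵥ u) = ∑ i, d i * u i ^ 2 := by
  rw [dotProduct_mulVec_self, hB.transpose_mul, dotProduct]
  exact Finset.sum_congr rfl fun i _ => by rw [Matrix.mulVec_diagonal]; ring

theorem lamMin_mul_le (hB : IsSpectralFactor S B d) (u : Fin n → ℝ) :
    lamMin S * (u ⬝ᵥ u) ≤ (B *ᵥ u) ⬝ᵥ (B *ᵥ u) := by
  rw [hB.normSq_mulVec, dotProduct, Finset.mul_sum]
  refine Finset.sum_le_sum fun i _ => ?_
  rw [← sq]
  exact mul_le_mul_of_nonneg_right (hB.lamMin_le i) (sq_nonneg _)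

theorem normSq_mulVec_le (hB : IsSpectralFactor S B d) (u : Fin n → ℝ) :
    (B *ᵥ u) ⬝ᵥ (B *ᵥ u) ≤ lamMax S * (u ⬝ᵥ u) := by
  rw [hB.normSq_mulVec, dotProduct, Finset.mul_sum]
  refine Finset.sum_le_sum fun i _ => ?_
  rw [← sq]
  exact mul_le_mul_of_nonneg_right (hB.le_lamMax i) (sq_nonneg _)

theorem det_mul_det (hB : IsSpectralFactor S B d) : B.det * B.det = S.det := by
  rw [← hB.mul_transpose, Matrix.det_mul, Matrix.det_transpose]

theorem isUnit_det (hB : IsSpectralFactor S B d) (hS : S.PosDef) : IsUnit B.det :=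
  isUnit_iff_ne_zero.2 fun h0 => hS.det_pos.ne' (by rw [← hB.det_mul_det, h0, mul_zero])

theorem inv_eq (hB : IsSpectralFactor S B d) : S⁻¹ = (B⁻¹)ᵀ * B⁻¹ := by
  rw [← hB.mul_transpose, Matrix.mul_inv_rev, Matrix.transpose_nonsing_inv]

theorem inv_quadratic (hB : IsSpectralFactor S B d) (hS : S.PosDef) (u : Fin n → ℝ) :
    (B *ᵥ u) ⬝ᵥ (S⁻¹ *ᵥ (B *ᵥ u)) = u ⬝ᵥ u := by
  rw [hB.inv_eq, ← dotProduct_mulVec_self, Matrix.mulVec_mulVec,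
    Matrix.nonsing_inv_mul B (hB.isUnit_det hS), Matrix.one_mulVec]

end IsSpectralFactor

theorem one_le_det_one_add {P : Matrix (Fin n) (Fin n) ℝ} (hP : P.PosSemidef) :
    1 ≤ (1 + P).det := by
  have hH : (1 + P).IsHermitian := Matrix.isHermitian_one.add hP.isHermitian
  rw [hH.det_eq_prod_eigenvalues, ← Finset.prod_const_one (s := Finset.univ (α := Fin n))]
  refine Finset.prod_le_prod (fun _ _ => zero_le_one) fun i _ => ?_
  set v : Fin n → ℝ := ⇑(hH.eigenvectorBasis i)
  have hv : star v ⬝ᵥ v = 1 := by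
    have := inner_self_eq_one_of_norm_eq_one (𝕜 := ℝ) (hH.eigenvectorBasis.orthonormal.1 i)
    rwa [EuclideanSpace.inner_eq_star_dotProduct, dotProduct_comm] at this
  rw [hH.eigenvalues_eq, Matrix.add_mulVec, Matrix.one_mulVec, dotProduct_add, hv]
  simpa using hP.dotProduct_mulVec_nonneg v

theorem det_le_det_of_posSemidef_sub {A C : Matrix (Fin n) (Fin n) ℝ} (hA : A.PosDef)
    (hAC : (C - A).PosSemidef) : A.det ≤ C.det := by
  obtain ⟨B, d, hB⟩ := exists_isSpectralFactor hA.posSemidef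
  have hBu := hB.isUnit_det hA
  have hC : C = B * (1 + B⁻¹ * (C - A) * (B⁻¹)ᵀ) * Bᵀ := by
    rw [Matrix.mul_add, Matrix.mul_one, Matrix.add_mul, hB.mul_transpose, Matrix.mul_assoc B⁻¹,
      Matrix.mul_nonsing_inv_cancel_left B _ hBu, Matrix.transpose_nonsing_inv,
      Matrix.nonsing_inv_mul_cancel_right Bᵀ _ (by rwa [Matrix.det_transpose]), add_sub_cancel]
  calc A.det ≤ A.det * (1 + B⁻¹ * (C - A) * (B⁻¹)ᵀ).det :=
        le_mul_of_one_le_right hA.det_pos.le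
          (one_le_det_one_add (posSemidef_mul_mul_transpose hAC B⁻¹))
    _ = C.det := by
        rw [← hB.det_mul_det]
        conv_rhs => rw [hC, Matrix.det_mul, Matrix.det_mul, Matrix.det_transpose]
        ring

theorem posDef_one_add_mul_mul_transpose (hS : S.PosSemidef) (A : Matrix (Fin m) (Fin n) ℝ) :
    (1 + A * S * Aᵀ).PosDef :=
  Matrix.PosDef.one.add_posSemidef (posSemidef_mul_mul_transpose hS A)

theorem posDef_one_add_transpose_mul (A : Matrix (Fin m) (Fin n) ℝ) : (1 + Aᵀ * A).PosDef := by
  simpa using posDef_one_add_mul_mul_transpose Matrix.PosSemidef.one Aᵀ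

end LinearAlgebra

section JointCovariance

variable {k n : ℕ} {S : Matrix (Fin n) (Fin n) ℝ}

theorem jointCov_inv (c : Fin (k + 1) → ℝ) (hS : IsUnit S.det) :
    (jointCov c S)⁻¹ = Matrix.fromBlocks (S⁻¹ + (centreMatrix n c)ᵀ * centreMatrix n c)
      (-(centreMatrix n c)ᵀ) (-centreMatrix n c) 1 := by
  refine Matrix.inv_eq_left_inv ?_
  rw [jointCov, Matrix.fromBlocks_multiply, ← Matrix.fromBlocks_one]
  congr 1
  · simp [Matrix.add_mul, Matrix.nonsing_inv_mul S hS, Matrix.mul_assoc]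
  · simp only [Matrix.add_mul, Matrix.nonsing_inv_mul_cancel_left S _ hS, Matrix.mul_add,
      Matrix.mul_assoc, Matrix.neg_mul, Matrix.mul_one]
    abel
  · simp
  · simp [Matrix.mul_assoc]

theorem jointCov_inv_quadratic (c : Fin (k + 1) → ℝ) (hS : IsUnit S.det) (x : Fin n → ℝ)
    (y : Fin (n + k) → ℝ) :
    Sum.elim x y ⬝ᵥ ((jointCov c S)⁻¹ *ᵥ Sum.elim x y) = x ⬝ᵥ (S⁻¹ *ᵥ x) +
      (y - centreMatrix n c *ᵥ x) ⬝ᵥ (y - centreMatrix n c *ᵥ x) := by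
  rw [jointCov_inv c hS, Matrix.fromBlocks_mulVec, Sum.elim_comp_inl, Sum.elim_comp_inr,
    sumElim_dotProduct_sumElim]
  set H := centreMatrix n c
  have htranspose : x ⬝ᵥ (Hᵀ *ᵥ y) = (H *ᵥ x) ⬝ᵥ y := by
    rw [Matrix.dotProduct_mulVec, Matrix.vecMul_transpose]
  simp only [Matrix.add_mulVec, Matrix.neg_mulVec, Matrix.one_mulVec, dotProduct_add,
    dotProduct_neg, sub_dotProduct, dotProduct_sub, ← dotProduct_mulVec_self, htranspose,
    dotProduct_comm y (H *ᵥ x)]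
  ring

end JointCovariance

/-! ### Perturbation of the channel matrix -/

section Perturbation

variable {k n : ℕ} {c r : Fin (k + 1) → ℝ} {h : Taps k}

/-- Every tap lies in its interval, the pointwise version of `IsTapLaw`. -/
def InBox (c r : Fin (k + 1) → ℝ) (h : Taps k) : Prop :=
  ∀ t i, h t i ∈ Set.Icc (c i - r i) (c i + r i)

theorem InBox.abs_sub_le (hb : InBox c r h) (t : ℕ) (i : Fin (k + 1)) : |h t i - c i| ≤ r i :=
  abs_sub_le_iff.2 ⟨by linarith [(hb t i).2], by linarith [(hb t i).1]⟩

theorem InBox.radius_nonneg (hb : InBox c r h) (i : Fin (k + 1)) : 0 ≤ r i :=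
  (abs_nonneg _).trans (hb.abs_sub_le 0 i)

theorem rSum_nonneg (hr : ∀ i, 0 ≤ r i) : 0 ≤ rSum r := Finset.sum_nonneg fun i _ => hr i

/-- Bounds the loss of energy `|H_c x|² - |H x|²` in units of `|x|²`; this is the factor
`r_s (r_s + 2β)` of the three `φ`s. -/
noncomputable def energyLoss (c r : Fin (k + 1) → ℝ) : ℝ := rSum r * (rSum r + 2 * beta c)

theorem energyLoss_nonneg (c : Fin (k + 1) → ℝ) (hr : ∀ i, 0 ≤ r i) : 0 ≤ energyLoss c r := by
  have := rSum_nonneg hr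
  have := beta_nonneg c
  unfold energyLoss
  positivity

theorem channelMatrix_mulVec_eq_add (c : Fin (k + 1) → ℝ) (h : Taps k) (x : Fin n → ℝ) :
    channelMatrix n h *ᵥ x = centreMatrix n c *ᵥ x + channelMatrix n (h - fun _ => c) *ᵥ x := by
  rw [← channelMatrix_sub, Matrix.sub_mulVec, centreMatrix]
  abel

theorem abs_dotProduct_le {a b : Fin n → ℝ} {p q : ℝ} (hp : 0 ≤ p) (hq : 0 ≤ q)
    (ha : a ⬝ᵥ a ≤ p ^ 2) (hb : b ⬝ᵥ b ≤ q ^ 2) : |a ⬝ᵥ b| ≤ p * q := by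
  refine abs_le_of_sq_le_sq (?_ : (a ⬝ᵥ b) ^ 2 ≤ (p * q) ^ 2) (by positivity)
  calc (a ⬝ᵥ b) ^ 2 ≤ (a ⬝ᵥ a) * (b ⬝ᵥ b) := by
        simpa [dotProduct, sq] using Finset.sum_mul_sq_le_sq_mul_sq Finset.univ a b
    _ ≤ p ^ 2 * q ^ 2 := mul_le_mul ha hb (dotProduct_self_nonneg _) (by positivity)
    _ = (p * q) ^ 2 := (mul_pow p q 2).symm

theorem centreMatrix_energy_sub_le (hb : InBox c r h) (x : Fin n → ℝ) :
    (centreMatrix n c *ᵥ x) ⬝ᵥ (centreMatrix n c *ᵥ x) - energyLoss c r * (x ⬝ᵥ x) ≤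
      (channelMatrix n h *ᵥ x) ⬝ᵥ (channelMatrix n h *ᵥ x) := by
  have hrs := rSum_nonneg hb.radius_nonneg
  have hβ := beta_nonneg c
  rw [channelMatrix_mulVec_eq_add c h x]
  set a := centreMatrix n c *ᵥ x
  set b := channelMatrix n (h - fun _ => c) *ᵥ x
  have hx := Real.sq_sqrt (dotProduct_self_nonneg x)
  set e := √(x ⬝ᵥ x)
  have hcross : |a ⬝ᵥ b| ≤ (beta c * e) * (rSum r * e) := by
    refine abs_dotProduct_le (by positivity) (by positivity) ?_ ?_
    · rw [mul_pow, hx]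
      exact centreMatrix_energy_le c x
    · rw [mul_pow, hx]
      exact channelMatrix_energy_le_rSum hb.radius_nonneg (fun t i => hb.abs_sub_le t i) x
  have hbb := dotProduct_self_nonneg b
  have hrr : 0 ≤ rSum r ^ 2 * e ^ 2 := by positivity
  rw [add_dotProduct, dotProduct_add, dotProduct_add, dotProduct_comm b a, ← hx, energyLoss]
  linarith [(abs_le.1 hcross).1]

theorem phi1_eq (c r : Fin (k + 1) → ℝ) (S : Matrix (Fin n) (Fin n) ℝ) :
    phi1 c r S = energyLoss c r * lamMax S / (1 + alpha c ^ 2 * lamMin S) := rfl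

theorem phi1_nonneg (c : Fin (k + 1) → ℝ) (hr : ∀ i, 0 ≤ r i) {S : Matrix (Fin n) (Fin n) ℝ}
    (hS : S.PosDef) : 0 ≤ phi1 c r S := by
  have := energyLoss_nonneg c hr
  have := lamMax_nonneg hS
  have := lamMin_nonneg hS
  rw [phi1_eq]
  positivity

theorem energyLoss_mul_le_phi1_mul (c : Fin (k + 1) → ℝ) (hr : ∀ i, 0 ≤ r i)
    {S B : Matrix (Fin n) (Fin n) ℝ} {d : Fin n → ℝ} (hS : S.PosDef) (hB : IsSpectralFactor S B d)
    (u : Fin n → ℝ) :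
    energyLoss c r * ((B *ᵥ u) ⬝ᵥ (B *ᵥ u)) ≤
      phi1 c r S * (u ⬝ᵥ u + (centreMatrix n c *ᵥ B *ᵥ u) ⬝ᵥ (centreMatrix n c *ᵥ B *ᵥ u)) := by
  have hκ := energyLoss_nonneg c hr
  have hφ := phi1_nonneg c hr hS
  have hm := lamMin_nonneg hS
  have hφκ : phi1 c r S * (1 + alpha c ^ 2 * lamMin S) = energyLoss c r * lamMax S := by
    rw [phi1_eq, div_mul_cancel₀ _ (by positivity)]
  calc energyLoss c r * ((B *ᵥ u) ⬝ᵥ (B *ᵥ u))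
      ≤ energyLoss c r * (lamMax S * (u ⬝ᵥ u)) := by
        gcongr
        exact hB.normSq_mulVec_le u
    _ = phi1 c r S * (u ⬝ᵥ u + alpha c ^ 2 * (lamMin S * (u ⬝ᵥ u))) := by
        linear_combination -(u ⬝ᵥ u) * hφκ
    _ ≤ phi1 c r S * (u ⬝ᵥ u + alpha c ^ 2 * ((B *ᵥ u) ⬝ᵥ (B *ᵥ u))) := by
        gcongr
        exact hB.lamMin_mul_le u
    _ ≤ _ := by
        gcongr
        exact alpha_sq_mul_le_centreMatrix_energy c _

theorem det_one_add_conj_eq {m : ℕ} {S B : Matrix (Fin n) (Fin n) ℝ} {d : Fin n → ℝ}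
    (hB : IsSpectralFactor S B d) (A : Matrix (Fin m) (Fin n) ℝ) :
    (1 + A * S * Aᵀ).det = (1 + (A * B)ᵀ * (A * B)).det := by
  rw [← hB.mul_transpose, ← Matrix.det_one_add_mul_comm (A * B), Matrix.transpose_mul]
  simp only [Matrix.mul_assoc]

theorem phi1_pow_mul_det_le (hb : InBox c r h) {S : Matrix (Fin n) (Fin n) ℝ} (hS : S.PosDef)
    (hphi : phi1 c r S < 1) :
    (1 - phi1 c r S) ^ n * (1 + (centreMatrix n c)ᵀ * centreMatrix n c * S).det ≤
      (1 + channelMatrix n h * S * (channelMatrix n h)ᵀ).det := by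
  obtain ⟨B, d, hB⟩ := exists_isSpectralFactor hS.posSemidef
  set H := channelMatrix n h
  set Hc := centreMatrix n c
  have hcomm : (1 + Hcᵀ * Hc * S).det = (1 + Hc * S * Hcᵀ).det := by
    rw [Matrix.mul_assoc, Matrix.det_one_add_mul_comm]
  have hquad (A : Matrix (Fin (n + k)) (Fin n) ℝ) (u : Fin n → ℝ) :
      u ⬝ᵥ ((1 + (A * B)ᵀ * (A * B)) *ᵥ u)
        = u ⬝ᵥ u + (A *ᵥ B *ᵥ u) ⬝ᵥ (A *ᵥ B *ᵥ u) := by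
    rw [Matrix.add_mulVec, Matrix.one_mulVec, dotProduct_add, ← dotProduct_mulVec_self,
      Matrix.mulVec_mulVec]
  have hpos (A : Matrix (Fin (n + k)) (Fin n) ℝ) := posDef_one_add_transpose_mul (A * B)
  have hscale (D : Matrix (Fin n) (Fin n) ℝ) :
      (1 - phi1 c r S) ^ n * D.det = ((1 - phi1 c r S) • D).det := by
    rw [Matrix.det_smul, Fintype.card_fin]
  rw [hcomm, det_one_add_conj_eq hB, det_one_add_conj_eq hB, hscale]
  refine det_le_det_of_posSemidef_sub ((hpos Hc).smul (by linarith))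
    (.of_dotProduct_mulVec_nonneg ((hpos H).isHermitian.sub
      ((hpos Hc).smul (by linarith)).isHermitian) fun u => ?_)
  have henergy := centreMatrix_energy_sub_le hb (B *ᵥ u)
  have hloss := energyLoss_mul_le_phi1_mul c hb.radius_nonneg hS hB u
  rw [star_trivial, Matrix.sub_mulVec, dotProduct_sub, Matrix.smul_mulVec, dotProduct_smul, hquad,
    hquad, smul_eq_mul]
  linarith

end Perturbation

/-! ### Joint typicality of the transmitted codeword -/

section MeasureTools

variable {α β : Type*} [MeasurableSpace α] [MeasurableSpace β] {μ : Measure α} {ν : Measure β}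

theorem measureReal_preimage_of_measurePreserving {f : α → β} (hf : MeasurePreserving f μ ν)
    {s : Set β} (hs : MeasurableSet s) : μ.real (f ⁻¹' s) = ν.real s := by
  rw [measureReal_def, measureReal_def, hf.measure_preimage hs.nullMeasurableSet]

theorem measureReal_prod_le_of_forall [IsProbabilityMeasure μ] [IsProbabilityMeasure ν]
    {s : Set (α × β)} (hs : MeasurableSet s) {b : ℝ} (hb : 0 ≤ b)
    (h : ∀ᵐ x ∂μ, ν.real (Prod.mk x ⁻¹' s) ≤ b) : (μ.prod ν).real s ≤ b := by
  have hle : (μ.prod ν) s ≤ ENNReal.ofReal b := by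
    calc (μ.prod ν) s = ∫⁻ x, ν (Prod.mk x ⁻¹' s) ∂μ := Measure.prod_apply hs
      _ ≤ ∫⁻ _, ENNReal.ofReal b ∂μ := lintegral_mono_ae <| h.mono fun _ hx =>
          (ENNReal.le_ofReal_iff_toReal_le (measure_ne_top _ _) hb).2 hx
      _ = ENNReal.ofReal b := by simp
  exact ENNReal.toReal_le_of_le_ofReal hb hle

end MeasureTools

section Measurability

theorem measurable_dotProduct_self {ι : Type*} [Fintype ι] :
    Measurable fun x : ι → ℝ => x ⬝ᵥ x :=
  (continuous_id.dotProduct continuous_id).measurable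

theorem measurable_quadratic {ι : Type*} [Fintype ι] (A : Matrix ι ι ℝ) :
    Measurable fun x : ι → ℝ => x ⬝ᵥ (A *ᵥ x) :=
  (continuous_id.dotProduct (continuous_const.matrix_mulVec continuous_id)).measurable

theorem measurableSet_typicalSet {ι : Type} [Fintype ι] [DecidableEq ι] (S : Matrix ι ι ℝ)
    (η : ℝ) : MeasurableSet (typicalSet S η) :=
  measurableSet_lt (((measurable_quadratic S⁻¹).const_mul _).sub_const 1).abs measurable_const

theorem measurableSet_jointlyTypical {k n : ℕ} (c : Fin (k + 1) → ℝ)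
    (S : Matrix (Fin n) (Fin n) ℝ) (ε η : ℝ) :
    MeasurableSet {p : (Fin n → ℝ) × (Fin (n + k) → ℝ) | JointlyTypical c S ε η p.1 p.2} := by
  have hsum : Measurable fun p : (Fin n → ℝ) × (Fin (n + k) → ℝ) =>
      (Sum.elim p.1 p.2 : Fin n ⊕ Fin (n + k) → ℝ) := by
    refine measurable_pi_iff.2 (Sum.rec (fun i => ?_) fun i => ?_)
    · exact (measurable_pi_apply i).comp measurable_fst
    · exact (measurable_pi_apply i).comp measurable_snd
  exact (measurable_fst (measurableSet_typicalSet S ε)).inter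
    (hsum (measurableSet_typicalSet (jointCov c S) η))

end Measurability

section Concentration

variable {n : ℕ} {S B : Matrix (Fin n) (Fin n) ℝ} {d : Fin n → ℝ} {s : ℝ}

theorem IsSpectralFactor.measurePreserving (hB : IsSpectralFactor S B d) :
    MeasurePreserving (B *ᵥ ·) (noise n) (codewordLaw S) := by
  simpa only [hB.mul_transpose] using measurePreserving_mulVec_noise B

theorem codewordLaw_le_abs_inv_quadratic_sub (hS : S.PosDef) (hs : 0 < s) :
    (codewordLaw S).real {x | s ≤ |x ⬝ᵥ (S⁻¹ *ᵥ x) - n|} ≤ chiVar * n / s ^ 2 := by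
  obtain ⟨B, d, hB⟩ := exists_isSpectralFactor hS.posSemidef
  have hmeas : MeasurableSet {x : Fin n → ℝ | s ≤ |x ⬝ᵥ (S⁻¹ *ᵥ x) - n|} :=
    measurableSet_le measurable_const ((measurable_quadratic S⁻¹).sub_const _).abs
  rw [← measureReal_preimage_of_measurePreserving hB.measurePreserving hmeas]
  simpa only [Set.preimage_ofPred_eq, hB.inv_quadratic hS] using noise_le_abs_normSq_sub n hs

theorem codewordLaw_trace_add_le_normSq (hS : S.PosDef) (hs : 0 < s) :
    (codewordLaw S).real {x | S.trace + s ≤ x ⬝ᵥ x} ≤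
      chiVar * (lamMax S * S.trace) / s ^ 2 := by
  obtain ⟨B, d, hB⟩ := exists_isSpectralFactor hS.posSemidef
  have hv := chiVar_nonneg
  have hmeas : MeasurableSet {x : Fin n → ℝ | S.trace + s ≤ x ⬝ᵥ x} :=
    measurableSet_le measurable_const measurable_dotProduct_self
  rw [← measureReal_preimage_of_measurePreserving hB.measurePreserving hmeas]
  calc (noise n).real {u | S.trace + s ≤ (B *ᵥ u) ⬝ᵥ (B *ᵥ u)}
      ≤ (noise n).real {u | s ≤ |∑ i, d i * u i ^ 2 - ∑ i, d i|} := by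
        refine measureReal_mono fun u (hu : S.trace + s ≤ (B *ᵥ u) ⬝ᵥ (B *ᵥ u)) => ?_
        rw [hB.normSq_mulVec, ← hB.sum_eq_trace] at hu
        exact (le_sub_iff_add_le'.2 hu).trans (le_abs_self _)
    _ ≤ chiVar * (∑ i, d i ^ 2) / s ^ 2 := noise_le_abs_quadratic_sub d hs
    _ ≤ chiVar * (lamMax S * S.trace) / s ^ 2 := by
        gcongr
        rw [← hB.sum_eq_trace, Finset.mul_sum]
        refine Finset.sum_le_sum fun i _ => ?_
        rw [sq]
        exact mul_le_mul_of_nonneg_right (hB.le_lamMax i)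
          (pos_of_mem_spectrum hS (hB.mem_spectrum i)).le

theorem prod_noise_le_abs_mulVec_dotProduct {m : ℕ} (μ : Measure (Fin n → ℝ))
    [IsProbabilityMeasure μ] {A : Matrix (Fin m) (Fin n) ℝ} {C E : ℝ} (hC : 0 ≤ C) (hE : 0 ≤ E)
    (hA : ∀ x, (A *ᵥ x) ⬝ᵥ (A *ᵥ x) ≤ C * (x ⬝ᵥ x)) (hs : 0 < s) :
    (μ.prod (noise m)).real {p | p.1 ⬝ᵥ p.1 ≤ E ∧ s ≤ |(A *ᵥ p.1) ⬝ᵥ p.2|} ≤ C * E / s ^ 2 := by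
  have hcont : Continuous fun p : (Fin n → ℝ) × (Fin m → ℝ) => (A *ᵥ p.1) ⬝ᵥ p.2 :=
    (continuous_const.matrix_mulVec continuous_fst).dotProduct continuous_snd
  have hmeas : MeasurableSet {p : (Fin n → ℝ) × (Fin m → ℝ) |
      p.1 ⬝ᵥ p.1 ≤ E ∧ s ≤ |(A *ᵥ p.1) ⬝ᵥ p.2|} :=
    (measurableSet_le (measurable_dotProduct_self.comp measurable_fst) measurable_const).inter
      (measurableSet_le measurable_const hcont.abs.measurable)
  refine measureReal_prod_le_of_forall hmeas (by positivity) (ae_of_all _ fun x => ?_)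
  by_cases hx : x ⬝ᵥ x ≤ E
  · calc (noise m).real (Prod.mk x ⁻¹' _) ≤ (noise m).real {z | s ≤ |(A *ᵥ x) ⬝ᵥ z|} :=
          measureReal_mono fun _ hz => hz.2
      _ ≤ (A *ᵥ x) ⬝ᵥ (A *ᵥ x) / s ^ 2 := noise_le_abs_dotProduct _ hs
      _ ≤ C * E / s ^ 2 := by
          gcongr
          exact (hA x).trans (mul_le_mul_of_nonneg_left hx hC)
  · simp only [Set.preimage_ofPred_eq, hx, false_and, Set.ofPred_false, measureReal_empty]
    positivity

end Concentration

section TrueCodeword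

variable {k n : ℕ} {c r : Fin (k + 1) → ℝ} {h : Taps k} {S : Matrix (Fin n) (Fin n) ℝ} {ε η : ℝ}

/-- The constant `(k + 1) ‖r‖²` of the theorem; it bounds the energy that the deviation of the taps
from their centres adds to the output, in units of the energy of the input. -/
noncomputable def tapConst (r : Fin (k + 1) → ℝ) : ℝ := ((k : ℝ) + 1) * ∑ i, r i ^ 2

theorem tapConst_nonneg (r : Fin (k + 1) → ℝ) : 0 ≤ tapConst r :=
  mul_nonneg (by positivity) (Finset.sum_nonneg fun _ _ => sq_nonneg _)

theorem output_sub_centre (c : Fin (k + 1) → ℝ) (h : Taps k) (x : Fin n → ℝ)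
    (z : Fin (n + k) → ℝ) :
    output h x z - centreMatrix n c *ᵥ x = channelMatrix n (h - fun _ => c) *ᵥ x + z := by
  rw [output, channelMatrix_mulVec_eq_add c h x]
  abel

theorem jointlyTypical_iff (c : Fin (k + 1) → ℝ) (hS : S.PosDef) (ε η : ℝ) (x : Fin n → ℝ)
    (y : Fin (n + k) → ℝ) :
    JointlyTypical c S ε η x y ↔ |1 / (n : ℝ) * (x ⬝ᵥ (S⁻¹ *ᵥ x)) - 1| < ε ∧
      |1 / ((n : ℝ) + (n + k)) * (x ⬝ᵥ (S⁻¹ *ᵥ x) + (y - centreMatrix n c *ᵥ x) ⬝ᵥ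
        (y - centreMatrix n c *ᵥ x)) - 1| < η := by
  rw [JointlyTypical, typicalSet, typicalSet, Set.mem_ofPred_eq, Set.mem_ofPred_eq,
    jointCov_inv_quadratic c hS.det_pos.ne'.isUnit]
  simp [Fintype.card_sum]

theorem abs_one_div_mul_sub_one_lt_iff {N Q η : ℝ} (hN : 0 < N) :
    |1 / N * Q - 1| < η ↔ |Q - N| < η * N := by
  rw [← div_lt_iff₀ hN, ← abs_of_pos hN, ← abs_div, abs_of_pos hN, sub_div, div_self hN.ne',
    one_div_mul_eq_div]

theorem jointlyTypical_output (hn : 0 < n) (hb : InBox c r h) (hS : S.PosDef) (hε : 0 < ε)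
    (hη : tapConst r * (S.trace / ((n : ℝ) + k + n)) + ε * (tapConst r + 4) ≤ η)
    {x : Fin n → ℝ} {z : Fin (n + k) → ℝ}
    (hx : |x ⬝ᵥ (S⁻¹ *ᵥ x) - n| < ε * n) (henergy : x ⬝ᵥ x < S.trace + ε * n)
    (hz : |z ⬝ᵥ z - (n + k : ℕ)| < ε * n)
    (hxz : |(channelMatrix n (h - fun _ => c) *ᵥ x) ⬝ᵥ z| < ε * n) :
    JointlyTypical c S ε η x (output h x z) := by
  have hn' : (0 : ℝ) < n := Nat.cast_pos.2 hn
  have hC := tapConst_nonneg r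
  have hN : (0 : ℝ) < (n : ℝ) + (n + k) := by positivity
  rw [jointlyTypical_iff c hS, output_sub_centre, abs_one_div_mul_sub_one_lt_iff hn',
    abs_one_div_mul_sub_one_lt_iff hN]
  refine ⟨hx, ?_⟩
  set a := channelMatrix n (h - fun _ => c) *ᵥ x
  have ha : a ⬝ᵥ a ≤ tapConst r * (S.trace + ε * n) :=
    (channelMatrix_energy_le (fun t => hb.abs_sub_le t) x).trans
      (mul_le_mul_of_nonneg_left henergy.le hC)
  have ha0 := dotProduct_self_nonneg a
  have hηN : tapConst r * S.trace + ε * (tapConst r + 4) * n ≤ η * (n + (n + k)) := calc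
    _ ≤ tapConst r * S.trace + ε * (tapConst r + 4) * (n + (n + k)) := by
        gcongr
        linarith [(Nat.cast_nonneg k : (0 : ℝ) ≤ k)]
    _ = (tapConst r * (S.trace / ((n : ℝ) + k + n)) + ε * (tapConst r + 4)) * (n + (n + k)) := by
        field_simp
        ring
    _ ≤ _ := by gcongr
  have htrace : 0 ≤ tapConst r * S.trace + ε * tapConst r * n := by
    have := hS.posSemidef.trace_nonneg
    positivity
  rw [add_dotProduct, dotProduct_add, dotProduct_add, dotProduct_comm z a]
  push_cast at hz
  rw [abs_lt] at hx hz hxz ⊢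
  constructor <;> linarith

theorem codewordLaw_prod_noise_atypical_le (hn : 0 < n) (hb : InBox c r h) (hS : S.PosDef)
    (hε : 0 < ε)
    (hη : tapConst r * (S.trace / ((n : ℝ) + k + n)) + ε * (tapConst r + 4) ≤ η) :
    ((codewordLaw S).prod (noise (n + k))).real {p | ¬ JointlyTypical c S ε η p.1
        (output h p.1 p.2) ∨ S.trace + ε * n ≤ p.1 ⬝ᵥ p.1} ≤
      (chiVar * n + chiVar * (lamMax S * S.trace) + chiVar * (n + k : ℕ) +
        tapConst r * (S.trace + ε * n)) / (ε * n) ^ 2 := by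
  have hs : 0 < ε * n := by positivity
  have htr := hS.posSemidef.trace_nonneg
  set μ := (codewordLaw S).prod (noise (n + k))
  set X₁ := {x : Fin n → ℝ | ε * n ≤ |x ⬝ᵥ (S⁻¹ *ᵥ x) - n|}
  set X₂ := {x : Fin n → ℝ | S.trace + ε * n ≤ x ⬝ᵥ x}
  set Z := {z : Fin (n + k) → ℝ | ε * n ≤ |z ⬝ᵥ z - (n + k : ℕ)|}
  set X₃ := {p : (Fin n → ℝ) × (Fin (n + k) → ℝ) | p.1 ⬝ᵥ p.1 ≤ S.trace + ε * n ∧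
    ε * n ≤ |(channelMatrix n (h - fun _ => c) *ᵥ p.1) ⬝ᵥ p.2|}
  have hX₁ : μ.real (Prod.fst ⁻¹' X₁) ≤ chiVar * n / (ε * n) ^ 2 := by
    rw [← Set.prod_univ, measureReal_prod_prod, probReal_univ, mul_one]
    exact codewordLaw_le_abs_inv_quadratic_sub hS hs
  have hX₂ : μ.real (Prod.fst ⁻¹' X₂) ≤ chiVar * (lamMax S * S.trace) / (ε * n) ^ 2 := by
    rw [← Set.prod_univ, measureReal_prod_prod, probReal_univ, mul_one]
    exact codewordLaw_trace_add_le_normSq hS hs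
  have hZ : μ.real (Prod.snd ⁻¹' Z) ≤ chiVar * (n + k : ℕ) / (ε * n) ^ 2 := by
    rw [← Set.univ_prod, measureReal_prod_prod, probReal_univ, one_mul]
    exact noise_le_abs_normSq_sub _ hs
  have hX₃ : μ.real X₃ ≤ tapConst r * (S.trace + ε * n) / (ε * n) ^ 2 :=
    prod_noise_le_abs_mulVec_dotProduct _ (tapConst_nonneg r) (by positivity)
      (fun x => channelMatrix_energy_le (fun t => hb.abs_sub_le t) x) hs
  have hsub : {p : (Fin n → ℝ) × (Fin (n + k) → ℝ) | ¬ JointlyTypical c S ε η p.1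
      (output h p.1 p.2) ∨ S.trace + ε * n ≤ p.1 ⬝ᵥ p.1} ⊆
      Prod.fst ⁻¹' X₁ ∪ Prod.fst ⁻¹' X₂ ∪ Prod.snd ⁻¹' Z ∪ X₃ := by
    rintro ⟨x, z⟩ hp
    by_contra! hout
    simp only [X₁, X₂, X₃, Z, Set.mem_union, Set.mem_preimage, Set.mem_ofPred_eq, not_or, not_le,
      not_and] at hout
    obtain ⟨⟨⟨hx, henergy⟩, hz⟩, hxz⟩ := hout
    exact hp.elim (fun hJ => hJ (jointlyTypical_output hn hb hS hε hη hx henergy hz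
      (hxz henergy.le))) henergy.not_ge
  refine ((measureReal_mono hsub).trans (measureReal_union_le _ _)).trans ?_
  have := measureReal_union_le (μ := μ) (Prod.fst ⁻¹' X₁ ∪ Prod.fst ⁻¹' X₂) (Prod.snd ⁻¹' Z)
  have := measureReal_union_le (μ := μ) (Prod.fst ⁻¹' X₁) (Prod.fst ⁻¹' X₂)
  rw [add_div, add_div, add_div]
  linarith

end TrueCodeword

/-! ### A wrong codeword passing the test -/

section WrongCodeword

variable {k n : ℕ} {c : Fin (k + 1) → ℝ} {S : Matrix (Fin n) (Fin n) ℝ} {ε η : ℝ}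

theorem measurePreserving_sumElim_noise (n m : ℕ) :
    MeasurePreserving (fun p : (Fin n → ℝ) × (Fin m → ℝ) => Sum.elim p.1 p.2)
      ((noise n).prod (noise m)) (stdNormal (Fin n ⊕ Fin m)) := by
  have h := measurePreserving_sumPiEquivProdPi_symm
    fun _ : Fin n ⊕ Fin m => gaussianReal 0 1
  convert! h using 1

theorem noise_prod_noise_le {m : ℕ} (G : Matrix (Fin m) (Fin n) ℝ) {T : Matrix (Fin m) (Fin m) ℝ}
    (hT : T.det ≠ 0) {q : ℝ} (hq : 0 < q) (s : ℝ) :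
    ((noise n).prod (noise m)).real {p | p.1 ⬝ᵥ p.1 + (T *ᵥ p.2 - G *ᵥ p.1) ⬝ᵥ
        (T *ᵥ p.2 - G *ᵥ p.1) ≤ q * (p.1 ⬝ᵥ p.1 + p.2 ⬝ᵥ p.2 + s)} ≤
      √q ^ (n + m) * Real.exp (s / 2) / |T.det| := by
  set V : Matrix (Fin n ⊕ Fin m) (Fin n ⊕ Fin m) ℝ := Matrix.fromBlocks 1 0 (-G) T
  have hdet : ((√q)⁻¹ • V).det = (√q)⁻¹ ^ (n + m) * T.det := by
    rw [Matrix.det_smul, Matrix.det_fromBlocks_zero₁₂, Matrix.det_one, one_mul, Fintype.card_sum,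
      Fintype.card_fin, Fintype.card_fin]
  set A := {w : Fin n ⊕ Fin m → ℝ | ((√q)⁻¹ • V *ᵥ w) ⬝ᵥ ((√q)⁻¹ • V *ᵥ w) ≤ w ⬝ᵥ w + s}
  have hA : MeasurableSet A := by
    have hcont : Continuous fun w : Fin n ⊕ Fin m → ℝ => (√q)⁻¹ • V *ᵥ w := by fun_prop
    exact measurableSet_le (hcont.dotProduct hcont).measurable
      (measurable_dotProduct_self.add_const s)
  have hbound := stdNormal_mulVec_le (T := (√q)⁻¹ • V)
    (by rw [hdet]; exact mul_ne_zero (by positivity) hT) s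
  simp only [Matrix.smul_mulVec] at hbound
  rw [← measureReal_preimage_of_measurePreserving (measurePreserving_sumElim_noise n m) hA, hdet,
    abs_mul, abs_of_pos (by positivity)] at hbound
  convert hbound using 1
  · congr 1
    ext ⟨u, v⟩
    have hV : V *ᵥ Sum.elim u v = Sum.elim u (T *ᵥ v - G *ᵥ u) := by
      simp only [V, Matrix.fromBlocks_mulVec, Sum.elim_comp_inl, Sum.elim_comp_inr,
        Matrix.one_mulVec, Matrix.zero_mulVec, add_zero, Matrix.neg_mulVec, neg_add_eq_sub]
    simp only [A, Set.mem_ofPred_eq, Set.mem_preimage, hV, smul_dotProduct, dotProduct_smul,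
      sumElim_dotProduct_sumElim, smul_eq_mul, ← mul_assoc, ← mul_inv, Real.mul_self_sqrt hq.le]
    rw [inv_mul_le_iff₀ hq]
  · rw [inv_pow]
    field_simp

/-- Bounds the probability that one given wrong codeword passes the test; `D` is the determinant
of the covariance matrix of the output. -/
noncomputable def confusionBound (n k : ℕ) (ε η D : ℝ) : ℝ :=
  √(1 + η) ^ (n + (n + k)) * Real.exp (ε * n) / √D

theorem confusionBound_le_of_le (n k : ℕ) (ε η : ℝ) {D D' : ℝ} (hD : 0 < D) (hDD' : D ≤ D') :
    confusionBound n k ε η D' ≤ confusionBound n k ε η D := by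
  have := Real.sqrt_pos.2 hD
  unfold confusionBound
  gcongr

theorem codewordLaw_prod_jointlyTypical_le (hn : 0 < n) (hS : S.PosDef)
    {K : Matrix (Fin (n + k)) (Fin (n + k)) ℝ} (hK : K.PosDef) (hη : 0 ≤ η) :
    ((codewordLaw S).prod (codewordLaw K)).real {p | JointlyTypical c S ε η p.1 p.2 ∧
        |p.2 ⬝ᵥ (K⁻¹ *ᵥ p.2) - (n + k : ℕ)| < ε * n} ≤ confusionBound n k ε η K.det := by
  obtain ⟨B, d, hB⟩ := exists_isSpectralFactor hS.posSemidef
  obtain ⟨T, d', hT⟩ := exists_isSpectralFactor hK.posSemidef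
  have hmeas : MeasurableSet {p : (Fin n → ℝ) × (Fin (n + k) → ℝ) |
      JointlyTypical c S ε η p.1 p.2 ∧ |p.2 ⬝ᵥ (K⁻¹ *ᵥ p.2) - (n + k : ℕ)| < ε * n} :=
    (measurableSet_jointlyTypical c S ε η).inter <| measurable_snd <|
      measurableSet_lt ((measurable_quadratic K⁻¹).sub_const _).abs measurable_const
  have hn' : (0 : ℝ) < n := Nat.cast_pos.2 hn
  have hN : (0 : ℝ) < (n : ℝ) + (n + k) := by positivity
  rw [← measureReal_preimage_of_measurePreserving (hB.measurePreserving.prod hT.measurePreserving)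
    hmeas]
  have hbound := noise_prod_noise_le (centreMatrix n c * B) (hT.isUnit_det hK).ne_zero
    (by linarith : 0 < 1 + η) (2 * (ε * n))
  rw [mul_div_cancel_left₀ _ two_ne_zero, ← Real.sqrt_mul_self_eq_abs, hT.det_mul_det] at hbound
  refine (measureReal_mono ?_).trans hbound
  rintro ⟨u, v⟩ ⟨hJ, hy⟩
  simp only [Prod.map_apply] at hJ hy
  rw [jointlyTypical_iff c hS, hB.inv_quadratic hS, abs_one_div_mul_sub_one_lt_iff hn',
    abs_one_div_mul_sub_one_lt_iff hN, Matrix.mulVec_mulVec] at hJ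
  rw [hT.inv_quadratic hK] at hy
  push_cast at hy
  have hu := (abs_lt.1 hJ.1).1
  have hv := (abs_lt.1 hy).1
  calc u ⬝ᵥ u + _ ≤ (1 + η) * (n + (n + k)) := by linarith [(abs_lt.1 hJ.2).2]
    _ ≤ (1 + η) * (u ⬝ᵥ u + v ⬝ᵥ v + 2 * (ε * n)) :=
      mul_le_mul_of_nonneg_left (by linarith) (by linarith)

end WrongCodeword

/-! ### The error probability of the random code -/

section BadEvent

variable {k n M : ℕ} {c r : Fin (k + 1) → ℝ} {h : Taps k} {S : Matrix (Fin n) (Fin n) ℝ}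
  {ε η : ℝ}

theorem measurePreserving_eval_pair {ι E : Type*} [Fintype ι] [MeasurableSpace E]
    (μ : ι → Measure E) [∀ i, IsProbabilityMeasure (μ i)] {i j : ι} (hij : i ≠ j) :
    MeasurePreserving (fun x : ι → E => (x i, x j)) (Measure.pi μ) ((μ i).prod (μ j)) := by
  have hindep := (iIndepFun_pi (μ := μ) (X := fun _ => id) fun _ => aemeasurable_id).indepFun hij
  refine ⟨(measurable_pi_apply i).prodMk (measurable_pi_apply j), ?_⟩
  rw [← (measurePreserving_eval μ i).map_eq, ← (measurePreserving_eval μ j).map_eq]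
  exact (indepFun_iff_map_prod_eq_prod_map_map (measurable_pi_apply i).aemeasurable
    (measurable_pi_apply j).aemeasurable).1 hindep

theorem measurePreserving_wrong_codeword_output (hS : S.PosSemidef) (h : Taps k) {i w : Fin M}
    (hiw : i ≠ w) :
    MeasurePreserving (fun p : (Fin M → Fin n → ℝ) × (Fin (n + k) → ℝ) =>
        (p.1 i, output h (p.1 w) p.2))
      ((Measure.pi fun _ : Fin M => codewordLaw S).prod (noise (n + k)))
      ((codewordLaw S).prod
        (codewordLaw (1 + channelMatrix n h * S * (channelMatrix n h)ᵀ))) :=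
  ((MeasurePreserving.id _).prod (measurePreserving_output hS h)).comp <|
    (measurePreserving_prodAssoc _ _ _).comp <|
      (measurePreserving_eval_pair (fun _ : Fin M => codewordLaw S) hiw).prod (.id _)

/-- The codebooks and noise vectors for which the decoder may fail on message `w`: the transmitted
codeword fails the test or has too much energy, or another codeword passes the test.  The energy
is included so that the same event controls the average power of a codebook. -/
def badEvent (c : Fin (k + 1) → ℝ) (S : Matrix (Fin n) (Fin n) ℝ) (ε η : ℝ) (h : Taps k)
    (w : Fin M) : Set ((Fin M → Fin n → ℝ) × (Fin (n + k) → ℝ)) :=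
  {p | (¬ JointlyTypical c S ε η (p.1 w) (output h (p.1 w) p.2) ∨
      S.trace + ε * n ≤ p.1 w ⬝ᵥ p.1 w) ∨
    ∃ i, i ≠ w ∧ JointlyTypical c S ε η (p.1 i) (output h (p.1 w) p.2)}

/-- The sum of the Chebyshev bounds for the input, the noise and the output being atypical; `C`
bounds the energy of the tap perturbation. -/
noncomputable def atypicalBound (n k : ℕ) (C trace lmax ε : ℝ) : ℝ :=
  (chiVar * n + chiVar * (lmax * trace) + chiVar * (n + k : ℕ) + C * (trace + ε * n)
    + chiVar * (n + k : ℕ)) / (ε * n) ^ 2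

theorem pi_prod_true_codeword_atypical_le (hn : 0 < n) (hb : InBox c r h) (hS : S.PosDef)
    (hε : 0 < ε)
    (hη : tapConst r * (S.trace / ((n : ℝ) + k + n)) + ε * (tapConst r + 4) ≤ η) (w : Fin M) :
    ((Measure.pi fun _ : Fin M => codewordLaw S).prod (noise (n + k))).real
        {p | ¬ JointlyTypical c S ε η (p.1 w) (output h (p.1 w) p.2) ∨
          S.trace + ε * n ≤ p.1 w ⬝ᵥ p.1 w} ≤
      (chiVar * n + chiVar * (lamMax S * S.trace) + chiVar * (n + k : ℕ) +
        tapConst r * (S.trace + ε * n)) / (ε * n) ^ 2 := by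
  refine le_of_eq_of_le ?_ (codewordLaw_prod_noise_atypical_le hn hb hS hε hη)
  have hw := (measurePreserving_eval (fun _ : Fin M => codewordLaw S) w).prod
    (.id (noise (n + k)))
  have hmeas : MeasurableSet {p : (Fin n → ℝ) × (Fin (n + k) → ℝ) |
      ¬ JointlyTypical c S ε η p.1 (output h p.1 p.2) ∨ S.trace + ε * n ≤ p.1 ⬝ᵥ p.1} :=
    ((measurable_fst.prodMk (measurable_output h))
      (measurableSet_jointlyTypical c S ε η)).compl.union <|
      measurableSet_le measurable_const (measurable_dotProduct_self.comp measurable_fst)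
  exact measureReal_preimage_of_measurePreserving hw hmeas

theorem pi_prod_output_atypical_le (hS : S.PosSemidef) (h : Taps k) {s : ℝ} (hs : 0 < s)
    (w : Fin M) :
    ((Measure.pi fun _ : Fin M => codewordLaw S).prod (noise (n + k))).real
        {p | s ≤ |output h (p.1 w) p.2 ⬝ᵥ ((1 + channelMatrix n h * S * (channelMatrix n h)ᵀ)⁻¹ *ᵥ
          output h (p.1 w) p.2) - (n + k : ℕ)|} ≤ chiVar * (n + k : ℕ) / s ^ 2 := by
  refine le_of_eq_of_le ?_ (codewordLaw_le_abs_inv_quadratic_sub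
    (posDef_one_add_mul_mul_transpose hS (channelMatrix n h)) hs)
  have hw := (measurePreserving_eval (fun _ : Fin M => codewordLaw S) w).prod
    (.id (noise (n + k)))
  exact measureReal_preimage_of_measurePreserving ((measurePreserving_output hS h).comp hw)
    (measurableSet_le measurable_const ((measurable_quadratic _).sub_const _).abs)

theorem pi_prod_wrong_codeword_le (hn : 0 < n) (hS : S.PosDef) (c : Fin (k + 1) → ℝ) (h : Taps k)
    (ε : ℝ) (hη : 0 ≤ η) {i w : Fin M} (hiw : i ≠ w) :
    ((Measure.pi fun _ : Fin M => codewordLaw S).prod (noise (n + k))).real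
        {p | JointlyTypical c S ε η (p.1 i) (output h (p.1 w) p.2) ∧
          |output h (p.1 w) p.2 ⬝ᵥ ((1 + channelMatrix n h * S * (channelMatrix n h)ᵀ)⁻¹ *ᵥ
            output h (p.1 w) p.2) - (n + k : ℕ)| < ε * n} ≤
      confusionBound n k ε η (1 + channelMatrix n h * S * (channelMatrix n h)ᵀ).det := by
  refine le_of_eq_of_le ?_ (codewordLaw_prod_jointlyTypical_le (c := c) (ε := ε) hn hS
    (posDef_one_add_mul_mul_transpose hS.posSemidef (channelMatrix n h)) hη)
  have hmeas : MeasurableSet {p : (Fin n → ℝ) × (Fin (n + k) → ℝ) | JointlyTypical c S ε η p.1 p.2 ∧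
      |p.2 ⬝ᵥ ((1 + channelMatrix n h * S * (channelMatrix n h)ᵀ)⁻¹ *ᵥ p.2) - (n + k : ℕ)| <
        ε * n} :=
    (measurableSet_jointlyTypical c S ε η).inter <| measurable_snd <|
      measurableSet_lt ((measurable_quadratic _).sub_const _).abs measurable_const
  exact measureReal_preimage_of_measurePreserving
    (measurePreserving_wrong_codeword_output hS.posSemidef h hiw) hmeas

theorem det_one_add_centre_pos (c : Fin (k + 1) → ℝ) (hS : S.PosSemidef) :
    0 < (1 + (centreMatrix n c)ᵀ * centreMatrix n c * S).det := by
  rw [Matrix.mul_assoc, Matrix.det_one_add_mul_comm]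
  exact (posDef_one_add_mul_mul_transpose hS _).det_pos

theorem badEvent_le (hn : 0 < n) (hb : InBox c r h) (hS : S.PosDef) (hphi : phi1 c r S < 1)
    (hε : 0 < ε)
    (hη : tapConst r * (S.trace / ((n : ℝ) + k + n)) + ε * (tapConst r + 4) ≤ η) (w : Fin M) :
    ((Measure.pi fun _ : Fin M => codewordLaw S).prod (noise (n + k))).real
        (badEvent c S ε η h w) ≤
      atypicalBound n k (tapConst r) S.trace (lamMax S) ε + ((M : ℝ) - 1) * confusionBound n k ε η
        ((1 - phi1 c r S) ^ n * (1 + (centreMatrix n c)ᵀ * centreMatrix n c * S).det) := by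
  set μ := (Measure.pi fun _ : Fin M => codewordLaw S).prod (noise (n + k))
  set K := 1 + channelMatrix n h * S * (channelMatrix n h)ᵀ
  set D := (1 - phi1 c r S) ^ n * (1 + (centreMatrix n c)ᵀ * centreMatrix n c * S).det
  set E₁ := {p : (Fin M → Fin n → ℝ) × (Fin (n + k) → ℝ) |
    ¬ JointlyTypical c S ε η (p.1 w) (output h (p.1 w) p.2) ∨ S.trace + ε * n ≤ p.1 w ⬝ᵥ p.1 w}
  set E₂ := {p : (Fin M → Fin n → ℝ) × (Fin (n + k) → ℝ) |
    ε * n ≤ |output h (p.1 w) p.2 ⬝ᵥ (K⁻¹ *ᵥ output h (p.1 w) p.2) - (n + k : ℕ)|}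
  set E₃ := fun i : Fin M => {p : (Fin M → Fin n → ℝ) × (Fin (n + k) → ℝ) |
    JointlyTypical c S ε η (p.1 i) (output h (p.1 w) p.2) ∧
      |output h (p.1 w) p.2 ⬝ᵥ (K⁻¹ *ᵥ output h (p.1 w) p.2) - (n + k : ℕ)| < ε * n}
  have hη0 : 0 ≤ η := by
    have := tapConst_nonneg r
    have := hS.posSemidef.trace_nonneg
    exact hη.trans' (by positivity)
  have hE₁ := pi_prod_true_codeword_atypical_le hn hb hS hε hη w
  have hE₂ := pi_prod_output_atypical_le hS.posSemidef h (by positivity : 0 < ε * n) w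
  have hE₃ : ∀ i ∈ Finset.univ.erase w, μ.real (E₃ i) ≤ confusionBound n k ε η D := fun i hi =>
    (pi_prod_wrong_codeword_le hn hS c h ε hη0 (Finset.ne_of_mem_erase hi)).trans <|
      confusionBound_le_of_le _ _ _ _ (mul_pos (pow_pos (sub_pos.2 hphi) n)
        (det_one_add_centre_pos c hS.posSemidef)) (phi1_pow_mul_det_le hb hS hphi)
  have hcard : ((Finset.univ.erase w).card : ℝ) = (M : ℝ) - 1 := by
    rw [Finset.cast_card_erase_of_mem (Finset.mem_univ w), Finset.card_univ, Fintype.card_fin]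
  have hsub : badEvent c S ε η h w ⊆ E₁ ∪ E₂ ∪ ⋃ i ∈ Finset.univ.erase w, E₃ i := by
    rintro p (hp | ⟨i, hi, hp⟩)
    · exact .inl (.inl hp)
    · rcases le_or_gt (ε * n) _ with hy | hy
      · exact .inl (.inr hy)
      · exact .inr (Set.mem_biUnion (Finset.mem_erase.2 ⟨hi, Finset.mem_univ i⟩) ⟨hp, hy⟩)
  calc μ.real (badEvent c S ε η h w) ≤ μ.real (E₁ ∪ E₂ ∪ ⋃ i ∈ Finset.univ.erase w, E₃ i) :=
        measureReal_mono hsub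
    _ ≤ μ.real E₁ + μ.real E₂ + ∑ i ∈ Finset.univ.erase w, μ.real (E₃ i) :=
        (measureReal_union_le _ _).trans <|
          add_le_add (measureReal_union_le _ _) (measureReal_biUnion_finset_le _ _)
    _ ≤ _ := add_le_add (add_le_add hE₁ hE₂) (Finset.sum_le_sum hE₃)
    _ = _ := by rw [Finset.sum_const, nsmul_eq_mul, hcard, atypicalBound, ← add_div]

end BadEvent

/-! ### Exponents -/

section Exponents

variable {k n : ℕ} {c r : Fin (k + 1) → ℝ} {S : Matrix (Fin n) (Fin n) ℝ}

theorem neg_half_logb_le_delta (hr : ∀ i, 0 ≤ r i) (hS : S.PosDef) :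
    -(1 / 2) * Real.logb 2 (1 - phi1 c r S) ≤ delta c r S := by
  have hloss : 0 ≤ rSum r * (rSum r + 2 * beta c) := energyLoss_nonneg c hr
  have htr := hS.posSemidef.trace_nonneg
  have hmax := lamMax_nonneg hS
  have hphi₂ : 0 ≤ phi2 c r S := by unfold phi2; positivity
  have hphi₃ : 0 ≤ phi3 c r S := by unfold phi3; positivity
  have hphi₃' : phi3 c r S ≤ 1 :=
    div_le_one_of_le₀ (le_add_of_nonneg_right (by positivity)) (by positivity)
  have hprod : max 0 (1 - phi2 c r S) * phi3 c r S ≤ 1 :=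
    mul_le_one₀ (max_le zero_le_one (by linarith)) hphi₃ hphi₃'
  exact le_add_of_nonneg_right (mul_nonneg (by positivity) (sub_nonneg.2 hprod))

theorem boundTerm_add_log_le_half_log_det (hn : 0 < n) (hr : ∀ i, 0 ≤ r i) (hS : S.PosDef)
    (hphi : phi1 c r S < 1) :
    n * Real.log 2 * boundTerm c r S +
        n * Real.log (1 + tapConst r * (S.trace / ((n : ℝ) + k + n))) ≤
      1 / 2 * Real.log ((1 - phi1 c r S) ^ n *
        (1 + (centreMatrix n c)ᵀ * centreMatrix n c * S).det) := by
  have hdelta := neg_half_logb_le_delta (c := c) hr hS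
  have hdet := det_one_add_centre_pos c hS.posSemidef
  set X := Real.log (1 - phi1 c r S) with hX
  set Y := Real.log (1 + (centreMatrix n c)ᵀ * centreMatrix n c * S).det with hY
  set Z := Real.log (1 + tapConst r * (S.trace / ((n : ℝ) + k + n)))
  have hbound : boundTerm c r S =
      1 / (2 * n) * (Y / Real.log 2) - Z / Real.log 2 - delta c r S := rfl
  rw [Real.log_mul (pow_ne_zero _ (sub_pos.2 hphi).ne') hdet.ne', Real.log_pow, ← hX, ← hY]
  calc n * Real.log 2 * boundTerm c r S + n * Z
      = 1 / 2 * Y - n * (Real.log 2 * delta c r S) := by rw [hbound]; field_simp; ring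
    _ ≤ 1 / 2 * Y - n * (Real.log 2 * (-(1 / 2) * (X / Real.log 2))) := by gcongr; exact hdelta
    _ = 1 / 2 * (n * X + Y) := by field_simp; ring

theorem log_one_add_le_add_sub {a b : ℝ} (ha : 0 ≤ a) (hab : a ≤ b) :
    Real.log (1 + b) ≤ Real.log (1 + a) + (b - a) := by
  have hpos : 0 < 1 + a := by linarith
  have hquot : (1 + b) / (1 + a) - 1 ≤ b - a := by
    rw [div_sub_one hpos.ne', add_sub_add_left_eq_sub]
    exact div_le_self (by linarith) (by linarith)
  have hlog := Real.log_le_sub_one_of_pos (div_pos (by linarith : 0 < 1 + b) hpos)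
  rw [Real.log_div (by linarith) hpos.ne'] at hlog
  linarith

theorem confusionBound_eq_exp (n k : ℕ) {ε η D : ℝ} (hη : 0 < 1 + η) (hD : 0 < D) :
    confusionBound n k ε η D =
      Real.exp ((n + (n + k)) * (Real.log (1 + η) / 2) + ε * n - 1 / 2 * Real.log D) := by
  have hsqrt {a : ℝ} (ha : 0 < a) : √a = Real.exp (Real.log a / 2) := by
    rw [← Real.log_sqrt ha.le, Real.exp_log (Real.sqrt_pos.2 ha)]
  rw [confusionBound, hsqrt hη, hsqrt hD, ← Real.exp_nat_mul, ← Real.exp_add, ← Real.exp_sub]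
  push_cast
  ring_nf

theorem rpow_mul_confusionBound_le (hn : 0 < n) (hr : ∀ i, 0 ≤ r i) {P : ℝ} (hS : S.PosDef)
    (htr : S.trace ≤ n * P) (hphi : phi1 c r S < 1) {R R₁ ε : ℝ} (hε : 0 < ε)
    (hgap : ε * (tapConst r + 5) ≤ Real.log 2 * (R₁ - R) / 2) (hR₁ : R₁ ≤ boundTerm c r S) :
    (2 : ℝ) ^ ((n : ℝ) * R) * confusionBound n k ε
      (tapConst r * (S.trace / ((n : ℝ) + k + n)) + ε * (tapConst r + 4))
      ((1 - phi1 c r S) ^ n * (1 + (centreMatrix n c)ᵀ * centreMatrix n c * S).det) ≤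
    Real.exp (-(n * (Real.log 2 * (R₁ - R) / 2)) +
      k / 2 * (tapConst r * P + ε * (tapConst r + 4))) := by
  have hn' : (0 : ℝ) < n := Nat.cast_pos.2 hn
  have hC := tapConst_nonneg r
  have htr₀ := hS.posSemidef.trace_nonneg
  have hdet := mul_pos (pow_pos (sub_pos.2 hphi) n) (det_one_add_centre_pos c hS.posSemidef)
  have hexponent := boundTerm_add_log_le_half_log_det hn hr hS hphi
  set ρ := tapConst r * (S.trace / ((n : ℝ) + k + n)) with hρ
  set μ := ε * (tapConst r + 4)
  have hρ₀ : 0 ≤ ρ := by positivity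
  have hμ : 0 ≤ μ := by positivity
  have hP : 0 ≤ P := nonneg_of_mul_nonneg_right (htr₀.trans htr) hn'
  have hρP : ρ ≤ tapConst r * P := by
    rw [hρ]
    gcongr
    rw [div_le_iff₀ (by positivity)]
    nlinarith [Nat.cast_nonneg (α := ℝ) k]
  rw [confusionBound_eq_exp n k (by linarith : 0 < 1 + (ρ + μ)) hdet,
    Real.rpow_def_of_pos two_pos, ← Real.exp_add, Real.exp_le_exp]
  have hlogη : n * Real.log (1 + (ρ + μ)) ≤ n * (Real.log (1 + ρ) + μ) := by
    gcongr
    simpa only [add_sub_cancel_left] using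
      log_one_add_le_add_sub hρ₀ (le_add_of_nonneg_right hμ : ρ ≤ ρ + μ)
  have hlogη' : (k : ℝ) / 2 * Real.log (1 + (ρ + μ)) ≤ k / 2 * (tapConst r * P + μ) := by
    gcongr
    linarith [Real.log_le_sub_one_of_pos (by linarith : 0 < 1 + (ρ + μ))]
  have hrate : n * Real.log 2 * R₁ ≤ n * Real.log 2 * boundTerm c r S := by gcongr
  have hloss : n * (μ + ε) ≤ n * (Real.log 2 * (R₁ - R) / 2) := by
    gcongr
    linarith
  linarith

theorem tendsto_atypicalBound {P C ε : ℝ} (hC : 0 ≤ C) (hε : 0 < ε)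
    {S : ∀ n : ℕ, Matrix (Fin n) (Fin n) ℝ} (hS : ∀ n, (S n).PosDef)
    (htr : ∀ n, (S n).trace ≤ n * P)
    (hmax : Tendsto (fun n : ℕ => 1 / (n : ℝ) * lamMax (S n)) atTop (𝓝 0)) :
    Tendsto (fun n => atypicalBound n k C (S n).trace (lamMax (S n)) ε) atTop (𝓝 0) := by
  have hχ := chiVar_nonneg
  have htr₀ := fun n => (hS n).posSemidef.trace_nonneg
  have hmax₀ := fun n => lamMax_nonneg (hS n)
  set A := 3 * chiVar + 2 * chiVar * k + C * (P + ε)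
  have hlim : Tendsto (fun n : ℕ => 1 / (n : ℝ) * (A / ε ^ 2) +
      1 / (n : ℝ) * lamMax (S n) * (chiVar * P / ε ^ 2)) atTop (𝓝 0) := by
    simpa only [zero_mul, add_zero] using
      ((tendsto_one_div_atTop_nhds_zero_nat (𝕜 := ℝ)).mul_const _).add (hmax.mul_const _)
  refine squeeze_zero' (Eventually.of_forall fun n => ?_) ?_ hlim
  · have := htr₀ n
    have := hmax₀ n
    unfold atypicalBound
    positivity
  filter_upwards [eventually_ge_atTop 1] with n hn
  have hn' : (1 : ℝ) ≤ n := Nat.one_le_cast.2 hn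
  have hmax_n := hmax₀ n
  have hinput : chiVar * (lamMax (S n) * (S n).trace) ≤ chiVar * (lamMax (S n) * (n * P)) := by
    gcongr
    exact htr n
  have hloss : C * (S n).trace ≤ C * (n * P) := by
    gcongr
    exact htr n
  have hk : chiVar * k ≤ chiVar * k * n := le_mul_of_one_le_right (by positivity) hn'
  calc atypicalBound n k C (S n).trace (lamMax (S n)) ε
      ≤ (A * n + lamMax (S n) * (chiVar * P) * n) / (ε * n) ^ 2 := by
        refine div_le_div_of_nonneg_right ?_ (sq_nonneg _)
        simp only [A, Nat.cast_add]
        linarith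
    _ = _ := by field_simp

theorem exists_uniform_badEvent_le (hr : ∀ i, 0 ≤ r i) {P : ℝ}
    {S : ∀ n : ℕ, Matrix (Fin n) (Fin n) ℝ} (hS : ∀ n, (S n).PosDef)
    (htr : ∀ n, (S n).trace ≤ n * P)
    (hmax : Tendsto (fun n : ℕ => 1 / (n : ℝ) * lamMax (S n)) atTop (𝓝 0))
    (hphi : ∀ n, phi1 c r (S n) < 1) {R : ℝ} (hR : (R : EReal) < lowerBound c r S)
    {θ : ℝ} (hθ : 0 < θ) :
    ∃ ε, 0 < ε ∧ ε ≤ θ ∧ ∃ η : ℕ → ℝ, (∀ n, 0 < η n) ∧ ∀ δ > 0, ∀ᶠ n in atTop,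
      ∀ M ≤ numMessages n R, ∀ h, InBox c r h → ∀ w : Fin M,
        ((Measure.pi fun _ : Fin M => codewordLaw (S n)).prod (noise (n + k))).real
          (badEvent c (S n) ε (η n) h w) ≤ δ := by
  obtain ⟨R₁, hRR₁, hR₁⟩ := EReal.lt_iff_exists_real_btwn.1 hR
  have hC := tapConst_nonneg r
  have hgap : 0 < Real.log 2 * (R₁ - R) / 2 :=
    half_pos (mul_pos (Real.log_pos one_lt_two) (sub_pos.2 (EReal.coe_lt_coe_iff.1 hRR₁)))
  set g := Real.log 2 * (R₁ - R) / 2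
  set ε := min θ (g / (tapConst r + 5))
  have hε : 0 < ε := lt_min hθ (by positivity)
  have hεg : ε * (tapConst r + 5) ≤ g :=
    (le_div_iff₀ (by positivity)).1 (min_le_right _ _)
  have hconf : Tendsto (fun n : ℕ => Real.exp (-(n * g) +
      k / 2 * (tapConst r * P + ε * (tapConst r + 4)))) atTop (𝓝 0) :=
    Real.tendsto_exp_atBot.comp <| tendsto_atBot_add_const_right _ _ <|
      tendsto_neg_atTop_atBot.comp (tendsto_natCast_atTop_atTop.atTop_mul_const hgap)
  have hsum := (tendsto_atypicalBound (k := k) hC hε hS htr hmax).add hconf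
  rw [add_zero] at hsum
  refine ⟨ε, hε, min_le_left _ _,
    fun n => tapConst r * ((S n).trace / ((n : ℝ) + k + n)) + ε * (tapConst r + 4), fun n => ?_,
    fun δ hδ => ?_⟩
  · have := (hS n).posSemidef.trace_nonneg
    positivity
  filter_upwards [hsum.eventually_lt_const hδ, eventually_lt_of_lt_liminf hR₁,
    eventually_gt_atTop 0] with n hsum_n hbound hn M hM h hb w
  have hM' : (M : ℝ) - 1 ≤ 2 ^ ((n : ℝ) * R) :=
    (sub_le_sub_right (Nat.cast_le.2 hM) 1).trans
      (sub_le_iff_le_add.2 (Nat.ceil_lt_add_one (by positivity)).le)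
  refine (badEvent_le hn hb (hS n) (hphi n) hε le_rfl w).trans (hsum_n.le.trans' ?_)
  gcongr
  refine (mul_le_mul_of_nonneg_right hM' ?_).trans <| rpow_mul_confusionBound_le hn hr (hS n)
    (htr n) (hphi n) hε hεg (EReal.coe_lt_coe_iff.1 hbound).le
  unfold confusionBound
  positivity

end Exponents

/-! ### The random code against an arbitrary law of the taps -/

section Ensemble

variable {k n M : ℕ} {c r : Fin (k + 1) → ℝ} {S : Matrix (Fin n) (Fin n) ℝ} {ε η : ℝ}

theorem jtDecode_eq_some {X : Fin M → Fin n → ℝ} {y : Fin (n + k) → ℝ} {w : Fin M}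
    (hw : JointlyTypical c S ε η (X w) y)
    (hne : ∀ i, i ≠ w → ¬ JointlyTypical c S ε η (X i) y) : jtDecode c S ε η X y = some w := by
  have h : ∃! i, JointlyTypical c S ε η (X i) y :=
    ⟨w, hw, fun i hi => by_contra fun hiw => hne i hiw hi⟩
  rw [jtDecode, dif_pos h, h.unique h.choose_spec.1 hw]

theorem jtDecode_eq_some_of_notMem_badEvent {h : Taps k} {w : Fin M}
    {p : (Fin M → Fin n → ℝ) × (Fin (n + k) → ℝ)} (hp : p ∉ badEvent c S ε η h w) :
    jtDecode c S ε η p.1 (output h (p.1 w) p.2) = some w := by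
  simp only [badEvent, Set.mem_ofPred_eq, not_or, not_not, not_exists, not_and] at hp
  exact jtDecode_eq_some hp.1.1 hp.2

theorem measurable_channelMatrix_apply (t : Fin (n + k)) (j : Fin n) :
    Measurable fun h : Taps k => channelMatrix n h t j := by
  simp only [channelMatrix, Matrix.of_apply]
  split_ifs
  · exact (measurable_pi_apply _).comp (measurable_pi_apply _)
  · exact measurable_const

theorem measurable_output_comp {α : Type*} [MeasurableSpace α] {h : α → Taps k}
    {x : α → Fin n → ℝ} {z : α → Fin (n + k) → ℝ} (hh : Measurable h) (hx : Measurable x)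
    (hz : Measurable z) : Measurable fun a => output (h a) (x a) (z a) := by
  refine measurable_pi_iff.2 fun t => ?_
  have hmulVec : Measurable fun a => ∑ j, channelMatrix n (h a) t j * x a j :=
    Finset.measurable_sum _ fun j _ =>
      ((measurable_channelMatrix_apply t j).comp hh).mul ((measurable_pi_apply j).comp hx)
  exact hmulVec.add ((measurable_pi_apply t).comp hz)

theorem measurableSet_badEvent_uncurry (c : Fin (k + 1) → ℝ) (S : Matrix (Fin n) (Fin n) ℝ)
    (ε η : ℝ) (w : Fin M) :
    MeasurableSet {q : Taps k × (Fin M → Fin n → ℝ) × (Fin (n + k) → ℝ) |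
      q.2 ∈ badEvent c S ε η q.1 w} := by
  have hcodeword (i : Fin M) :
      Measurable fun q : Taps k × (Fin M → Fin n → ℝ) × (Fin (n + k) → ℝ) => q.2.1 i :=
    (measurable_pi_apply i).comp (measurable_fst.comp measurable_snd)
  have houtput : Measurable fun q : Taps k × (Fin M → Fin n → ℝ) × (Fin (n + k) → ℝ) =>
      output q.1 (q.2.1 w) q.2.2 :=
    measurable_output_comp measurable_fst (hcodeword w) measurable_snd.snd
  have htypical (i : Fin M) :
      MeasurableSet {q : Taps k × (Fin M → Fin n → ℝ) × (Fin (n + k) → ℝ) |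
        JointlyTypical c S ε η (q.2.1 i) (output q.1 (q.2.1 w) q.2.2)} :=
    ((hcodeword i).prodMk houtput) (measurableSet_jointlyTypical c S ε η)
  have henergy : MeasurableSet {q : Taps k × (Fin M → Fin n → ℝ) × (Fin (n + k) → ℝ) |
      S.trace + ε * n ≤ q.2.1 w ⬝ᵥ q.2.1 w} :=
    measurableSet_le measurable_const (measurable_dotProduct_self.comp (hcodeword w))
  have hother : MeasurableSet {q : Taps k × (Fin M → Fin n → ℝ) × (Fin (n + k) → ℝ) |
      ∃ i, i ≠ w ∧ JointlyTypical c S ε η (q.2.1 i) (output q.1 (q.2.1 w) q.2.2)} := by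
    rw [Set.ofPred_exists]
    exact .iUnion fun i => (MeasurableSet.const (i ≠ w)).inter (htypical i)
  exact ((htypical w).compl.union henergy).union hother

theorem IsTapLaw.ae_inBox {ν : Measure (Taps k)} (hν : IsTapLaw c r ν) : ∀ᵐ h ∂ν, InBox c r h :=
  ae_all_iff.2 fun t => ae_all_iff.2 fun i => hν.supp t i

theorem measurePreserving_prod_left_comm {α β γ : Type*} [MeasurableSpace α] [MeasurableSpace β]
    [MeasurableSpace γ] (μ : Measure α) (ν : Measure β) (ξ : Measure γ) [SFinite μ] [SFinite ν]
    [SFinite ξ] :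
    MeasurePreserving (fun p : α × β × γ => (p.2.1, p.1, p.2.2)) (μ.prod (ν.prod ξ))
      (ν.prod (μ.prod ξ)) :=
  (measurePreserving_prodAssoc ν μ ξ).comp ((Measure.measurePreserving_swap.prod
    (MeasurePreserving.id ξ)).comp ((measurePreserving_prodAssoc μ ν ξ).symm _))

theorem ensembleError_nonneg (c : Fin (k + 1) → ℝ) (S : Matrix (Fin n) (Fin n) ℝ)
    (ε η : ℝ) (ν : Measure (Taps k)) : 0 ≤ ensembleError c S ε η M ν :=
  mul_nonneg (by positivity) (Finset.sum_nonneg fun _ _ => measureReal_nonneg)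

theorem inv_mul_sum_le_of_forall_le {f : Fin M → ℝ} {b : ℝ} (hb : 0 ≤ b) (hf : ∀ w, f w ≤ b) :
    (M : ℝ)⁻¹ * ∑ w, f w ≤ b := by
  calc (M : ℝ)⁻¹ * ∑ w, f w ≤ (M : ℝ)⁻¹ * ∑ _w : Fin M, b := by gcongr with w; exact hf w
    _ = ((M : ℝ)⁻¹ * M) * b := by rw [Finset.sum_const, Finset.card_fin, nsmul_eq_mul, mul_assoc]
    _ ≤ b := mul_le_of_le_one_left hb inv_mul_le_one

theorem ensembleError_le {δ : ℝ} (hδ : 0 ≤ δ)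
    (hbad : ∀ h, InBox c r h → ∀ w : Fin M,
      ((Measure.pi fun _ : Fin M => codewordLaw S).prod (noise (n + k))).real
        (badEvent c S ε η h w) ≤ δ) {ν : Measure (Taps k)} (hν : IsTapLaw c r ν) :
    ensembleError c S ε η M ν ≤ δ := by
  have := hν.prob
  refine inv_mul_sum_le_of_forall_le hδ fun w => ?_
  have hmeas := measurableSet_badEvent_uncurry c S ε η w
  calc ((Measure.pi fun _ : Fin M => codewordLaw S).prod (ν.prod (noise (n + k)))).real
        {p | jtDecode c S ε η p.1 (output p.2.1 (p.1 w) p.2.2) ≠ some w}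
      ≤ ((Measure.pi fun _ : Fin M => codewordLaw S).prod (ν.prod (noise (n + k)))).real
        {p | (p.1, p.2.2) ∈ badEvent c S ε η p.2.1 w} :=
        measureReal_mono fun p hp => by_contra fun hgood =>
          hp (jtDecode_eq_some_of_notMem_badEvent (p := (p.1, p.2.2)) hgood)
    _ = (ν.prod ((Measure.pi fun _ : Fin M => codewordLaw S).prod (noise (n + k)))).real
        {q | q.2 ∈ badEvent c S ε η q.1 w} :=
        measureReal_preimage_of_measurePreserving (measurePreserving_prod_left_comm _ _ _) hmeas
    _ ≤ δ := measureReal_prod_le_of_forall hmeas hδ (hν.ae_inBox.mono fun h hb => hbad h hb w)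

theorem tendsto_zero_of_eventually_le {u : ℕ → ℝ} (hu : ∀ n, 0 ≤ u n)
    (h : ∀ δ > 0, ∀ᶠ n in atTop, u n ≤ δ) : Tendsto u atTop (𝓝 0) :=
  tendsto_order.2 ⟨fun _ ha => .of_forall fun n => ha.trans_le (hu n),
    fun a ha => (h (a / 2) (half_pos ha)).mono fun _ hn => hn.trans_lt (half_lt_self ha)⟩

theorem tendsto_ensembleError (hr : ∀ i, 0 ≤ r i) {P : ℝ}
    {S : ∀ n : ℕ, Matrix (Fin n) (Fin n) ℝ} (hS : ∀ n, (S n).PosDef)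
    (htr : ∀ n, (S n).trace ≤ n * P)
    (hmax : Tendsto (fun n : ℕ => 1 / (n : ℝ) * lamMax (S n)) atTop (𝓝 0))
    (hphi : ∀ n, phi1 c r (S n) < 1) {R : ℝ} (hR : (R : EReal) < lowerBound c r S) :
    ∃ ε : ℝ, 0 < ε ∧ ∃ η : ℕ → ℝ, (∀ n, 0 < η n) ∧
      ∀ ν : Measure (Taps k), IsTapLaw c r ν →
        Tendsto (fun n => ensembleError c (S n) ε (η n) (numMessages n R) ν) atTop (𝓝 0) := by
  obtain ⟨ε, hε, -, η, hη, hbad⟩ :=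
    exists_uniform_badEvent_le hr hS htr hmax hphi hR one_pos
  refine ⟨ε, hε, η, hη, fun ν hν => tendsto_zero_of_eventually_le
    (fun n => ensembleError_nonneg _ _ _ _ _) fun δ hδ => ?_⟩
  exact (hbad δ hδ).mono fun n hn => ensembleError_le hδ.le (hn _ le_rfl) hν

end Ensemble

/-! ### Simultaneous selection of good samples -/

section Selection

variable {E : Type*} [MeasurableSpace E] {π : Measure E} [IsProbabilityMeasure π]

theorem measureReal_pi_sum_ge_le_exp {ι : Type*} [Fintype ι] {e : E → ℝ} (he : Measurable e)
    (hmem : ∀ x, e x ∈ Set.Icc 0 1) {δ s : ℝ} (hδ : ∫ x, e x ∂π ≤ δ) (hs : 0 ≤ s) :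
    (Measure.pi fun _ : ι => π).real {X | (δ + s) * Fintype.card ι ≤ ∑ i, e (X i)} ≤
      Real.exp (-(Fintype.card ι * (2 * s ^ 2))) := by
  set m := ∫ x, e x ∂π
  have hindep : iIndepFun (fun i (X : ι → E) => e (X i) - m) (Measure.pi fun _ : ι => π) :=
    iIndepFun_pi fun _ => (he.sub_const m).aemeasurable
  have hsub (i : ι) : HasSubgaussianMGF (fun X : ι → E => e (X i) - m) ((‖(1 : ℝ) - 0‖₊ / 2) ^ 2)
      (Measure.pi fun _ : ι => π) := by
    have hmean : ∫ X : ι → E, e (X i) ∂(Measure.pi fun _ : ι => π) = m :=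
      integral_comp_eval he.aestronglyMeasurable
    have he_i : Measurable fun X : ι → E => e (X i) := he.comp (measurable_pi_apply i)
    rw [← hmean]
    exact hasSubgaussianMGF_of_mem_Icc he_i.aemeasurable (ae_of_all _ fun X => hmem (X i))
  have hcard : (0 : ℝ) ≤ Fintype.card ι := Nat.cast_nonneg _
  calc _ ≤ (Measure.pi fun _ : ι => π).real
        {X | Fintype.card ι * s ≤ ∑ i, (e (X i) - m)} := by
        refine measureReal_mono fun X hX => ?_
        simp only [Set.mem_ofPred_eq, Finset.sum_sub_distrib, Finset.sum_const, Finset.card_univ,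
          nsmul_eq_mul] at hX ⊢
        nlinarith
    _ ≤ _ := HasSubgaussianMGF.measure_sum_ge_le_of_iIndepFun hindep (fun i _ => hsub i)
        (by positivity)
    _ = _ := by
        congr 1
        rcases hcard.eq_or_lt with h | h
        · simp [← h]
        · simp only [sub_zero, nnnorm_one, Finset.sum_const, Finset.card_univ, nsmul_eq_mul]
          push_cast
          field_simp

theorem exists_forall_sum_lt {ι G : Type*} [Fintype ι] [Fintype G] {e : G → E → ℝ}
    (he : ∀ g, Measurable (e g)) (hmem : ∀ g x, e g x ∈ Set.Icc 0 1) {δ s : ℝ}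
    (hδ : ∀ g, ∫ x, e g x ∂π ≤ δ) (hs : 0 ≤ s)
    (hcard : Fintype.card G * Real.exp (-(Fintype.card ι * (2 * s ^ 2))) < 1) :
    ∃ X : ι → E, ∀ g, ∑ i, e g (X i) < (δ + s) * Fintype.card ι := by
  by_contra! hcon
  have hcover : Set.univ ⊆ ⋃ g, {X : ι → E | (δ + s) * Fintype.card ι ≤ ∑ i, e g (X i)} :=
    fun X _ => Set.mem_iUnion.2 (hcon X)
  have : (1 : ℝ) < 1 := calc
    1 = (Measure.pi fun _ : ι => π).real Set.univ := probReal_univ.symm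
    _ ≤ ∑ g, (Measure.pi fun _ : ι => π).real
        {X : ι → E | (δ + s) * Fintype.card ι ≤ ∑ i, e g (X i)} :=
      (measureReal_mono hcover).trans (measureReal_iUnion_fintype_le _)
    _ ≤ ∑ _g : G, Real.exp (-(Fintype.card ι * (2 * s ^ 2))) :=
      Finset.sum_le_sum fun g _ => measureReal_pi_sum_ge_le_exp (he g) (hmem g) (hδ g) hs
    _ < 1 := by rwa [Finset.sum_const, Finset.card_univ, nsmul_eq_mul]
  exact lt_irrefl 1 this

end Selection

/-! ### A finite grid of tap arrays -/

section Grid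

variable {k n : ℕ} {c r : Fin (k + 1) → ℝ} {h g : Taps k} {q : ℕ}

/-- The tap arrays with `h t i = c i - r i + 2 * r i * (j t i / q)` for `t < N`; later
taps, which a block of `N` outputs does not see, are set to the centre. -/
noncomputable def gridTaps (c r : Fin (k + 1) → ℝ) (N q : ℕ)
    (j : Fin N → Fin (k + 1) → Fin (q + 1)) : Taps k := fun t i =>
  if ht : t < N then c i - r i + 2 * r i * ((j ⟨t, ht⟩ i : ℕ) / (q : ℝ)) else c i

theorem inBox_gridTaps (hr : ∀ i, 0 ≤ r i) {N : ℕ} (j : Fin N → Fin (k + 1) → Fin (q + 1)) :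
    InBox c r (gridTaps c r N q j) := by
  intro t i
  have hri := hr i
  unfold gridTaps
  split_ifs with ht
  · set a := ((j ⟨t, ht⟩ i : ℕ) : ℝ) / q
    have ha₀ : 0 ≤ 2 * r i * a := by positivity
    have ha₁ : a ≤ 1 := div_le_one_of_le₀ (Nat.cast_le.2 (Fin.is_le _)) (Nat.cast_nonneg q)
    constructor <;> nlinarith
  · constructor <;> linarith

theorem exists_abs_sub_grid_le {a ρ x : ℝ} (hx : x ∈ Set.Icc (a - ρ) (a + ρ)) (hq : 0 < q) :
    ∃ j : Fin (q + 1), |x - (a - ρ + 2 * ρ * ((j : ℕ) / (q : ℝ)))| ≤ 2 * ρ / q := by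
  have hq' : (0 : ℝ) < q := Nat.cast_pos.2 hq
  have hρ : 0 ≤ ρ := by linarith [hx.1, hx.2]
  rcases hρ.eq_or_lt with rfl | hρ
  · refine ⟨0, ?_⟩
    simp [le_antisymm (by simpa using hx.2) (by simpa using hx.1)]
  set s := (x - (a - ρ)) / (2 * ρ) * q with hs
  have hs₀ : 0 ≤ s := mul_nonneg (div_nonneg (sub_nonneg.2 hx.1) (by positivity)) hq'.le
  have hsq : s ≤ q := by
    refine mul_le_of_le_one_left hq'.le ((div_le_one (by positivity)).2 ?_)
    linarith [hx.2]
  refine ⟨⟨⌊s⌋₊, Nat.lt_succ_iff.2 (Nat.floor_le_of_le hsq)⟩, ?_⟩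
  have hround : x - (a - ρ + 2 * ρ * ((⌊s⌋₊ : ℕ) / (q : ℝ))) = 2 * ρ / q * (s - ⌊s⌋₊) := by
    rw [hs]
    field_simp
    ring
  rw [hround, abs_of_nonneg (mul_nonneg (by positivity) (sub_nonneg.2 (Nat.floor_le hs₀)))]
  exact mul_le_of_le_one_right (by positivity) (by linarith [Nat.lt_floor_add_one s])

theorem exists_gridTaps_near (hb : InBox c r h) (N : ℕ) (hq : 0 < q) :
    ∃ j : Fin N → Fin (k + 1) → Fin (q + 1),
      ∀ (t : Fin N) i, |(h - gridTaps c r N q j) t i| ≤ 2 * r i / q := by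
  choose j hj using fun (t : Fin N) i => exists_abs_sub_grid_le (hb t i) hq
  refine ⟨j, fun t i => ?_⟩
  simpa only [Pi.sub_apply, gridTaps, t.2, dite_true] using hj t i

theorem noise_output_mem_le (hq : 0 < q)
    (hgh : ∀ (t : Fin (n + k)) i, |(h - g) t i| ≤ 2 * r i / q) {x : Fin n → ℝ}
    (hx : 4 * tapConst r * (x ⬝ᵥ x) ≤ (q : ℝ) ^ 2) {A : Set (Fin (n + k) → ℝ)}
    (hA : MeasurableSet A) {t : ℝ} (ht : 0 < t) :
    (noise (n + k)).real {z | output h x z ∈ A} ≤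
      t * (noise (n + k)).real {z | output g x z ∈ A} + 3 / t := by
  have : (0 : ℝ) < q := Nat.cast_pos.2 hq
  set a := channelMatrix n (h - g) *ᵥ x with ha
  have henergy : a ⬝ᵥ a ≤ 1 := by
    refine (channelMatrix_energy_le hgh x).trans ?_
    calc ((k : ℝ) + 1) * (∑ i, (2 * r i / q) ^ 2) * (x ⬝ᵥ x)
        = 4 * tapConst r * (x ⬝ᵥ x) / (q : ℝ) ^ 2 := by
          simp only [div_pow, mul_pow, ← Finset.sum_div, ← Finset.mul_sum, tapConst]
          ring
      _ ≤ 1 := (div_le_one (by positivity)).2 hx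
  have hshift : {z | output h x z ∈ A} = (a + ·) ⁻¹' {z | output g x z ∈ A} := by
    ext z
    simp only [Set.mem_preimage, Set.mem_ofPred_eq, output, ha, ← channelMatrix_sub,
      Matrix.sub_mulVec]
    rw [← add_assoc, add_sub_cancel]
  rw [hshift]
  refine (stdNormal_add_left_le a ?_ ht).trans (add_le_add le_rfl ?_)
  · exact measurable_output g |>.comp (measurable_const.prodMk measurable_id) hA
  · gcongr
    exact (Real.exp_le_exp.2 henergy).trans Real.exp_one_lt_three.le

theorem card_grid_mul_exp_lt_one {s k K : ℕ} {a : ℝ}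
    (hs : (s : ℝ) * (s + k) * (k + 1) < s ^ 3 * a) (ha : 0 < a) (hK : s ^ 3 ≤ K) :
    (Fintype.card (Fin (s + k) → Fin (k + 1) → Fin (s + 1)) : ℝ) * Real.exp (-(K * a)) < 1 := by
  have hK' : (s : ℝ) ^ 3 ≤ K := by exact_mod_cast hK
  have hcard : (Fintype.card (Fin (s + k) → Fin (k + 1) → Fin (s + 1)) : ℝ) ≤
      Real.exp ((s : ℝ) * (s + k) * (k + 1)) := by
    simp only [Fintype.card_fun, Fintype.card_fin]
    push_cast
    rw [← pow_mul]
    calc ((s : ℝ) + 1) ^ ((k + 1) * (s + k)) ≤ Real.exp s ^ ((k + 1) * (s + k)) := by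
          gcongr
          exact Real.add_one_le_exp _
      _ = _ := by
          rw [← Real.exp_nat_mul]
          push_cast
          ring_nf
  calc _ ≤ Real.exp ((s : ℝ) * (s + k) * (k + 1)) * Real.exp (-(K * a)) := by gcongr
    _ = Real.exp ((s : ℝ) * (s + k) * (k + 1) - K * a) := by rw [← Real.exp_add, sub_eq_add_neg]
    _ < 1 := Real.exp_lt_one_iff.2 (by nlinarith)

theorem eventually_mul_add_mul_lt_cube (k : ℕ) {a : ℝ} (ha : 0 < a) :
    ∀ᶠ s : ℕ in atTop, (s : ℝ) * (s + k) * (k + 1) < s ^ 3 * a := by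
  filter_upwards [(tendsto_natCast_atTop_atTop (R := ℝ)).eventually_gt_atTop
    ((k + 1) * (k + 1) / a), eventually_ge_atTop 1] with s hs hs₁
  have hs₁' : (1 : ℝ) ≤ s := Nat.one_le_cast.2 hs₁
  have hk : (0 : ℝ) ≤ k := Nat.cast_nonneg k
  rw [div_lt_iff₀ ha] at hs
  calc (s : ℝ) * (s + k) * (k + 1) ≤ s * (s * (k + 1)) * (k + 1) := by
        gcongr
        nlinarith
    _ = s ^ 2 * ((k + 1) * (k + 1)) := by ring
    _ < s ^ 2 * (s * a) := by gcongr
    _ = _ := by ring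

end Grid

/-! ### A family of codes that is good for every tap array -/

section Sections

variable {α β : Type*} [MeasurableSpace α] [MeasurableSpace β] {μ : Measure α} {ν : Measure β}
  [IsProbabilityMeasure ν] {s : Set (α × β)}

theorem measurable_measureReal_section (hs : MeasurableSet s) :
    Measurable fun x => ν.real (Prod.mk x ⁻¹' s) :=
  (measurable_measure_prodMk_left hs).ennreal_toReal

theorem integral_measureReal_section (hs : MeasurableSet s) :
    ∫ x, ν.real (Prod.mk x ⁻¹' s) ∂μ = (μ.prod ν).real s := by
  simp only [measureReal_def]
  rw [integral_toReal (measurable_measure_prodMk_left hs).aemeasurable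
    (ae_of_all _ fun _ => measure_lt_top _ _), Measure.prod_apply hs]

theorem integrable_measureReal_section [IsFiniteMeasure μ] (hs : MeasurableSet s) :
    Integrable (fun x => ν.real (Prod.mk x ⁻¹' s)) μ :=
  .of_bound (measurable_measureReal_section hs).aestronglyMeasurable 1 <| ae_of_all _ fun x => by
    rw [Real.norm_of_nonneg measureReal_nonneg]
    exact measureReal_le_one

end Sections

section Decoder

variable {k n M : ℕ} (c : Fin (k + 1) → ℝ) (S : Matrix (Fin n) (Fin n) ℝ) (ε η : ℝ)

theorem jtDecode_eq_some_iff {c : Fin (k + 1) → ℝ} {S : Matrix (Fin n) (Fin n) ℝ} {ε η : ℝ}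
    {X : Fin M → Fin n → ℝ} {y : Fin (n + k) → ℝ} {w : Fin M} :
    jtDecode c S ε η X y = some w ↔ JointlyTypical c S ε η (X w) y ∧
      ∀ i, i ≠ w → ¬ JointlyTypical c S ε η (X i) y := by
  refine ⟨fun h => ?_, fun h => jtDecode_eq_some h.1 h.2⟩
  rw [jtDecode] at h
  split_ifs at h with hex
  obtain rfl : hex.choose = w := Option.some.inj h
  exact ⟨hex.choose_spec.1, fun i hi hJ => hi (hex.choose_spec.2 i hJ)⟩

theorem measurableSet_jtDecode_eq_some (X : Fin M → Fin n → ℝ) (w : Fin M) :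
    MeasurableSet {y : Fin (n + k) → ℝ | jtDecode c S ε η X y = some w} := by
  have htypical (i : Fin M) :
      MeasurableSet {y : Fin (n + k) → ℝ | JointlyTypical c S ε η (X i) y} :=
    (measurable_const.prodMk measurable_id) (measurableSet_jointlyTypical c S ε η)
  simp only [jtDecode_eq_some_iff, Set.ofPred_and, Set.ofPred_forall]
  exact (htypical w).inter (.iInter fun i => .iInter fun _ => (htypical i).compl)

theorem measurable_getD_jtDecode (X : Fin M → Fin n → ℝ) (w : Fin M) :
    Measurable fun y : Fin (n + k) → ℝ => (jtDecode c S ε η X y).getD w := by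
  let _ : MeasurableSpace (Option (Fin M)) := ⊤
  refine (measurable_from_top (f := fun o : Option (Fin M) => o.getD w)).comp
    (measurable_to_countable' fun o => ?_)
  cases o with
  | some v => exact measurableSet_jtDecode_eq_some c S ε η X v
  | none =>
    have hnone : (jtDecode c S ε η X) ⁻¹' {none} =
        (⋃ v : Fin M, {y : Fin (n + k) → ℝ | jtDecode c S ε η X y = some v})ᶜ := by
      ext y
      simp [Option.eq_none_iff_forall_ne_some]
    rw [hnone]
    exact (MeasurableSet.iUnion (measurableSet_jtDecode_eq_some c S ε η X)).compl

theorem measurableSet_badEvent (h : Taps k) (w : Fin M) :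
    MeasurableSet (badEvent c S ε η h w) :=
  (measurable_const.prodMk measurable_id) (measurableSet_badEvent_uncurry c S ε η w)

end Decoder

section CodeFamily

variable {k n M : ℕ} {c r : Fin (k + 1) → ℝ} {S : Matrix (Fin n) (Fin n) ℝ} {ε η : ℝ} {h : Taps k}

/-- The probability of the bad event for the codebook `X` and the taps `h`, averaged over the
messages: the quantity that the selection of good codebooks makes small on the grid. -/
noncomputable def badProb (c : Fin (k + 1) → ℝ) (S : Matrix (Fin n) (Fin n) ℝ) (ε η : ℝ)
    (h : Taps k) (X : Fin M → Fin n → ℝ) : ℝ :=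
  (M : ℝ)⁻¹ * ∑ w : Fin M, (noise (n + k)).real (Prod.mk X ⁻¹' badEvent c S ε η h w)

theorem measurable_badProb : Measurable (badProb (M := M) c S ε η h) :=
  (Finset.measurable_sum _ fun w _ =>
    measurable_measureReal_section (measurableSet_badEvent c S ε η h w)).const_mul _

theorem badProb_mem_Icc (X : Fin M → Fin n → ℝ) : badProb c S ε η h X ∈ Set.Icc 0 1 :=
  ⟨mul_nonneg (by positivity) (Finset.sum_nonneg fun _ _ => measureReal_nonneg),
    inv_mul_sum_le_of_forall_le zero_le_one fun _ => measureReal_le_one⟩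

theorem sum_noise_badEvent (X : Fin M → Fin n → ℝ) :
    ∑ w, (noise (n + k)).real (Prod.mk X ⁻¹' badEvent c S ε η h w) =
      M * badProb c S ε η h X := by
  rcases Nat.eq_zero_or_pos M with rfl | hM
  · simp
  · rw [badProb, mul_inv_cancel_left₀ (Nat.cast_ne_zero.2 hM.ne')]

theorem integral_badProb_le {δ : ℝ} (hδ : 0 ≤ δ)
    (hbad : ∀ w : Fin M, ((Measure.pi fun _ : Fin M => codewordLaw S).prod (noise (n + k))).real
      (badEvent c S ε η h w) ≤ δ) :
    ∫ X, badProb c S ε η h X ∂(Measure.pi fun _ : Fin M => codewordLaw S) ≤ δ := by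
  have hmeas := measurableSet_badEvent c S ε η h (M := M)
  unfold badProb
  rw [integral_const_mul, integral_finsetSum _ fun w _ => integrable_measureReal_section (hmeas w)]
  refine inv_mul_sum_le_of_forall_le hδ fun w => ?_
  rw [integral_measureReal_section (hmeas w)]
  exact hbad w

theorem exists_codebooks (hr : ∀ i, 0 ≤ r i) {δ : ℝ} (hδ : 0 ≤ δ)
    (hbad : ∀ h, InBox c r h → ∀ w : Fin M,
      ((Measure.pi fun _ : Fin M => codewordLaw S).prod (noise (n + k))).real
        (badEvent c S ε η h w) ≤ δ) {N q : ℕ} {ι : Type*} [Fintype ι]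
    (hcard : Fintype.card (Fin N → Fin (k + 1) → Fin (q + 1)) *
      Real.exp (-(Fintype.card ι * (2 * δ ^ 2))) < 1) :
    ∃ X : ι → Fin M → Fin n → ℝ, ∀ j,
      ∑ κ, badProb c S ε η (gridTaps c r N q j) (X κ) ≤ 2 * δ * Fintype.card ι := by
  obtain ⟨X, hX⟩ := exists_forall_sum_lt
    (e := fun (j : Fin N → Fin (k + 1) → Fin (q + 1)) =>
      badProb (M := M) c S ε η (gridTaps c r N q j))
    (fun _ => measurable_badProb) (fun _ => badProb_mem_Icc)
    (fun j => integral_badProb_le hδ (hbad _ (inBox_gridTaps hr j))) hδ hcard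
  exact ⟨X, fun j => (hX j).le.trans_eq (by rw [two_mul])⟩

/-- The codeword `x`, replaced by `0` when its energy is not typical: this enforces the power
constraint, and costs nothing because an atypical energy is part of the bad event. -/
noncomputable def clip (S : Matrix (Fin n) (Fin n) ℝ) (ε : ℝ) (x : Fin n → ℝ) : Fin n → ℝ :=
  if x ⬝ᵥ x < S.trace + ε * n then x else 0

theorem clip_dotProduct_self_le (hS : S.PosSemidef) (hε : 0 ≤ ε) (x : Fin n → ℝ) :
    clip S ε x ⬝ᵥ clip S ε x ≤ S.trace + ε * n := by
  unfold clip
  split_ifs with hx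
  · exact hx.le
  · have := hS.trace_nonneg
    rw [zero_dotProduct]
    positivity

theorem jtDecode_output_clip {X : Fin M → Fin n → ℝ} {w : Fin M} {z : Fin (n + k) → ℝ}
    (hgood : (X, z) ∉ badEvent c S ε η h w) :
    jtDecode c S ε η X (output h (clip S ε (X w)) z) = some w := by
  have henergy : X w ⬝ᵥ X w < S.trace + ε * n := not_le.1 fun hle => hgood (.inl (.inr hle))
  rw [clip, if_pos henergy]
  exact jtDecode_eq_some_of_notMem_badEvent hgood

/-- The error probability of the code `C` for the message `w` when the taps are known to be `h`,
the noise being the only randomness. -/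
noncomputable def BlockCode.errorAt (C : BlockCode k n M) (h : Taps k) (w : Fin M) : ℝ :=
  (noise (n + k)).real {z | C.dec (output h (C.enc w) z) ≠ w}

/-- The deterministic code obtained from the codebook `X`: clipped codewords and the
joint-typicality decoder, which guesses message `0` instead of declaring a failure. -/
noncomputable def jtCode (hM : 0 < M) (c : Fin (k + 1) → ℝ) (S : Matrix (Fin n) (Fin n) ℝ)
    (ε η : ℝ) (X : Fin M → Fin n → ℝ) : BlockCode k n M where
  enc w := clip S ε (X w)
  dec y := (jtDecode c S ε η X y).getD ⟨0, hM⟩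
  measurable_dec := measurable_getD_jtDecode c S ε η X _

theorem jtCode_errorAt_le (hM : 0 < M) (hn : 0 < n) (hS : S.PosSemidef) (hε : 0 ≤ ε) {g : Taps k}
    (hgh : ∀ (t : Fin (n + k)) i, |(h - g) t i| ≤ 2 * r i / n)
    (hpow : 4 * tapConst r * (S.trace + ε * n) ≤ (n : ℝ) ^ 2) {t : ℝ} (ht : 0 < t)
    (X : Fin M → Fin n → ℝ) (w : Fin M) :
    (jtCode hM c S ε η X).errorAt h w ≤
      t * (noise (n + k)).real (Prod.mk X ⁻¹' badEvent c S ε η g w) + 3 / t := by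
  have hC := tapConst_nonneg r
  have hdec : MeasurableSet {y | (jtCode hM c S ε η X).dec y ≠ w} :=
    ((jtCode hM c S ε η X).measurable_dec (measurableSet_singleton w)).compl
  refine (noise_output_mem_le hn hgh ?_ hdec ht).trans ?_
  · exact (mul_le_mul_of_nonneg_left (clip_dotProduct_self_le hS hε _) (by positivity)).trans hpow
  · refine add_le_add (mul_le_mul_of_nonneg_left (measureReal_mono fun z hz => ?_) ht.le) le_rfl
    refine by_contra fun hgood : (X, z) ∉ badEvent c S ε η g w => hz ?_
    simp only [jtCode, jtDecode_output_clip hgood, Option.getD_some]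

theorem sum_jtCode_errorAt_le (hM : 0 < M) (hn : 0 < n) (hS : S.PosSemidef) (hε : 0 ≤ ε)
    {g : Taps k} (hgh : ∀ (t : Fin (n + k)) i, |(h - g) t i| ≤ 2 * r i / n)
    (hpow : 4 * tapConst r * (S.trace + ε * n) ≤ (n : ℝ) ^ 2) {t : ℝ} (ht : 0 < t)
    {ι : Type*} [Fintype ι] (X : ι → Fin M → Fin n → ℝ) :
    ∑ κ, ∑ w, (jtCode hM c S ε η (X κ)).errorAt h w ≤
      t * M * ∑ κ, badProb c S ε η g (X κ) + Fintype.card ι * M * (3 / t) := by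
  refine (Finset.sum_le_sum fun κ _ => Finset.sum_le_sum fun w _ =>
    jtCode_errorAt_le hM hn hS hε hgh hpow ht (X κ) w).trans_eq ?_
  simp only [Finset.sum_add_distrib, ← Finset.mul_sum, sum_noise_badEvent, Finset.sum_const,
    Finset.card_univ, Fintype.card_fin, nsmul_eq_mul]
  ring

theorem power_pos {P : ℝ} {S : ∀ n : ℕ, Matrix (Fin n) (Fin n) ℝ} (hS : ∀ n, (S n).PosDef)
    (htr : ∀ n, (S n).trace ≤ n * P) : 0 < P := by
  simpa using (hS 1).trace_pos.trans_le (htr 1)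

theorem exists_code_family (hr : ∀ i, 0 ≤ r i) {P : ℝ}
    {S : ∀ n : ℕ, Matrix (Fin n) (Fin n) ℝ} (hS : ∀ n, (S n).PosDef)
    (htr : ∀ n, (S n).trace ≤ n * P)
    (hmax : Tendsto (fun n : ℕ => 1 / (n : ℝ) * lamMax (S n)) atTop (𝓝 0))
    (hphi : ∀ n, phi1 c r (S n) < 1) {R : ℝ} (hR : (R : EReal) < lowerBound c r S)
    {θ τ : ℝ} (hθ : 0 < θ) (hτ : 0 < τ) :
    ∀ᶠ s : ℕ in atTop, ∀ V ≤ numMessages s R, 0 < V → ∀ L, s ^ 3 ≤ 2 ^ L →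
      ∃ C : (Fin L → Bool) → BlockCode k s V,
        (∀ κ v, (C κ).enc v ⬝ᵥ (C κ).enc v ≤ s * (P + θ)) ∧
        ∀ h, InBox c r h → ∑ κ, ∑ v, (C κ).errorAt h v ≤ τ * (2 ^ L * V) := by
  obtain ⟨ε, hε, hεθ, η, -, hb⟩ := exists_uniform_badEvent_le hr hS htr hmax hphi hR hθ
  have hδ : 0 < τ ^ 2 / 24 := by positivity
  filter_upwards [hb (τ ^ 2 / 24) hδ, eventually_gt_atTop 0,
    eventually_mul_add_mul_lt_cube k (show 0 < 2 * (τ ^ 2 / 24) ^ 2 by positivity),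
    (tendsto_natCast_atTop_atTop (R := ℝ)).eventually_ge_atTop (4 * tapConst r * (P + θ))]
    with s hbad hs hcub hlarge V hVR hV L hL
  have hC := tapConst_nonneg r
  have hgrid := card_grid_mul_exp_lt_one hcub (by positivity) hL
  have henergy : (S s).trace + ε * s ≤ s * (P + θ) := by
    linarith [htr s, mul_le_mul_of_nonneg_right hεθ (Nat.cast_nonneg (α := ℝ) s)]
  have hpow : 4 * tapConst r * ((S s).trace + ε * s) ≤ (s : ℝ) ^ 2 := calc
    _ ≤ 4 * tapConst r * (s * (P + θ)) := by gcongr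
    _ = s * (4 * tapConst r * (P + θ)) := by ring
    _ ≤ (s : ℝ) ^ 2 := by
      rw [sq]
      gcongr
  obtain ⟨X, hX⟩ := exists_codebooks (N := s + k) (q := s) (ι := Fin L → Bool) hr hδ.le
    (hbad V hVR) (by simpa using hgrid)
  refine ⟨fun κ => jtCode hV c (S s) ε (η s) (X κ),
    fun κ v => (clip_dotProduct_self_le (hS s).posSemidef hε.le _).trans henergy, fun h hbox => ?_⟩
  obtain ⟨j, hj⟩ := exists_gridTaps_near hbox (s + k) hs
  have hcardL : (Fintype.card (Fin L → Bool) : ℝ) = 2 ^ L := by simp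
  rw [hcardL] at hX
  calc ∑ κ, ∑ v, (jtCode hV c (S s) ε (η s) (X κ)).errorAt h v
      ≤ 6 / τ * V * ∑ κ, badProb c (S s) ε (η s) (gridTaps c r (s + k) s j) (X κ) +
          2 ^ L * V * (3 / (6 / τ)) := by
        rw [← hcardL]
        exact sum_jtCode_errorAt_le hV hs (hS s).posSemidef hε.le hj hpow (by positivity) X
    _ ≤ 6 / τ * V * (2 * (τ ^ 2 / 24) * 2 ^ L) + 2 ^ L * V * (3 / (6 / τ)) := by
        gcongr
        exact hX j
    _ = τ * (2 ^ L * V) := by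
        field_simp
        ring

end CodeFamily

/-! ### Signalling the code in use through a prefix -/

section Concatenation

variable {k l s : ℕ}

theorem measurePreserving_noise_comp {m n : ℕ} {f : Fin m → Fin n} (hf : Function.Injective f) :
    MeasurePreserving (fun z : Fin n → ℝ => z ∘ f) (noise n) (noise m) := by
  set A : Matrix (Fin m) (Fin n) ℝ := (1 : Matrix (Fin n) (Fin n) ℝ).submatrix f id with hA
  have hmulVec (z : Fin n → ℝ) : A *ᵥ z = z ∘ f := by
    ext i
    simp [hA, Matrix.mulVec, dotProduct, Matrix.one_apply]
  have hmul : A * Aᵀ = 1 := by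
    ext i j
    simp [hA, Matrix.mul_apply, Matrix.one_apply, hf.eq_iff, eq_comm]
  simpa only [hmulVec, hmul, ← noise_eq_codewordLaw_one] using measurePreserving_mulVec_noise A

/-- The embedding of the output slots of a block of length `s` as the last slots of a block of
length `l + s`. -/
def suffixIndex (l : ℕ) (j : Fin (s + k)) : Fin (l + s + k) := ⟨l + j, by omega⟩

theorem suffixIndex_injective (l : ℕ) :
    Function.Injective (suffixIndex l : Fin (s + k) → Fin (l + s + k)) := fun i j hij => by
  simpa [suffixIndex, Fin.ext_iff] using hij

theorem tapInput_append (p : Fin l → ℝ) (x : Fin s → ℝ) (t i : ℕ) :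
    tapInput (Fin.append p x) t i =
      tapInput p t i + ∑ j : Fin s, if t = i + (l + j) then x j else 0 := by
  simp [tapInput, Fin.sum_univ_add]

theorem tapInput_eq_zero {x : Fin s → ℝ} {t i : ℕ} (h : ∀ j : Fin s, t = i + j → x j = 0) :
    tapInput x t i = 0 :=
  Finset.sum_eq_zero fun j _ => ite_eq_right_iff.2 (h j)

theorem tapInput_add (x : Fin s → ℝ) (i : ℕ) (j : Fin s) : tapInput x (i + j) i = x j := by
  simp [tapInput, Fin.val_inj]

theorem tapInput_append_of_lt (p : Fin l → ℝ) (x : Fin s → ℝ) {t : ℕ} (ht : t < l) (i : ℕ) :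
    tapInput (Fin.append p x) t i = tapInput p t i := by
  rw [tapInput_append, Finset.sum_eq_zero fun j _ => if_neg (by omega), add_zero]

theorem tapInput_append_add {p : Fin l → ℝ} (hp : ∀ j : Fin l, l ≤ j + k → p j = 0)
    (x : Fin s → ℝ) (t : ℕ) (i : Fin (k + 1)) :
    tapInput (Fin.append p x) (l + t) i = tapInput x t i := by
  rw [tapInput_append, tapInput_eq_zero fun j hj => hp j (by omega), zero_add, tapInput]
  refine Finset.sum_congr rfl fun j _ => ?_
  simp only [show l + t = i + (l + j) ↔ t = i + j by omega]

theorem output_append_suffix (h : Taps k) {p : Fin l → ℝ}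
    (hp : ∀ j : Fin l, l ≤ j + k → p j = 0) (x : Fin s → ℝ) (z : Fin (l + s + k) → ℝ) :
    output h (Fin.append p x) z ∘ suffixIndex l =
      output (fun t => h (l + t)) x (z ∘ suffixIndex l) := by
  ext j
  simp only [output, Function.comp_apply, Pi.add_apply, channelMatrix_mulVec, suffixIndex,
    tapInput_append_add hp]

theorem append_dotProduct_self (p : Fin l → ℝ) (x : Fin s → ℝ) :
    Fin.append p x ⬝ᵥ Fin.append p x = p ⬝ᵥ p + x ⬝ᵥ x := by
  simp [dotProduct, Fin.sum_univ_add]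

end Concatenation

section BitPrefix

variable {k l s L : ℕ} {A : ℝ}

/-- The slot of the pulse that carries the bit `i`: pulses are `k + 1` slots apart, so that their
echoes do not overlap. -/
def pulseSlot (hl : (k + 1) * L ≤ l) (i : Fin L) : Fin l :=
  ⟨(k + 1) * i, (Nat.mul_lt_mul_of_pos_left i.2 k.succ_pos).trans_le hl⟩

theorem pulseSlot_injective (hl : (k + 1) * L ≤ l) : Function.Injective (pulseSlot hl) :=
  fun _ _ hij => Fin.ext (Nat.eq_of_mul_eq_mul_left k.succ_pos (congrArg Fin.val hij))

theorem pulseSlot_add_lt (hl : (k + 1) * L ≤ l) (i : Fin L) : (pulseSlot hl i : ℕ) + k < l := by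
  have hi : (k + 1) * (i + 1) ≤ (k + 1) * L := Nat.mul_le_mul_left _ i.2
  rw [mul_add] at hi
  simp only [pulseSlot]
  omega

/-- Antipodal signalling of the bits `b` with amplitude `A`. -/
noncomputable def bitPrefix (hl : (k + 1) * L ≤ l) (A : ℝ) (b : Fin L → Bool) : Fin l → ℝ :=
  Function.extend (pulseSlot hl) (fun i => if b i then A else -A) 0

variable (hl : (k + 1) * L ≤ l)

theorem bitPrefix_pulseSlot (A : ℝ) (b : Fin L → Bool) (i : Fin L) :
    bitPrefix hl A b (pulseSlot hl i) = if b i then A else -A :=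
  (pulseSlot_injective hl).extend_apply _ _ _

theorem bitPrefix_eq_zero (A : ℝ) (b : Fin L → Bool) {j : Fin l}
    (hj : j ∉ Set.range (pulseSlot hl)) : bitPrefix hl A b j = 0 :=
  Function.extend_apply' _ _ _ hj

theorem bitPrefix_eq_zero_of_le_add (A : ℝ) (b : Fin L → Bool) (j : Fin l) (hj : l ≤ j + k) :
    bitPrefix hl A b j = 0 :=
  bitPrefix_eq_zero hl A b fun ⟨i, hi⟩ => by
    have := pulseSlot_add_lt hl i
    rw [hi] at this
    omega

theorem bitPrefix_dotProduct_self (A : ℝ) (b : Fin L → Bool) :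
    bitPrefix hl A b ⬝ᵥ bitPrefix hl A b = L * A ^ 2 := by
  have hpulse (i : Fin L) :
      A ^ 2 = bitPrefix hl A b (pulseSlot hl i) * bitPrefix hl A b (pulseSlot hl i) := by
    rw [bitPrefix_pulseSlot]
    split_ifs <;> ring
  rw [dotProduct, ← Fintype.sum_of_injective _ (pulseSlot_injective hl) (fun _ => A ^ 2) _
    (fun j hj => by rw [bitPrefix_eq_zero hl A b hj, zero_mul]) hpulse]
  simp

theorem tapInput_bitPrefix (A : ℝ) (b : Fin L → Bool) (i : Fin L) (a q : Fin (k + 1)) :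
    tapInput (bitPrefix hl A b) (a + pulseSlot hl i) q =
      if q = a then (if b i then A else -A) else 0 := by
  split_ifs with hq hbi
  · rw [hq, tapInput_add, bitPrefix_pulseSlot, if_pos hbi]
  · rw [hq, tapInput_add, bitPrefix_pulseSlot, if_neg ‹_›]
  · refine tapInput_eq_zero fun j hj => bitPrefix_eq_zero hl A b ?_
    rintro ⟨i', rfl⟩
    have hmod := congrArg (· % (k + 1)) hj
    simp only [pulseSlot, Nat.add_mul_mod_self_left, Nat.mod_eq_of_lt a.2,
      Nat.mod_eq_of_lt q.2] at hmod
    exact hq (Fin.ext hmod.symm)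

/-- The slot in which the tap `a` acts on the pulse that carries the bit `i`. -/
def bitSlot (s : ℕ) (a : Fin (k + 1)) (i : Fin L) : Fin (l + s + k) :=
  ⟨a + pulseSlot hl i, by have := pulseSlot_add_lt hl i; omega⟩

theorem output_bitSlot (a : Fin (k + 1)) (h : Taps k) (A : ℝ) (b : Fin L → Bool) (x : Fin s → ℝ)
    (z : Fin (l + s + k) → ℝ) (i : Fin L) :
    output h (Fin.append (bitPrefix hl A b) x) z (bitSlot hl s a i) =
      h (bitSlot hl s a i) a * (if b i then A else -A) + z (bitSlot hl s a i) := by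
  have hlt : (a : ℕ) + pulseSlot hl i < l := by have := pulseSlot_add_lt hl i; omega
  simp only [output, Pi.add_apply, channelMatrix_mulVec, bitSlot, tapInput_append_of_lt _ _ hlt,
    tapInput_bitPrefix, mul_ite, mul_zero, Finset.sum_ite_eq', Finset.mem_univ, if_true]

/-- Detection of the bits of the prefix by the sign of the output, relative to that of the centre
`c a`. -/
noncomputable def bitDecode (s : ℕ) (c : Fin (k + 1) → ℝ) (a : Fin (k + 1))
    (y : Fin (l + s + k) → ℝ) (i : Fin L) : Bool :=
  decide (0 < c a * y (bitSlot hl s a i))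

theorem measurable_bitDecode (s : ℕ) (c : Fin (k + 1) → ℝ) (a : Fin (k + 1)) :
    Measurable (bitDecode hl s c a) :=
  measurable_pi_iff.2 fun i => measurable_to_bool <| by
    have hpos : MeasurableSet {y : Fin (l + s + k) → ℝ | 0 < c a * y (bitSlot hl s a i)} :=
      measurableSet_lt measurable_const ((measurable_pi_apply _).const_mul _)
    convert hpos using 1
    ext y
    simp [bitDecode]

theorem mul_add_pos_of_abs_lt {A c u ρ ζ : ℝ} (hA : 0 < A) (hu : |u - c| ≤ ρ)
    (hζ : |ζ| < A * (|c| - ρ)) : 0 < c * (u * A + ζ) := by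
  have hρ : 0 ≤ ρ := (abs_nonneg _).trans hu
  have hc : 0 < |c| := by
    have := pos_of_mul_pos_right ((abs_nonneg ζ).trans_lt hζ) hA.le
    linarith
  have htap : |c * (u - c)| ≤ |c| * ρ := by
    rw [abs_mul]
    gcongr
  have hnoise : |c * ζ| < |c| * (A * (|c| - ρ)) := by
    rw [abs_mul]
    gcongr
  have hsq : c * c = |c| * |c| := (abs_mul_abs_self c).symm
  nlinarith [(abs_le.1 htap).1, (abs_lt.1 hnoise).1]

theorem bitDecode_output {c r : Fin (k + 1) → ℝ} {a : Fin (k + 1)} {h : Taps k}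
    (hb : InBox c r h) (hA : 0 < A) (b : Fin L → Bool) (x : Fin s → ℝ)
    {z : Fin (l + s + k) → ℝ} (hz : ∀ i : Fin L, |z (bitSlot hl s a i)| < A * (|c a| - r a)) :
    bitDecode hl s c a (output h (Fin.append (bitPrefix hl A b) x) z) = b := by
  ext i
  have htap := hb.abs_sub_le (bitSlot hl s a i) a
  rw [bitDecode, output_bitSlot]
  cases hbi : b i with
  | true => simpa using mul_add_pos_of_abs_lt hA htap (hz i)
  | false =>
    have := mul_add_pos_of_abs_lt hA htap ((abs_neg _).trans_lt (hz i))
    simp only [Bool.false_eq_true, if_false, decide_eq_false_iff_not, not_lt]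
    linarith

theorem noise_coordinate_le {n : ℕ} (i : Fin n) {t : ℝ} (ht : 0 < t) :
    (noise n).real {z | t ≤ |z i|} ≤ 1 / t ^ 2 := by
  simpa using noise_le_abs_dotProduct (Pi.single i (1 : ℝ)) ht

end BitPrefix

section PrefixedCode

variable {k n l s L M V : ℕ} {c r : Fin (k + 1) → ℝ} {A : ℝ} {a : Fin (k + 1)}

theorem BlockCode.measurable_dec_output (C : BlockCode k n M) (h : Taps k) (x : Fin n → ℝ) :
    Measurable fun z => C.dec (output h x z) :=
  C.measurable_dec.comp ((measurable_output h).comp (measurable_const.prodMk measurable_id))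

theorem BlockCode.errorProb_le (C : BlockCode k n M) {b : ℝ}
    (hb : ∀ h, InBox c r h → (M : ℝ)⁻¹ * ∑ w, C.errorAt h w ≤ b) {ν : Measure (Taps k)}
    (hν : IsTapLaw c r ν) : C.errorProb ν ≤ b := by
  have := hν.prob
  have hmeas (w : Fin M) : MeasurableSet {p : Taps k × (Fin (n + k) → ℝ) |
      C.dec (output p.1 (C.enc w) p.2) ≠ w} :=
    ((C.measurable_dec.comp (measurable_output_comp measurable_fst measurable_const
      measurable_snd)) (measurableSet_singleton w)).compl
  have hint (w : Fin M) : Integrable (fun h => C.errorAt h w) ν :=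
    integrable_measureReal_section (hmeas w)
  calc C.errorProb ν = ∫ h, (M : ℝ)⁻¹ * ∑ w, C.errorAt h w ∂ν := by
        rw [integral_const_mul, integral_finsetSum _ fun w _ => hint w]
        simp only [BlockCode.errorProb, ← integral_measureReal_section (hmeas _)]
        rfl
    _ ≤ ∫ _, b ∂ν := integral_mono_ae ((integrable_finsetSum _ fun w _ => hint w).const_mul _)
        (integrable_const b) (hν.ae_inBox.mono hb)
    _ = b := by simp

/-- The code that announces in a prefix which member of the family `C` is in use. Messages are
identified by `e` with pairs of a member of the family and a message of that member; `F` undoes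
this identification. -/
noncomputable def prefixedCode (hl : (k + 1) * L ≤ l) (A : ℝ) (c : Fin (k + 1) → ℝ)
    (a : Fin (k + 1)) (C : (Fin L → Bool) → BlockCode k s V) (e : Fin M → (Fin L → Bool) × Fin V)
    (F : (Fin L → Bool) × Fin V → Fin M) : BlockCode k (l + s) M where
  enc w := Fin.append (bitPrefix hl A (e w).1) ((C (e w).1).enc (e w).2)
  dec y := F (bitDecode hl s c a y, (C (bitDecode hl s c a y)).dec (y ∘ suffixIndex l))
  measurable_dec := by
    have hmember : Measurable fun p : (Fin L → Bool) × (Fin (s + k) → ℝ) =>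
        F (p.1, (C p.1).dec p.2) := measurable_from_prod_countable_right fun κ =>
      (measurable_of_finite fun v => F (κ, v)).comp (C κ).measurable_dec
    exact hmember.comp ((measurable_bitDecode hl s c a).prodMk
      (measurePreserving_noise_comp (suffixIndex_injective l)).measurable)

variable {hl : (k + 1) * L ≤ l} {C : (Fin L → Bool) → BlockCode k s V}
  {e : Fin M → (Fin L → Bool) × Fin V} {F : (Fin L → Bool) × Fin V → Fin M}

theorem prefixedCode_dec_output (hF : Function.LeftInverse F e) {h : Taps k} (hb : InBox c r h)
    (hA : 0 < A) {w : Fin M} {z : Fin (l + s + k) → ℝ}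
    (hz : ∀ i : Fin L, |z (bitSlot hl s a i)| < A * (|c a| - r a))
    (hdec : (C (e w).1).dec (output (fun t => h (l + t)) ((C (e w).1).enc (e w).2)
      (z ∘ suffixIndex l)) = (e w).2) :
    (prefixedCode hl A c a C e F).dec
      (output h ((prefixedCode hl A c a C e F).enc w) z) = w := by
  simp only [prefixedCode, bitDecode_output hl hb hA _ _ hz,
    output_append_suffix h (bitPrefix_eq_zero_of_le_add hl A _), hdec]
  exact hF w

theorem prefixedCode_errorAt_le (hF : Function.LeftInverse F e) (ha : r a < |c a|) {h : Taps k}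
    (hb : InBox c r h) (hA : 0 < A) (w : Fin M) :
    (prefixedCode hl A c a C e F).errorAt h w ≤ L * (1 / (A * (|c a| - r a)) ^ 2) +
      (C (e w).1).errorAt (fun t => h (l + t)) (e w).2 := by
  have hpos : 0 < A * (|c a| - r a) := mul_pos hA (sub_pos.2 ha)
  set atypical : Fin L → Set (Fin (l + s + k) → ℝ) :=
    fun i => {z | A * (|c a| - r a) ≤ |z (bitSlot hl s a i)|}
  set fails : Set (Fin (s + k) → ℝ) := {z | (C (e w).1).dec
    (output (fun t => h (l + t)) ((C (e w).1).enc (e w).2) z) ≠ (e w).2}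
  have hfails : MeasurableSet fails :=
    ((C (e w).1).measurable_dec_output _ _ (measurableSet_singleton _)).compl
  have hsub : {z | (prefixedCode hl A c a C e F).dec
      (output h ((prefixedCode hl A c a C e F).enc w) z) ≠ w} ⊆
        (⋃ i, atypical i) ∪ (fun z => z ∘ suffixIndex l) ⁻¹' fails := fun z hz => by
    by_contra hgood
    simp only [atypical, fails, Set.mem_union, Set.mem_iUnion, Set.mem_ofPred_eq,
      Set.mem_preimage, not_or, not_exists, not_le, not_not] at hgood
    exact hz (prefixedCode_dec_output hF hb hA hgood.1 hgood.2)
  refine (measureReal_mono hsub).trans ((measureReal_union_le _ _).trans (add_le_add ?_ ?_))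
  · calc _ ≤ ∑ i, (noise (l + s + k)).real (atypical i) := measureReal_iUnion_fintype_le _
      _ ≤ ∑ _i : Fin L, 1 / (A * (|c a| - r a)) ^ 2 :=
          Finset.sum_le_sum fun i _ => noise_coordinate_le _ hpos
      _ = _ := by simp
  · exact (measureReal_preimage_of_measurePreserving
      (measurePreserving_noise_comp (suffixIndex_injective l)) hfails).le

theorem exists_prefixedCode (ha : r a < |c a|) (hM : 0 < M) (hl : (k + 1) * L ≤ l)
    (hMV : M ≤ 2 ^ L * V) (hA : 0 < A) {E B : ℝ} {C : (Fin L → Bool) → BlockCode k s V}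
    (hE : ∀ κ v, (C κ).enc v ⬝ᵥ (C κ).enc v ≤ E)
    (hB : ∀ h, InBox c r h → ∑ κ, ∑ v, (C κ).errorAt h v ≤ B) :
    ∃ D : BlockCode k (l + s) M, (∀ w, D.enc w ⬝ᵥ D.enc w ≤ L * A ^ 2 + E) ∧
      ∀ ν, IsTapLaw c r ν →
        D.errorProb ν ≤ L * (1 / (A * (|c a| - r a)) ^ 2) + (M : ℝ)⁻¹ * B := by
  have : Nonempty (Fin M) := ⟨⟨0, hM⟩⟩
  obtain ⟨e⟩ : Nonempty (Fin M ↪ (Fin L → Bool) × Fin V) :=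
    Function.Embedding.nonempty_of_card_le (by simpa using hMV)
  refine ⟨prefixedCode hl A c a C e (Function.invFun e), fun w => ?_, fun ν hν =>
    BlockCode.errorProb_le _ (fun h hb => ?_) hν⟩
  · simp only [prefixedCode, append_dotProduct_self, bitPrefix_dotProduct_self]
    exact add_le_add le_rfl (hE _ _)
  set δ := 1 / (A * (|c a| - r a)) ^ 2
  set G : (Fin L → Bool) × Fin V → ℝ := fun q => (C q.1).errorAt (fun t => h (l + t)) q.2
  have hG : ∑ w, G (e w) ≤ B := calc
    ∑ w, G (e w) = ∑ q ∈ Finset.univ.map e, G q := (Finset.sum_map _ _ _).symm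
    _ ≤ ∑ q, G q := Finset.sum_le_sum_of_subset_of_nonneg (Finset.subset_univ _)
        fun _ _ _ => measureReal_nonneg
    _ = ∑ κ, ∑ v, G (κ, v) := Fintype.sum_prod_type _
    _ ≤ B := hB _ fun t => hb (l + t)
  calc _ ≤ (M : ℝ)⁻¹ * ∑ w, (L * δ + G (e w)) := by
        gcongr with w
        exact prefixedCode_errorAt_le (Function.leftInverse_invFun e.injective) ha hb hA w
    _ = L * δ + (M : ℝ)⁻¹ * ∑ w, G (e w) := by
        rw [Finset.sum_add_distrib, Finset.sum_const, Finset.card_fin, nsmul_eq_mul]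
        field_simp
    _ ≤ _ := by gcongr

end PrefixedCode

/-! ### Achievability of rates below the lower bound -/

section SignallingTap

variable {k : ℕ} {c r : Fin (k + 1) → ℝ}

theorem boundTerm_nonpos_of_forall_abs_le (hcr : ∀ i, |c i| ≤ r i) {n : ℕ} (hn : 0 < n)
    {S : Matrix (Fin n) (Fin n) ℝ} (hS : S.PosDef) (hphi : phi1 c r S < 1) :
    boundTerm c r S ≤ 0 := by
  -- The zero channel is admissible, and its output determinant is `1`.
  have hbox : InBox c r (0 : Taps k) := fun t i => by
    obtain ⟨hlo, hhi⟩ := abs_le.1 (hcr i)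
    exact ⟨sub_nonpos.2 hhi, neg_le_iff_add_nonneg.1 (by linarith)⟩
  have hzero : channelMatrix n (0 : Taps k) = 0 := by
    ext t j
    simp [channelMatrix]
  have hdet := phi1_pow_mul_det_le hbox hS hphi
  rw [hzero, Matrix.zero_mul, Matrix.zero_mul, add_zero, Matrix.det_one] at hdet
  have hlogdet := Real.log_nonpos (mul_nonneg (pow_nonneg (sub_nonneg.2 hphi.le) n)
    (det_one_add_centre_pos c hS.posSemidef).le) hdet
  have hsnr : 0 ≤ tapConst r * (S.trace / ((n : ℝ) + k + n)) :=
    mul_nonneg (tapConst_nonneg r) (div_nonneg hS.posSemidef.trace_nonneg (by positivity))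
  have hlog : 0 ≤ n * Real.log (1 + tapConst r * (S.trace / ((n : ℝ) + k + n))) :=
    mul_nonneg n.cast_nonneg (Real.log_nonneg (le_add_of_nonneg_right hsnr))
  have hbound := boundTerm_add_log_le_half_log_det hn hbox.radius_nonneg hS hphi
  have hlog2 : 0 < n * Real.log 2 := mul_pos (Nat.cast_pos.2 hn) (Real.log_pos one_lt_two)
  exact nonpos_of_mul_nonpos_right (by linarith) hlog2

theorem exists_radius_lt_centre {S : ∀ n : ℕ, Matrix (Fin n) (Fin n) ℝ} (hS : ∀ n, (S n).PosDef)
    (hphi : ∀ n, phi1 c r (S n) < 1) (hpos : ((0 : ℝ) : EReal) < lowerBound c r S) :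
    ∃ a, r a < |c a| := by
  by_contra! hcr
  obtain ⟨n, hlt, hn⟩ := ((eventually_lt_of_lt_liminf hpos).and (eventually_gt_atTop 0)).exists
  exact (EReal.coe_lt_coe_iff.1 hlt).not_ge
    (boundTerm_nonpos_of_forall_abs_le hcr hn (hS n) (hphi n))

end SignallingTap

section BlockLengths

theorem numMessages_pos (n : ℕ) (R : ℝ) : 0 < numMessages n R :=
  Nat.ceil_pos.2 (by positivity)

theorem two_pow_le_numMessages {n L : ℕ} {R : ℝ} (hL : (L : ℝ) ≤ n * R) :
    2 ^ L ≤ numMessages n R := by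
  have hle : (2 : ℝ) ^ L ≤ 2 ^ ((n : ℝ) * R) := by
    rw [← Real.rpow_natCast]
    exact Real.rpow_le_rpow_of_exponent_le one_le_two hL
  exact_mod_cast hle.trans (Nat.le_ceil _)

theorem eventually_numMessages_le_floor {ρ R R' : ℝ} (hR' : 0 ≤ R') (hR : R < ρ * R') :
    ∀ᶠ n : ℕ in atTop, numMessages n R ≤ numMessages ⌊ρ * n⌋₊ R' := by
  filter_upwards [tendsto_natCast_atTop_atTop.eventually_ge_atTop (R' / (ρ * R' - R))] with n hn
  refine Nat.ceil_le_ceil (Real.rpow_le_rpow_of_exponent_le one_le_two ?_)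
  rw [div_le_iff₀ (sub_pos.2 hR)] at hn
  calc (n : ℝ) * R ≤ (ρ * n - 1) * R' := by linarith
    _ ≤ ⌊ρ * n⌋₊ * R' := by
      gcongr
      exact (Nat.sub_one_lt_floor _).le

theorem cube_le_two_pow {n L : ℕ} (hn : 0 < n) (hL : 5 * Real.log n ≤ L) : n ^ 3 ≤ 2 ^ L := by
  have : (0 : ℝ) < n := Nat.cast_pos.2 hn
  have := Real.log_natCast_nonneg n
  have := Real.log_two_gt_d9
  have hle : (n : ℝ) ^ 3 ≤ 2 ^ L := by
    rw [← Real.log_le_log_iff (by positivity) (by positivity), Real.log_pow, Real.log_pow]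
    push_cast
    nlinarith
  exact_mod_cast hle

theorem eventually_mul_log_sq_le (q : ℝ) : ∀ᶠ n : ℕ in atTop, q * Real.log n ^ 2 ≤ n := by
  have hlittle := ((Real.isLittleO_pow_log_id_atTop (n := 2)).comp_tendsto
    (tendsto_natCast_atTop_atTop (R := ℝ))).const_mul_left q
  filter_upwards [hlittle.def one_pos] with n hn
  simpa using (le_abs_self _).trans hn

theorem eventually_exists_bitLength {p q : ℝ} (hp : 0 ≤ p) (hq : 0 ≤ q) :
    ∀ᶠ n : ℕ in atTop, ∃ L : ℕ, 0 < L ∧ n ^ 3 ≤ 2 ^ L ∧ p * L ≤ n ∧ q * (L : ℝ) ^ 2 ≤ n := by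
  filter_upwards [eventually_gt_atTop 0, eventually_mul_log_sq_le ((p + q) * 36),
    (Real.tendsto_log_atTop.comp tendsto_natCast_atTop_atTop).eventually_ge_atTop 1]
    with n hn hpq hlog
  simp only [Function.comp_apply] at hlog
  set L := ⌈5 * Real.log n⌉₊
  have hL : (L : ℝ) ≤ 6 * Real.log n := by
    linarith [Nat.ceil_lt_add_one (show 0 ≤ 5 * Real.log n by linarith)]
  have hLsq : (L : ℝ) ≤ (L : ℝ) ^ 2 := by exact_mod_cast Nat.le_self_pow two_ne_zero L
  have hbound : p * (L : ℝ) ^ 2 + q * (L : ℝ) ^ 2 ≤ n := calc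
    p * (L : ℝ) ^ 2 + q * (L : ℝ) ^ 2 = (p + q) * (L : ℝ) ^ 2 := (add_mul _ _ _).symm
    _ ≤ (p + q) * (6 * Real.log n) ^ 2 := by gcongr
    _ = (p + q) * 36 * Real.log n ^ 2 := by ring
    _ ≤ n := hpq
  refine ⟨L, Nat.ceil_pos.2 (by linarith), cube_le_two_pow hn (Nat.le_ceil _), ?_, ?_⟩
  · exact (mul_le_mul_of_nonneg_left hLsq hp).trans
      ((le_add_of_nonneg_right (by positivity)).trans hbound)
  · exact (le_add_of_nonneg_left (by positivity)).trans hbound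

theorem exists_mul_mem_Icc {K M : ℕ} (hK : 2 ≤ K) (hKM : K ≤ M) :
    ∃ V, 0 < V ∧ V ≤ M ∧ K * V ∈ Set.Icc M (2 * M) := by
  refine ⟨M / K + 1, Nat.succ_pos _, ?_, (Nat.lt_mul_div_succ M (by omega)).le, ?_⟩
  · have := Nat.div_le_div_left (a := M) hK two_pos
    omega
  · have := Nat.mul_div_le M K
    rw [mul_add]
    omega

end BlockLengths

section Coding

variable {k n M : ℕ} {c r : Fin (k + 1) → ℝ} {P R : ℝ}

theorem BlockCode.powerConstraint_of_forall (C : BlockCode k n M) (hP : 0 ≤ P)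
    (h : ∀ w, C.enc w ⬝ᵥ C.enc w ≤ n * P) : C.PowerConstraint P :=
  inv_mul_sum_le_of_forall_le (by positivity) fun w =>
    (Finset.sum_congr rfl fun _ _ => sq _).trans_le (h w)

theorem exists_code_of_family {a : Fin (k + 1)} (ha : r a < |c a|) {γ : ℝ} (hγ : 0 < γ)
    (hP : 0 < P) {s L : ℕ} (hL : 0 < L) (hs : (s : ℝ) ≤ (1 - γ) * n)
    (hLn : ((k : ℝ) + 1) * L ≤ γ * n) (hLM : 2 ^ L ≤ M) {τ : ℝ} (hτ : 0 ≤ τ)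
    (hfam : ∀ V ≤ M, 0 < V → ∃ C : (Fin L → Bool) → BlockCode k s V,
      (∀ κ v, (C κ).enc v ⬝ᵥ (C κ).enc v ≤ s * (P + γ * P / 2)) ∧
      ∀ h, InBox c r h → ∑ κ, ∑ v, (C κ).errorAt h v ≤ τ * (2 ^ L * V)) :
    ∃ D : BlockCode k n M, D.PowerConstraint P ∧ ∀ ν, IsTapLaw c r ν →
      D.errorProb ν ≤ 2 / (γ * P * (|c a| - r a) ^ 2) * L ^ 2 / n + 2 * τ := by
  have : (0 : ℝ) < L := Nat.cast_pos.2 hL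
  have hn : (0 : ℝ) < n := pos_of_mul_pos_right ((by positivity : _ < _).trans_le hLn) hγ.le
  have hM : 0 < M := (by positivity : 0 < 2 ^ L).trans_le hLM
  obtain ⟨V, hV, hVM, hMV, hVM'⟩ := exists_mul_mem_Icc (Nat.le_self_pow hL.ne' 2) hLM
  obtain ⟨C, hE, hB⟩ := hfam V hVM hV
  have hsn : (s : ℝ) ≤ n := hs.trans (mul_le_of_le_one_left n.cast_nonneg (sub_le_self _ hγ.le))
  obtain ⟨l, rfl⟩ := Nat.exists_eq_add_of_le' (Nat.cast_le.1 hsn)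
  have hl : (k + 1) * L ≤ l := by
    push_cast at hs hLn
    have hle : ((k : ℝ) + 1) * L ≤ l := by linarith
    exact_mod_cast hle
  set N : ℝ := ((l + s : ℕ) : ℝ)
  have hA : 0 < √(γ * N * P / (2 * L)) := Real.sqrt_pos.2 (by positivity)
  obtain ⟨D, hDE, hDerr⟩ := exists_prefixedCode ha hM hl hMV hA hE hB
  simp only [mul_pow, Real.sq_sqrt (show 0 ≤ γ * N * P / (2 * L) by positivity)] at hDE hDerr
  refine ⟨D, D.powerConstraint_of_forall hP.le fun w => ?_, fun ν hν => (hDerr ν hν).trans ?_⟩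
  · -- Leaving a fraction `γ` of the block to the prefix saves enough power for its pulses.
    calc D.enc w ⬝ᵥ D.enc w ≤ L * (γ * N * P / (2 * L)) + s * (P + γ * P / 2) := hDE w
      _ ≤ L * (γ * N * P / (2 * L)) + (1 - γ) * N * (P + γ * P / 2) := by gcongr
      _ = N * P - γ ^ 2 * (N * P) / 2 := by field_simp; ring
      _ ≤ N * P := sub_le_self _ (by positivity)
  · have hgap : 0 < |c a| - r a := sub_pos.2 ha
    have hcount : (2 : ℝ) ^ L * V ≤ 2 * M := by exact_mod_cast hVM'
    have : (0 : ℝ) < M := Nat.cast_pos.2 hM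
    refine add_le_add (le_of_eq (by field_simp)) ?_
    calc (M : ℝ)⁻¹ * (τ * (2 ^ L * V)) ≤ (M : ℝ)⁻¹ * (τ * (2 * M)) := by gcongr
      _ = 2 * τ := by field_simp

theorem exists_code_of_lt_lowerBound (hr : ∀ i, 0 ≤ r i)
    {S : ∀ n : ℕ, Matrix (Fin n) (Fin n) ℝ} (hS : ∀ n, (S n).PosDef)
    (htr : ∀ n, (S n).trace ≤ n * P)
    (hmax : Tendsto (fun n : ℕ => 1 / (n : ℝ) * lamMax (S n)) atTop (𝓝 0))
    (hphi : ∀ n, phi1 c r (S n) < 1) {R' : ℝ} (hR : 0 < R) (hRR' : R < R')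
    (hR' : (R' : EReal) < lowerBound c r S) {τ : ℝ} (hτ : 0 < τ) :
    ∀ᶠ n : ℕ in atTop, ∃ C : BlockCode k n (numMessages n R), C.PowerConstraint P ∧
      ∀ ν, IsTapLaw c r ν → C.errorProb ν ≤ τ := by
  have hP := power_pos hS htr
  have hR'0 : 0 < R' := hR.trans hRR'
  obtain ⟨a, ha⟩ := exists_radius_lt_centre hS hphi
    ((EReal.coe_lt_coe_iff.2 hR'0).trans hR')
  obtain ⟨ρ, hRρ, hρ1⟩ := exists_between ((div_lt_one hR'0).2 hRR')
  have hρ : 0 < ρ := (div_pos hR hR'0).trans hRρ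
  have hγ : 0 < 1 - ρ := sub_pos.2 hρ1
  have : 0 < |c a| - r a := sub_pos.2 ha
  set q₁ := 2 / ((1 - ρ) * P * (|c a| - r a) ^ 2)
  have : 0 < q₁ := by positivity
  have hcast := tendsto_natCast_atTop_atTop (R := ℝ)
  have hfloor : Tendsto (fun n : ℕ => ⌊ρ * (n : ℝ)⌋₊) atTop atTop :=
    tendsto_nat_floor_atTop.comp (hcast.const_mul_atTop hρ)
  filter_upwards [hfloor.eventually (exists_code_family hr hS htr hmax hphi hR'
      (show 0 < (1 - ρ) * P / 2 by positivity) (show 0 < τ / 4 by positivity)),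
    eventually_numMessages_le_floor hR'0.le ((div_lt_iff₀ hR'0).1 hRρ), eventually_gt_atTop 0,
    eventually_exists_bitLength
      (show 0 ≤ (k + 1) / (1 - ρ) + 1 / R by positivity) (show 0 ≤ q₁ / (τ / 2) by positivity)]
    with n hfam hmsg hn ⟨L, hL, hcube, hLn, hLsq⟩
  have hn' : (0 : ℝ) < n := Nat.cast_pos.2 hn
  have hsn : (⌊ρ * (n : ℝ)⌋₊ : ℝ) ≤ (1 - (1 - ρ)) * n :=
    (Nat.floor_le (by positivity)).trans_eq (by ring)
  have hsn' : ⌊ρ * (n : ℝ)⌋₊ ≤ n :=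
    Nat.floor_le_of_le (mul_le_of_le_one_left n.cast_nonneg hρ1.le)
  rw [add_mul] at hLn
  have hLγ : ((k : ℝ) + 1) * L ≤ (1 - ρ) * n := by
    rw [← div_le_iff₀' hγ, mul_div_right_comm]
    exact (le_add_of_nonneg_right (by positivity)).trans hLn
  have hLR : (L : ℝ) ≤ n * R := by
    rw [← div_le_iff₀ hR, ← one_div_mul_eq_div]
    exact (le_add_of_nonneg_left (by positivity)).trans hLn
  have hLτ : q₁ * L ^ 2 / n ≤ τ / 2 := by
    rwa [div_le_iff₀ hn', ← div_le_iff₀' (half_pos hτ), mul_div_right_comm]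
  obtain ⟨D, hD, hDerr⟩ := exists_code_of_family ha hγ hP hL hsn hLγ (two_pow_le_numMessages hLR)
    (τ := τ / 4) (by positivity) fun V hVM hV =>
      hfam V (hVM.trans hmsg) hV L ((Nat.pow_le_pow_left hsn' 3).trans hcube)
  exact ⟨D, hD, fun ν hν => (hDerr ν hν).trans (by linarith)⟩

theorem BlockCode.errorProb_nonneg (C : BlockCode k n M) (ν : Measure (Taps k)) :
    0 ≤ C.errorProb ν :=
  mul_nonneg (by positivity) (Finset.sum_nonneg fun _ _ => measureReal_nonneg)

theorem BlockCode.errorProb_le_one (C : BlockCode k n M) (ν : Measure (Taps k))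
    [IsProbabilityMeasure ν] : C.errorProb ν ≤ 1 :=
  inv_mul_sum_le_of_forall_le zero_le_one fun _ => measureReal_le_one

/-- The code that always sends the zero word and decodes to the first message. -/
def BlockCode.zero (k n : ℕ) {M : ℕ} (hM : 0 < M) : BlockCode k n M where
  enc _ _ := 0
  dec _ := ⟨0, hM⟩
  measurable_dec := measurable_const

theorem BlockCode.zero_powerConstraint (k n : ℕ) (hM : 0 < M) (hP : 0 ≤ P) :
    (BlockCode.zero k n hM).PowerConstraint P :=
  powerConstraint_of_forall _ hP fun _ => by
    simpa [zero, dotProduct] using mul_nonneg n.cast_nonneg hP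

theorem achievable_of_forall_eventually (hP : 0 ≤ P) (hR : 0 ≤ R)
    (h : ∀ τ > 0, ∀ᶠ n : ℕ in atTop, ∃ C : BlockCode k n (numMessages n R),
      C.PowerConstraint P ∧ ∀ ν, IsTapLaw c r ν → C.errorProb ν ≤ τ) : Achievable c r P R := by
  classical
  let HasCode : ℕ → ℕ → Prop := fun n j => ∃ C : BlockCode k n (numMessages n R),
    C.PowerConstraint P ∧ ∀ ν, IsTapLaw c r ν → C.errorProb ν ≤ 1 / ((j : ℝ) + 1)
  have hasCode_zero (n : ℕ) : HasCode n 0 :=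
    ⟨BlockCode.zero k n (numMessages_pos n R), BlockCode.zero_powerConstraint k n _ hP,
      fun ν hν => by
        have := hν.prob
        simpa using BlockCode.errorProb_le_one _ ν⟩
  -- At block length `n`, use the best of the first `n` error levels `1 / (j + 1)`.
  have hasCode_best (n : ℕ) : HasCode n (Nat.findGreatest (HasCode n) n) :=
    Nat.findGreatest_spec n.zero_le (hasCode_zero n)
  choose C hpower herr using hasCode_best
  refine ⟨hR, C, hpower, fun ν hν =>
    tendsto_zero_of_eventually_le (fun n => (C n).errorProb_nonneg ν) fun δ hδ => ?_⟩
  obtain ⟨m, hm⟩ := exists_nat_one_div_lt hδ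
  filter_upwards [h (1 / ((m : ℝ) + 1)) (by positivity), eventually_ge_atTop m] with n hn hmn
  have hle : m ≤ Nat.findGreatest (HasCode n) n := Nat.le_findGreatest hmn hn
  calc (C n).errorProb ν ≤ 1 / ((Nat.findGreatest (HasCode n) n : ℝ) + 1) := herr n ν hν
    _ ≤ 1 / ((m : ℝ) + 1) := by gcongr
    _ ≤ δ := hm.le

theorem achievable_zero (c r : Fin (k + 1) → ℝ) (hP : 0 ≤ P) : Achievable c r P 0 := by
  have hunique (n : ℕ) : Subsingleton (Fin (numMessages n 0)) := by
    rw [numMessages, mul_zero, Real.rpow_zero, Nat.ceil_one]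
    infer_instance
  refine ⟨le_rfl, fun n => BlockCode.zero k n (numMessages_pos n 0),
    fun n => BlockCode.zero_powerConstraint k n _ hP, fun ν _ => ?_⟩
  simp [BlockCode.errorProb, eq_iff_true_of_subsingleton]

theorem lowerBound_le_capacity (hr : ∀ i, 0 ≤ r i)
    {S : ∀ n : ℕ, Matrix (Fin n) (Fin n) ℝ} (hS : ∀ n, (S n).PosDef)
    (htr : ∀ n, (S n).trace ≤ n * P)
    (hmax : Tendsto (fun n : ℕ => 1 / (n : ℝ) * lamMax (S n)) atTop (𝓝 0))
    (hphi : ∀ n, phi1 c r (S n) < 1) : lowerBound c r S ≤ capacity c r P := by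
  have hP := (power_pos hS htr).le
  have hcap {R : ℝ} (hR : Achievable c r P R) : (R : EReal) ≤ capacity c r P :=
    le_sSup (Set.mem_image_of_mem _ hR)
  refine le_of_forall_lt fun x hx => ?_
  obtain ⟨R', hxR', hR'⟩ := EReal.lt_iff_exists_real_btwn.1 hx
  obtain ⟨R, hxR, hRR'⟩ := EReal.lt_iff_exists_real_btwn.1 hxR'
  refine hxR.trans_le ?_
  rcases le_or_gt R 0 with h0 | h0
  · exact (EReal.coe_le_coe_iff.2 h0).trans (hcap (achievable_zero c r hP))
  · exact hcap (achievable_of_forall_eventually hP h0.le fun τ hτ =>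
      exists_code_of_lt_lowerBound hr hS htr hmax hphi h0 (EReal.coe_lt_coe_iff.1 hRR') hR' hτ)

end Coding

end ISI

theorem theorem1 {k : ℕ} (hk : 1 ≤ k) (c r : Fin (k + 1) → ℝ) (hr : ∀ i, 0 ≤ r i) (P : ℝ)
    (S : ∀ n : ℕ, Matrix (Fin n) (Fin n) ℝ)
    (hS : ∀ n, (S n).PosDef)
    (htr : ∀ n, (S n).trace ≤ n * P)
    (hmax : Tendsto (fun n : ℕ => 1 / (n : ℝ) * ISI.lamMax (S n)) atTop (𝓝 0))
    (hphi : ∀ n, ISI.phi1 c r (S n) < 1) :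
    ISI.lowerBound c r S ≤ ISI.capacity c r P ∧
    ∀ R : ℝ, 0 ≤ R → (R : EReal) < ISI.lowerBound c r S →
      ∃ ε : ℝ, 0 < ε ∧ ∃ η : ℕ → ℝ, (∀ n, 0 < η n) ∧
        ∀ ν : Measure (ISI.Taps k), ISI.IsTapLaw c r ν →
          Tendsto (fun n => ISI.ensembleError c (S n) ε (η n) (ISI.numMessages n R) ν)
            atTop (𝓝 0) := by
  exact ⟨ISI.lowerBound_le_capacity hr hS htr hmax hphi,
    fun R _ hR => ISI.tendsto_ensembleError hr hS htr hmax hphi hR⟩
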